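/- **Model.** Fix densities $\lambda_1,\lambda_2>0$, a hole radius $D\ge 0$ and hole angle $\theta_c\in[0,2\pi]$, and put $\lambda_{PHP}=\lambda_2\exp(-\lambda_1\theta_cD^2/2)$. For tiers $k=1$ (MBSs) and $k=2$ (SBSs) fix transmit powers $P_k>0$, main and side lobe gains $M_k>0$, $m_k\ge0$, beamwidths $\theta_k\in[0,2\pi]$ and SINR thresholds $\tau_k>0$; for the user (UE), located at the origin of $\mathbb R^2$, fix gains $M_{UE}>0$, $m_{UE}\ge0$ and a beamwidth $\theta_{UE}\in[0,2\pi]$. For $s\in\{LOS,NLOS\}$ fix path loss exponents $\alpha^s>0$ and Nakagami parameters $\nu^s\in\{1,2,\dots\}$. Let $P^{LOS}:[0,\infty)\to[0,1]$ be non-increasing, $P^{NLOS}=1-P^{LOS}$, and let $\sigma^2\ge0$ be the noise power. Base stations (BSs) are the points of independent homogeneous Poisson point processes (PPPs) in $\mathbb R^2$. Given the locations, the link of a BS at distance $r$ is in state LOS with probability $P^{LOS}(r)$ and NLOS otherwise; the directivity gain $G$ of an interfering BS of tier $k$ takes the values $A_{k,1}=M_kM_{UE}$, $A_{k,2}=M_km_{UE}$,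 $A_{k,3}=m_kM_{UE}$, $A_{k,4}=m_km_{UE}$ with probabilities $P_{k,1}=c_kc_{UE}$, $P_{k,2}=c_k(1-c_{UE})$, $P_{k,3}=(1-c_k)c_{UE}$, $P_{k,4}=(1-c_k)(1-c_{UE})$, where $c_k=\theta_k/2\pi$, $c_{UE}=\theta_{UE}/2\pi$; the channel gain $|h|^2$ in state $s$ is Gamma distributed with shape $\nu^s$ and mean $1$; all these marks are independent across BSs, and the gain marks are independent of the rest. The UE is served by the BS with the largest averaged power $P_kM_kM_{UE}\,r^{-\alpha^s}$. If the serving BS is of tier $k$, state $s$ and distance $x$, then $$SINR=\frac{P_k|h|^2M_kM_{UE}\,x^{-\alpha^s}}{\sigma^2+I},$$ where $I\in[0,\infty]$ is the sum of $P_j|h|^2G\,r^{-\alpha^{s'}}$ over the interfering BSs, and $P_C$ is the probability that $SINR>\tau_k$ with $k$ the tier of the serving BS. **PPP approximations of the small-cell tier.** The MBSs are a PPP of density $\lambda_1$, and the Poisson hole process of SBSs is replaced in one of the following ways. * (A) The serving BS is determined among the MBSs and a PPP of SBSs of density $\lambda_{PHP}$; the interfering BSs are the MBSs and the points of an independent baseline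 PPP of SBSs of density $\lambda_2$ whose averaged power is below that of the serving BS. Put $\lambda^a=(\lambda_1,\lambda_{PHP})$ and $\lambda^I=(\lambda_1,\lambda_2)$. * (B) The SBSs are the baseline PPP of density $\lambda_2$, and all BSs except the serving one interfere. Put $\lambda^a=\lambda^I=(\lambda_1,\lambda_2)$. * (C) The SBSs are a PPP of density $\lambda_{PHP}$, and all BSs except the serving one interfere. Put $\lambda^a=\lambda^I=(\lambda_1,\lambda_{PHP})$. **Theorem.** In each of the cases (A), (B), (C) the following holds. 1. $P_C=\mathbb E\big[T_{\nu^s}(Z)\big]$, where $s$, $k$, $x$ are the state, tier and distance of the serving BS, $Z=\tau_k(\sigma^2+I)/(P_kM_kM_{UE}x^{-\alpha^s})$, and $T_\nu(z)$ is the probability that a Gamma variable with shape $\nu$ and mean $1$ exceeds $z$. 2. If each $T_{\nu^s}(z)$ in 1 is replaced by its standard approximation $1-(1-e^{-\eta^sz})^{\nu^s}$, $\eta^s=\nu^s(\nu^s!)^{-1/\nu^s}$, then the resulting approximation of $P_C$ equals exactly $$\sum_{k=1}^2\ \sum_{s\in\{LOS,NLOS\}}\ \sum_{n=1}^{\nu^s}(-1)^{n+1}\binom{\nu^s}{n}\int_0^\infty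 e^{-\mu_{k,n}^s\sigma^2}\exp\Big(-\sum_{j=1}^2\ \sum_{s'\in\{LOS,NLOS\}}\big[W_j^{s'}(x)+\Lambda_{j,a}^{s'}([0,R_j^{s'}(x)))\big]\Big)\,\Lambda'^{\,s}_{k,a}([0,x))\,dx,$$ where, for $\ast\in\{a,I\}$, $\Lambda_{j,\ast}^{s}([0,r))=2\pi\lambda_j^{\ast}\int_0^r uP^{s}(u)\,du$ and $\Lambda'^{\,s}_{j,\ast}([0,r))$ is its derivative in $r$, $$\mu_{k,n}^s=\frac{n\,\tau_k\,\eta^s}{P_kM_kM_{UE}\,x^{-\alpha^s}},\qquad R_j^{s'}(x)=\Big(\frac{P_j}{P_k}\cdot\frac{M_j}{M_k}\Big)^{1/\alpha^{s'}}x^{\alpha^s/\alpha^{s'}},$$ $$W_j^{s'}(x)=\sum_{g=1}^4P_{j,g}\int_{R_j^{s'}(x)}^\infty F\Big(\nu^{s'},\frac{\mu_{k,n}^sP_jA_{j,g}r^{-\alpha^{s'}}}{\nu^{s'}}\Big)\Lambda'^{\,s'}_{j,I}([0,r))\,dr\in[0,\infty],\qquad F(v,y)=1-\Big(\frac1{1+y}\Big)^{v},$$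 and $e^{-\infty}=0$. The integrals over $x$ converge absolutely. -/

import Mathlib

open MeasureTheory ProbabilityTheory Set
open scoped ENNReal

noncomputable section

namespace MmWave

/-- The plane `ℝ²` with its Euclidean norm; the typical UE sits at the origin. -/
abbrev Plane : Type := EuclideanSpace ℝ (Fin 2)

/-- State of a link: line of sight or not. -/
inductive Link
  | LOS
  | NLOS
  deriving DecidableEq

instance : Fintype Link := ⟨{.LOS, .NLOS}, fun s => by cases s <;> simp⟩

/-- The deterministic parameters of the network. Tier `0` is the macro tier (MBSs, the first tier),
tier `1` is the small-cell tier (SBSs, the second tier). All powers, gains and thresholds are in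
linear scale. -/
structure Params where
  /-- density of the MBSs -/
  dens1 : ℝ
  /-- density of the baseline PPP of SBSs -/
  dens2 : ℝ
  /-- radius of the exclusion sectors around the MBSs -/
  D : ℝ
  /-- central angle of the exclusion sectors -/
  thetaC : ℝ
  /-- transmit powers -/
  P : Fin 2 → ℝ
  /-- main lobe gains of the BSs -/
  M : Fin 2 → ℝ
  /-- side lobe gains of the BSs -/
  m : Fin 2 → ℝ
  /-- beamwidths of the BSs -/
  theta : Fin 2 → ℝ
  /-- main lobe gain of the UE -/
  MUE : ℝ
  /-- side lobe gain of the UE -/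
  mUE : ℝ
  /-- beamwidth of the UE -/
  thetaUE : ℝ
  /-- path loss exponents -/
  alpha : Link → ℝ
  /-- Nakagami parameters -/
  nu : Link → ℕ
  /-- LOS probability as a function of the distance -/
  pLOS : ℝ → ℝ
  /-- thermal noise power `σ²` -/
  noise : ℝ
  /-- SINR thresholds -/
  tau : Fin 2 → ℝ
  dens1_pos : 0 < dens1
  dens2_pos : 0 < dens2
  D_nonneg : 0 ≤ D
  thetaC_mem : thetaC ∈ Icc 0 (2 * Real.pi)
  P_pos : ∀ k, 0 < P k
  M_pos : ∀ k, 0 < M k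
  m_nonneg : ∀ k, 0 ≤ m k
  theta_mem : ∀ k, theta k ∈ Icc 0 (2 * Real.pi)
  MUE_pos : 0 < MUE
  mUE_nonneg : 0 ≤ mUE
  thetaUE_mem : thetaUE ∈ Icc 0 (2 * Real.pi)
  alpha_pos : ∀ s, 0 < alpha s
  nu_pos : ∀ s, 0 < nu s
  pLOS_anti : AntitoneOn pLOS (Ici 0)
  pLOS_mem : ∀ r, 0 ≤ r → pLOS r ∈ Icc (0 : ℝ) 1
  noise_nonneg : 0 ≤ noise
  tau_pos : ∀ k, 0 < tau k

namespace Params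

variable (p : Params)

/-- Equivalent density `λ_PHP` of the Poisson hole process of SBSs. -/
def densPHP : ℝ := p.dens2 * Real.exp (-(p.dens1 * p.thetaC * p.D ^ 2 / 2))

/-- Probability that a link of length `r` is in state `s`. -/
def prob : Link → ℝ → ℝ
  | .LOS, r => p.pLOS r
  | .NLOS, r => 1 - p.pLOS r

/-- Probability that an interfering BS of tier `k` shows its main lobe to the UE. -/
def c (k : Fin 2) : ℝ := p.theta k / (2 * Real.pi)

/-- Probability that the UE shows its main lobe to an interfering BS. -/
def cUE : ℝ := p.thetaUE / (2 * Real.pi)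

/-- Values `A_{k,g}` of the directivity gain (`g = 0, 1, 2, 3` here). -/
def gainValue (k : Fin 2) : Fin 4 → ℝ :=
  ![p.M k * p.MUE, p.M k * p.mUE, p.m k * p.MUE, p.m k * p.mUE]

/-- Probabilities `P_{k,g}` of the values of the directivity gain. -/
def gainProb (k : Fin 2) : Fin 4 → ℝ :=
  ![p.c k * p.cUE, p.c k * (1 - p.cUE), (1 - p.c k) * p.cUE, (1 - p.c k) * (1 - p.cUE)]

end Params

/-! ### Poisson point processes -/

/-- Number of points of the enumerated random point set `X 0, X 1, …` in `B`. -/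
def pointCount {Ω E : Type*} (X : ℕ → Ω → E) (B : Set E) (ω : Ω) : ℕ∞ :=
  {i | X i ω ∈ B}.encard

/-- The enumerated random point set `X` is a Poisson point process with intensity measure `μ`:
the number of points in a set of finite intensity is Poisson, and the numbers of points in
disjoint sets are independent. -/
structure IsPoissonProcess {Ω E : Type*} [MeasurableSpace Ω] [MeasurableSpace E]
    (X : ℕ → Ω → E) (μ : Measure E) (Pr : Measure Ω) : Prop where
  measurable : ∀ i, Measurable (X i)
  count_law : ∀ B, MeasurableSet B → μ B ≠ ∞ → ∀ n : ℕ,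
    Pr {ω | pointCount X B ω = n} = poissonMeasure (μ B).toNNReal {n}
  count_indep : ∀ (N : ℕ) (B : Fin N → Set E), (∀ a, MeasurableSet (B a)) →
    Pairwise (fun a b => Disjoint (B a) (B b)) → iIndepFun (fun a => pointCount X (B a)) Pr

/-! ### Networks of marked point processes -/

/-- The random objects of a network whose BSs form point processes indexed by `T`:
locations of the BSs and, for each BS, the marks that determine its blocking, the directivity gain
of its link to the UE when it interferes, and its fading gain in either link state. -/
structure Network (T : Type) (Ω : Type*) where
  loc : T → ℕ → Ω → Plane
  block : T → ℕ → Ω → ℝ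
  gain : T → ℕ → Ω → Fin 4
  fade : T → ℕ → Link → Ω → ℝ

/-- Labels of the independent sources of randomness of a network. -/
inductive Source (T : Type)
  | loc (t : T)
  | block (t : T) (i : ℕ)
  | gain (t : T) (i : ℕ)
  | fade (t : T) (i : ℕ) (s : Link)

namespace Network

variable {T : Type} {Ω : Type*}

/-- The σ-algebra generated by each source of randomness. -/
@[reducible]
def sigma (N : Network T Ω) : Source T → MeasurableSpace Ω
  | .loc t => ⨆ i, MeasurableSpace.comap (N.loc t i) inferInstance
  | .block t i => MeasurableSpace.comap (N.block t i) inferInstance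
  | .gain t i => MeasurableSpace.comap (N.gain t i) inferInstance
  | .fade t i s => MeasurableSpace.comap (N.fade t i s) inferInstance

/-- The probabilistic model. The point process `t` consists of BSs of tier `tier t`, and is a
homogeneous PPP of density `dens t`; the point processes are independent of each other, and the
marks are independent of each other and of the locations. Blocking marks are uniform on `[0, 1]`,
the gain mark has the law of the sectored antenna model, and the fading gain in state `s` is a
normalized Gamma variable with parameter `ν^s` (shape `ν^s`, mean one). -/
structure IsModel (p : Params) (tier : T → Fin 2) (dens : T → ℝ)
    [MeasurableSpace Ω] (Pr : Measure Ω) (N : Network T Ω) : Prop where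
  poisson : ∀ t, IsPoissonProcess (N.loc t) (ENNReal.ofReal (dens t) • volume) Pr
  block_meas : ∀ t i, Measurable (N.block t i)
  block_law : ∀ t i, Pr.map (N.block t i) = volume.restrict (Icc (0 : ℝ) 1)
  gain_meas : ∀ t i, Measurable (N.gain t i)
  gain_law : ∀ t i g, Pr {ω | N.gain t i ω = g} = ENNReal.ofReal (p.gainProb (tier t) g)
  fade_meas : ∀ t i s, Measurable (N.fade t i s)
  fade_law : ∀ t i s, Pr.map (N.fade t i s) = gammaMeasure (p.nu s) (p.nu s)
  indep : iIndep N.sigma Pr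

/-- The network that uses the point process `f t` of `N` (with its marks) as its process `t`. -/
def pick {T' : Type} (N : Network T Ω) (f : T' → T) : Network T' Ω where
  loc t := N.loc (f t)
  block t := N.block (f t)
  gain t := N.gain (f t)
  fade t := N.fade (f t)

end Network

/-- A BS of a two-tier network: its tier and its index. -/
abbrev BS : Type := Fin 2 × ℕ

namespace Network

variable {Ω : Type*} (p : Params)

/-- Distance between a BS and the typical UE. -/
def dist (N : Network (Fin 2) Ω) (b : BS) (ω : Ω) : ℝ := ‖N.loc b.1 b.2 ω‖

open Classical in
/-- State of the link between a BS and the typical UE: given the location of the BS, it is LOS with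
probability `P^LOS(r)`. -/
def link (N : Network (Fin 2) Ω) (b : BS) (ω : Ω) : Link :=
  if N.block b.1 b.2 ω ≤ p.pLOS (N.dist b ω) then .LOS else .NLOS

/-- Channel gain `|h|²` between a BS and the typical UE. -/
def chan (N : Network (Fin 2) Ω) (b : BS) (ω : Ω) : ℝ := N.fade b.1 b.2 (N.link p b ω) ω

/-- Long-term averaged power `P M M_UE r^{-α}` received from a BS when beams are aligned. -/
def avgPower (N : Network (Fin 2) Ω) (b : BS) (ω : Ω) : ℝ :=
  p.P b.1 * (p.M b.1 * p.MUE) * N.dist b ω ^ (-p.alpha (N.link p b ω))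

/-- The typical UE is associated with the BS `b`: it is the strongest one in terms of long-term
averaged received power. -/
def IsServing (N : Network (Fin 2) Ω) (b : BS) (ω : Ω) : Prop :=
  ∀ b', b' ≠ b → N.avgPower p b' ω < N.avgPower p b ω

/-- Power `P |h|² G r^{-α}` received from an interfering BS. -/
def rxPower (N : Network (Fin 2) Ω) (b : BS) (ω : Ω) : ℝ :=
  p.P b.1 * N.chan p b ω * p.gainValue b.1 (N.gain b.1 b.2 ω)
    * N.dist b ω ^ (-p.alpha (N.link p b ω))

/-- Total power in `[0, ∞]` received from the interfering BSs in `S`. -/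
def interference (N : Network (Fin 2) Ω) (S : Set BS) (ω : Ω) : ℝ≥0∞ :=
  ∑' b, S.indicator (fun b => ENNReal.ofReal (N.rxPower p b ω)) b

end Network

/-! ### SINR and coverage. Serving BSs are taken from a network `A`, interfering BSs from a network
`B` (which may be `A` itself); `I b ω` is the set of BSs of `B` that interfere when the BS `b` of
`A` is serving. -/

section Coverage

variable {Ω : Type*} (p : Params) (A B : Network (Fin 2) Ω) (I : BS → Ω → Set BS)

/-- SINR in `[0, ∞]` when the serving BS is `b`; the beams of the serving link are aligned. -/
def sinr (b : BS) (ω : Ω) : ℝ≥0∞ :=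
  ENNReal.ofReal
      (p.P b.1 * A.chan p b ω * (p.M b.1 * p.MUE) * A.dist b ω ^ (-p.alpha (A.link p b ω)))
    / (ENNReal.ofReal p.noise + B.interference p (I b ω) ω)

/-- SINR coverage probability: the SINR from the serving BS exceeds the threshold of its tier. -/
def coverageProb [MeasurableSpace Ω] (Pr : Measure Ω) : ℝ≥0∞ :=
  Pr {ω | ∃ b, A.IsServing p b ω ∧ ENNReal.ofReal (p.tau b.1) < sinr p A B I b ω}

/-- Level that the channel gain of the serving link with `b` has to exceed for coverage. -/
def fadeLevel (b : BS) (ω : Ω) : ℝ≥0∞ :=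
  ENNReal.ofReal (p.tau b.1) * (ENNReal.ofReal p.noise + B.interference p (I b ω) ω)
    / ENNReal.ofReal (A.avgPower p b ω)

/-- Coverage probability computed by averaging, over everything but the fading of the serving link,
a function `Q s` that plays the role of the tail of the channel gain in state `s`. -/
def tailCoverage (Q : Link → ℝ≥0∞ → ℝ≥0∞) [MeasurableSpace Ω] (Pr : Measure Ω) : ℝ≥0∞ :=
  ∫⁻ ω, ∑' b, {b | A.IsServing p b ω}.indicator
    (fun b => Q (A.link p b ω) (fadeLevel p A B I b ω)) b ∂Pr

end Coverage

/-- All BSs other than the serving one. -/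
def allOthers {Ω : Type*} (b : BS) (_ω : Ω) : Set BS := {b' | b' ≠ b}

/-- All BSs of `B` whose averaged received power is below that of the serving BS `b` of `A`, i.e.
those outside the exclusion region imposed by the association rule. -/
def allWeaker {Ω : Type*} (p : Params) (A B : Network (Fin 2) Ω) (b : BS) (ω : Ω) : Set BS :=
  {b' | B.avgPower p b' ω < A.avgPower p b ω}

namespace Params

variable (p : Params)

/-- The exact tail `z ↦ P(|h|² > z)` of the normalized Gamma channel gain. -/
def gammaTail (s : Link) (z : ℝ≥0∞) : ℝ≥0∞ :=
  gammaMeasure (p.nu s) (p.nu s) {h | z < ENNReal.ofReal h}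

/-- `η^s = ν^s (ν^s!)^{-1/ν^s}`. -/
def eta (s : Link) : ℝ := p.nu s * ((p.nu s).factorial : ℝ) ^ (-1 / (p.nu s : ℝ))

/-- The standard approximation `z ↦ 1 - (1 - e^{-η^s z})^{ν^s}` of the tail, on `[0, ∞]`. -/
def approxTail (s : Link) (z : ℝ≥0∞) : ℝ≥0∞ :=
  1 - (1 - EReal.exp (-((ENNReal.ofReal (p.eta s) * z : ℝ≥0∞) : EReal))) ^ p.nu s

/-! ### The formula -/

/-- `Λ^s([0, r)) = 2πλ ∫₀^r x P^s(x) dx` for a tier of density `dens`. -/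
def Lam (dens : ℝ) (s : Link) (r : ℝ) : ℝ :=
  2 * Real.pi * dens * ∫ x in (0 : ℝ)..r, x * p.prob s x

/-- `Λ'^s([0, r)) = dΛ^s([0, r))/dr`. -/
def Lam' (dens : ℝ) (s : Link) (r : ℝ) : ℝ := deriv (p.Lam dens s) r

/-- `F(v, x) = 1 - (1 / (1 + x))^v`. -/
def F (v : ℕ) (x : ℝ) : ℝ := 1 - (1 / (1 + x)) ^ v

/-- `μ_{k,n}^s` at serving distance `x`, with `G_{k,0} = M_k M_UE`. -/
def mu (k : Fin 2) (s : Link) (n : ℕ) (x : ℝ) : ℝ :=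
  n * p.tau k * p.eta s / (p.P k * (p.M k * p.MUE) * x ^ (-p.alpha s))

/-- The exclusion radius `R_j^{s'}(x)` when the serving BS is of tier `k` in state `s`. -/
def R (k : Fin 2) (s : Link) (j : Fin 2) (s' : Link) (x : ℝ) : ℝ :=
  (p.P j / p.P k * (p.M j / p.M k)) ^ (1 / p.alpha s') * x ^ (p.alpha s / p.alpha s')

/-- The interference term `W_j^{s'}(x)` in `[0, ∞]` (for serving tier `k`, state `s`, index `n`),
with interfering tiers of densities `densI`. -/
def W (densI : Fin 2 → ℝ) (k : Fin 2) (s : Link) (n : ℕ) (j : Fin 2) (s' : Link) (x : ℝ) : ℝ≥0∞ :=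
  ∑ g : Fin 4, ENNReal.ofReal (p.gainProb j g) * ∫⁻ r in Ioi (p.R k s j s' x),
    ENNReal.ofReal
      (F (p.nu s') (p.mu k s n x * p.P j * p.gainValue j g * r ^ (-p.alpha s') / p.nu s')
        * p.Lam' (densI j) s' r)

/-- The integrand over the serving distance `x`: association and serving distance are computed with
densities `densA`, interference with densities `densI`; `e^{-∞} = 0`. -/
def integrand (densA densI : Fin 2 → ℝ) (k : Fin 2) (s : Link) (n : ℕ) (x : ℝ) : ℝ :=
  Real.exp (-(p.mu k s n x * p.noise))
    * (EReal.exp (-((∑ j : Fin 2, ∑ s' : Link,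
        (p.W densI k s n j s' x + ENNReal.ofReal (p.Lam (densA j) s' (p.R k s j s' x))) : ℝ≥0∞)
          : EReal))).toReal
    * p.Lam' (densA k) s x

/-- The explicit single-integral expression for the coverage probability. -/
def formula (densA densI : Fin 2 → ℝ) : ℝ :=
  ∑ k : Fin 2, ∑ s : Link, ∑ n ∈ Finset.Icc 1 (p.nu s),
    (-1 : ℝ) ^ (n + 1) * ((p.nu s).choose n : ℝ) * ∫ x in Ioi (0 : ℝ), p.integrand densA densI k s n x

end Params

end MmWave

end

noncomputable section

namespace MmWave


/-! ### The exponential `e^{-x}` on `[0, ∞]` -/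

/-! Exact identity. Whether a BS serves, the state of its link and the level its gain must exceed do
not involve the fading gain of that link: a BS is not weaker than itself, so the serving BS is never
among the interferers, even when both networks coincide. Splitting the coverage event over serving
BS and link state (disjoint events, the serving BS being unique) and conditioning on everything but
that one gain replaces the event by the Gamma tail; this is `Network.IsModel.coverageProb_eq`.

Formula. The approximate tail `1 - (1 - e^{-ηz})^ν` is a signed binomial combination of the
exponentials `e^{-nηz}`, and at the fading level `nηz = μ(σ² + I)`. It remains to compute, for each
`k`, `s`, `n`, the mean of the sum over BSs of tier `k` of the serving indicator in state `s` times
`e^{-μ(σ² + I)}`. If every competitor that is not weaker than the candidate receives the exponent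
`∞`, the indicator and the interference merge into a single `e^{-∑ exponent}` over all other points
(`serving_term`). The marks are independent of the locations and of each other, so averaging over
them replaces the factor of a point by its mean (`Network.IsModel.lintegral_servingTerm`). This mean
lies in `[0, 1]`, hence is again some `e^{-g}` with `g` in `[0, ∞]`. The reduced Palm (Mecke)
formula yields an integral over the location of the serving BS of its weight times `exp(-∑ₜ ∫ (1 -
e^{-gₜ}) dμₜ)`. In polar coordinates the inner integral splits at the exclusion radius: the
association part inside is `Λ`, the interference part outside is `W`.

Palm formula. It is derived from the law of the counts alone. Independence over disjoint sets gives
the Laplace functional of step functions, and limits give it in general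
(`IsPoissonProcess.laplace`). Differentiating it in the direction of an indicator inserts a count,
and dividing by the factor of the distinguished point removes that point from the sum. The exponents
needed here may be infinite and depend on the distance of the distinguished point, so truncation,
discretisation of the distance and right-continuity lead to `PoissonFamily.palm_dependent`.

Convergence. The exponent contains `Λ_k^s([0, x))`, since the exclusion radius for the serving tier
and state is `x` itself. The integrand is therefore bounded by `e^{-Λ} Λ'`, whose integral is at
most one.

All three cases are treated at once: a family of point processes is indexed by `T`, and `a, c : Fin
2 → T` select the processes used for association and for interference. -/

/-- `x ↦ e^{-x}` on `[0, ∞]`, with `e^{-∞} = 0`. -/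
def expNeg (x : ℝ≥0∞) : ℝ≥0∞ := EReal.exp (-(x : EReal))

/-- `u ↦ -log u` on `[0, 1]`, with `-log 0 = ∞`. -/
def negLog (u : ℝ≥0∞) : ℝ≥0∞ := (-ENNReal.log u).toENNReal

@[simp] lemma expNeg_zero : expNeg 0 = 1 := by simp [expNeg]

@[simp] lemma expNeg_top : expNeg ∞ = 0 := by simp [expNeg]

lemma expNeg_add (x y : ℝ≥0∞) : expNeg (x + y) = expNeg x * expNeg y := by
  rw [expNeg, expNeg, expNeg, ← EReal.exp_add, EReal.coe_ennreal_add, EReal.neg_add]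
  · rfl
  · left; simp
  · right; simp

lemma expNeg_sum {ι : Type*} (s : Finset ι) (f : ι → ℝ≥0∞) :
    expNeg (∑ i ∈ s, f i) = ∏ i ∈ s, expNeg (f i) := by
  classical
  induction s using Finset.induction_on with
  | empty => simp
  | insert a s ha ih => rw [Finset.sum_insert ha, Finset.prod_insert ha, expNeg_add, ih]

lemma expNeg_le_one (x : ℝ≥0∞) : expNeg x ≤ 1 := by
  rw [expNeg, EReal.exp_le_one_iff, EReal.neg_le, neg_zero]
  exact EReal.coe_ennreal_nonneg x

lemma expNeg_ne_top (x : ℝ≥0∞) : expNeg x ≠ ∞ :=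
  ((expNeg_le_one x).trans_lt ENNReal.one_lt_top).ne

lemma expNeg_antitone : Antitone expNeg := fun x y h => by
  simpa [expNeg, EReal.neg_le_neg_iff] using h

lemma expNeg_eq_zero {x : ℝ≥0∞} : expNeg x = 0 ↔ x = ∞ := by
  simp [expNeg, EReal.neg_eq_bot_iff]

lemma continuous_expNeg : Continuous expNeg :=
  ENNReal.continuous_exp.comp (continuous_neg.comp continuous_coe_ennreal_ereal)

@[fun_prop]
lemma measurable_expNeg : Measurable expNeg := continuous_expNeg.measurable

lemma expNeg_ofReal {x : ℝ} (hx : 0 ≤ x) :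
    expNeg (ENNReal.ofReal x) = ENNReal.ofReal (Real.exp (-x)) := by
  rw [expNeg, EReal.coe_ennreal_ofReal, max_eq_left hx, ← EReal.coe_neg, EReal.exp_coe]

lemma expNeg_natCast_mul (n : ℕ) (x : ℝ≥0∞) : expNeg (n * x) = expNeg x ^ n := by
  induction n with
  | zero => simp
  | succ n ih => rw [Nat.cast_succ, add_mul, one_mul, expNeg_add, ih, pow_succ]

lemma continuous_negLog : Continuous negLog :=
  EReal.continuous_toENNReal.comp (continuous_neg.comp ENNReal.continuous_log)

@[fun_prop]
lemma measurable_negLog : Measurable negLog := continuous_negLog.measurable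

/-- Allowing the exponent `∞` makes every number of `[0, 1]`, including `0`, an exponential.
Averages over marks can thus be turned back into exponents. -/
lemma expNeg_negLog {u : ℝ≥0∞} (hu : u ≤ 1) : expNeg (negLog u) = u := by
  have h : (0 : EReal) ≤ -ENNReal.log u := by
    rw [EReal.le_neg, neg_zero]
    exact ENNReal.log_le_zero_iff.2 hu
  rw [expNeg, negLog, EReal.coe_toENNReal h, neg_neg, ENNReal.exp_log]

/-! ### Products of independent random variables -/

section Independence

variable {Ω : Type*} {mΩ : MeasurableSpace Ω} {Pr : Measure Ω}

/-- The expectation of a product of functions that depend on disjoint groups of independent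
σ-algebras is the product of the expectations. -/
lemma lintegral_prod_of_iIndep {ι κ : Type*} {m : ι → MeasurableSpace Ω} (hm : ∀ i, m i ≤ mΩ)
    (hind : iIndep m Pr) [IsProbabilityMeasure Pr] (S : κ → Set ι)
    (hS : Pairwise fun a b => Disjoint (S a) (S b)) (h : κ → Ω → ℝ≥0∞)
    (hh : ∀ k, Measurable[⨆ i ∈ S k, m i] (h k)) (F : Finset κ) :
    ∫⁻ ω, ∏ k ∈ F, h k ω ∂Pr = ∏ k ∈ F, ∫⁻ ω, h k ω ∂Pr := by
  classical
  induction F using Finset.induction_on with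
  | empty => simp
  | insert a F ha ih =>
    simp_rw [Finset.prod_insert ha]
    have hd : Disjoint (S a) (⋃ k ∈ F, S k) := by
      simp only [Set.disjoint_iUnion_right]
      exact fun k hk => hS (by rintro rfl; exact ha hk)
    rw [← ih]
    refine lintegral_mul_eq_lintegral_mul_lintegral_of_independent_measurableSpace
      (Mf := ⨆ i ∈ S a, m i) (Mg := ⨆ i ∈ ⋃ k ∈ F, S k, m i) (iSup₂_le fun i _ => hm i)
      (iSup₂_le fun i _ => hm i) (indep_iSup_of_disjoint hm hind hd) (hh a) ?_
    refine Finset.measurable_fun_prod _ fun k hk => (hh k).mono ?_ le_rfl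
    exact biSup_mono fun i hi => mem_biUnion (t := S) hk hi

lemma lintegral_prod_of_iIndep' {ι : Type*} {m : ι → MeasurableSpace Ω} (hm : ∀ i, m i ≤ mΩ)
    (hind : iIndep m Pr) [IsProbabilityMeasure Pr] (h : ι → Ω → ℝ≥0∞)
    (hh : ∀ k, Measurable[m k] (h k)) (F : Finset ι) :
    ∫⁻ ω, ∏ k ∈ F, h k ω ∂Pr = ∏ k ∈ F, ∫⁻ ω, h k ω ∂Pr :=
  lintegral_prod_of_iIndep hm hind (fun i => {i})
    (fun a b hab => by simpa using hab) h (fun k => by rw [iSup_singleton]; exact hh k) F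

end Independence

/-! ### The Laplace functional of a Poisson process -/

section Poisson

/-- The link between cardinalities and countable sums, through which counts become measurable and
enter exponential functionals. -/
lemma toENNReal_pointCount {Ω E : Type*} (X : ℕ → Ω → E) (B : Set E) (ω : Ω) :
    ((pointCount X B ω : ℕ∞) : ℝ≥0∞) = ∑' i, B.indicator 1 (X i ω) := by
  rw [pointCount, ← ENNReal.tsum_set_one, tsum_subtype {i | X i ω ∈ B} (fun _ => (1 : ℝ≥0∞))]
  rfl

variable {Ω E : Type*} [MeasurableSpace Ω] [MeasurableSpace E] {Pr : Measure Ω}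

lemma measurable_tsum_comp {X : ℕ → Ω → E} (hX : ∀ i, Measurable (X i)) {g : E → ℝ≥0∞}
    (hg : Measurable g) : Measurable fun ω => ∑' i, g (X i ω) :=
  Measurable.tsum fun i => hg.comp (hX i)

lemma measurable_pointCount {X : ℕ → Ω → E} (hX : ∀ i, Measurable (X i)) {B : Set E}
    (hB : MeasurableSet B) : Measurable (pointCount X B) := by
  refine measurable_to_countable' fun n => ?_
  have h : Measurable fun ω => ((pointCount X B ω : ℕ∞) : ℝ≥0∞) := by
    simp_rw [toENNReal_pointCount]
    exact measurable_tsum_comp hX (measurable_one.indicator hB)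
  convert h (measurableSet_singleton ((n : ℕ∞) : ℝ≥0∞)) using 1
  ext ω
  simp

/-- The probability generating function of the Poisson law, at `q = e^{-w}`. -/
lemma lintegral_poissonMeasure_pow (r : NNReal) (w : ℝ≥0∞) :
    ∫⁻ n, expNeg (w * n) ∂(poissonMeasure r) = expNeg (r * (1 - expNeg w)) := by
  obtain ⟨q, hq⟩ : ∃ q : NNReal, expNeg w = q := ⟨_, (ENNReal.coe_toNNReal (expNeg_ne_top w)).symm⟩
  have hq1 : q ≤ 1 := by have := expNeg_le_one w; rw [hq] at this; exact_mod_cast this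
  have h1 : ∀ n : ℕ, expNeg (w * n) = (q : ℝ≥0∞) ^ n := fun n => by
    rw [mul_comm, expNeg_natCast_mul, hq]
  have hs := hasSum_one_poissonMeasure (r * q)
  have h2 : (r : ℝ≥0∞) * (1 - q) = ENNReal.ofReal (r * (1 - q)) := by
    rw [ENNReal.ofReal_mul r.coe_nonneg, ENNReal.ofReal_sub _ q.coe_nonneg]
    simp
  have hq1' : (q : ℝ) ≤ 1 := by exact_mod_cast hq1
  rw [hq, h2, expNeg_ofReal (mul_nonneg r.coe_nonneg (by linarith)), poissonMeasure,
    lintegral_sum_measure]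
  simp_rw [lintegral_smul_measure, lintegral_dirac, h1, smul_eq_mul]
  -- Tilting: `qⁿ` times the Poisson mass of parameter `r` is a constant times the Poisson mass of
  -- parameter `r q`, and the latter masses sum to one.
  have h3 : ∀ n : ℕ, ENNReal.ofReal (Real.exp (-r) * r ^ n / n.factorial) * (q : ℝ≥0∞) ^ n
      = ENNReal.ofReal (Real.exp (-(r * (1 - q)))) *
        ENNReal.ofReal (Real.exp (-(r * q : NNReal)) * (r * q : NNReal) ^ n / n.factorial) := by
    intro n
    rw [← ENNReal.ofReal_coe_nnreal, ← ENNReal.ofReal_pow q.coe_nonneg, ← ENNReal.ofReal_mul (by positivity),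
      ← ENNReal.ofReal_mul (by positivity)]
    congr 1
    have : Real.exp (-(r * (1 - q) : ℝ)) * Real.exp (-(r * q : ℝ)) = Real.exp (-r) := by
      rw [← Real.exp_add]; congr 1; ring
    push_cast
    rw [← this]; ring
  simp_rw [h3, ENNReal.tsum_mul_left]
  rw [← ENNReal.ofReal_tsum_of_nonneg (fun n => by positivity) hs.summable, hs.tsum_eq]
  simp

variable {X : ℕ → Ω → E} {μ : Measure E} [IsProbabilityMeasure Pr]

lemma IsPoissonProcess.map_pointCount (hX : IsPoissonProcess X μ Pr) {B : Set E}
    (hB : MeasurableSet B) (hμ : μ B ≠ ∞) :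
    Pr.map (pointCount X B) = (poissonMeasure (μ B).toNNReal).map (Nat.cast : ℕ → ℕ∞) := by
  have hm := measurable_pointCount hX.measurable hB
  have hfin : ∀ n : ℕ, Pr.map (pointCount X B) {(n : ℕ∞)}
      = (poissonMeasure (μ B).toNNReal).map (Nat.cast : ℕ → ℕ∞) {(n : ℕ∞)} := by
    intro n
    rw [Measure.map_apply hm (measurableSet_singleton _),
      Measure.map_apply (measurable_of_countable _) (measurableSet_singleton _)]
    have : (Nat.cast : ℕ → ℕ∞) ⁻¹' {(n : ℕ∞)} = {n} := by ext; simp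
    rw [this, ← hX.count_law B hB hμ n]
    rfl
  -- `count_law` prescribes only the finite values; the mass at `⊤` is whatever remains of total
  -- mass one, hence the same for both laws.
  have hp : ∀ (ν : Measure ℕ∞) [IsProbabilityMeasure ν], ν {⊤} = 1 - ∑' n : ℕ, ν {(n : ℕ∞)} := by
    intro ν _
    have : ({⊤} : Set ℕ∞) = (⋃ n : ℕ, {(n : ℕ∞)})ᶜ := by
      ext x
      induction x using ENat.recTopCoe <;> simp
    rw [this, prob_compl_eq_one_sub (MeasurableSet.of_discrete),
      measure_iUnion (fun i j h => by simpa using h) fun _ => measurableSet_singleton _]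
  have : IsProbabilityMeasure (Pr.map (pointCount X B)) :=
    Measure.isProbabilityMeasure_map hm.aemeasurable
  have : IsProbabilityMeasure ((poissonMeasure (μ B).toNNReal).map (Nat.cast : ℕ → ℕ∞)) :=
    Measure.isProbabilityMeasure_map (measurable_of_countable _).aemeasurable
  refine Measure.ext_of_singleton fun x => ?_
  induction x using ENat.recTopCoe with
  | top => rw [hp, hp]; simp_rw [hfin]
  | coe n => exact hfin n

lemma IsPoissonProcess.lintegral_expNeg_count (hX : IsPoissonProcess X μ Pr) {B : Set E}
    (hB : MeasurableSet B) (hμ : μ B ≠ ∞) (w : ℝ≥0∞) :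
    ∫⁻ ω, expNeg (w * (pointCount X B ω : ℝ≥0∞)) ∂Pr = expNeg (μ B * (1 - expNeg w)) := by
  have hm := measurable_pointCount hX.measurable hB
  rw [← lintegral_map (f := fun n : ℕ∞ => expNeg (w * (n : ℝ≥0∞))) (measurable_of_countable _) hm,
    hX.map_pointCount hB hμ, lintegral_map (measurable_of_countable _) (measurable_of_countable _)]
  simp only [ENat.toENNReal_coe]
  rw [lintegral_poissonMeasure_pow, ENNReal.coe_toNNReal hμ]

lemma IsPoissonProcess.ae_count_lt_top (hX : IsPoissonProcess X μ Pr) {B : Set E}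
    (hB : MeasurableSet B) (hμ : μ B ≠ ∞) : ∀ᵐ ω ∂Pr, {i | X i ω ∈ B}.Finite := by
  have hm := measurable_pointCount hX.measurable hB
  have h : ∀ᵐ n ∂(Pr.map (pointCount X B)), n ≠ ⊤ := by
    rw [hX.map_pointCount hB hμ, ae_map_iff (measurable_of_countable _).aemeasurable
      MeasurableSet.of_discrete]
    simp
  filter_upwards [ae_of_ae_map hm.aemeasurable h] with ω hω
  exact Set.encard_ne_top_iff.1 hω

/-- The sum over the points is a linear combination of counts in disjoint sets, so the expectation
factorises into Poisson generating functions. -/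
lemma IsPoissonProcess.laplace_step (hX : IsPoissonProcess X μ Pr) (N : ℕ) (B : Fin N → Set E)
    (hB : ∀ a, MeasurableSet (B a)) (hμ : ∀ a, μ (B a) ≠ ∞)
    (hd : Pairwise (fun a b => Disjoint (B a) (B b))) (w : Fin N → ℝ≥0∞) :
    ∫⁻ ω, expNeg (∑' i, ∑ a, (B a).indicator (fun _ => w a) (X i ω)) ∂Pr
      = expNeg (∑ a, μ (B a) * (1 - expNeg (w a))) := by
  have h1 : ∀ ω, expNeg (∑' i, ∑ a, (B a).indicator (fun _ => w a) (X i ω))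
      = ∏ a, expNeg (w a * (pointCount X (B a) ω : ℝ≥0∞)) := by
    intro ω
    rw [← expNeg_sum, Summable.tsum_finsetSum fun _ _ => ENNReal.summable]
    congr 1
    refine Finset.sum_congr rfl fun a _ => ?_
    rw [toENNReal_pointCount, ← ENNReal.tsum_mul_left]
    refine tsum_congr fun i => ?_
    by_cases h : X i ω ∈ B a <;> simp [h]
  simp_rw [h1]
  rw [lintegral_prod_eq_prod_lintegral_of_indepFun Finset.univ
    (fun a ω => expNeg (w a * (pointCount X (B a) ω : ℝ≥0∞)))
    ((hX.count_indep N B hB hd).comp (fun a (n : ℕ∞) => expNeg (w a * (n : ℝ≥0∞)))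
      fun a => measurable_of_countable _)
    (fun a => (measurable_of_countable (fun n : ℕ∞ => expNeg (w a * (n : ℝ≥0∞)))).comp
      (measurable_pointCount hX.measurable (hB a))), expNeg_sum]
  exact Finset.prod_congr rfl fun a _ => hX.lintegral_expNeg_count (hB a) (hμ a) (w a)

lemma IsPoissonProcess.laplace_simple (hX : IsPoissonProcess X μ Pr) (g : SimpleFunc E ℝ≥0∞)
    (hg : ∀ a ≠ 0, μ (g ⁻¹' {a}) ≠ ∞) :
    ∫⁻ ω, expNeg (∑' i, g (X i ω)) ∂Pr = expNeg (∫⁻ x, (1 - expNeg (g x)) ∂μ) := by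
  classical
  -- Only the nonzero level sets are used. The level set of `0` may have infinite intensity, but it
  -- contributes nothing to either side.
  set s := g.range.filter (· ≠ 0) with hs
  let e := s.equivFin.symm
  have hdecomp : ∀ (φ : ℝ≥0∞ → ℝ≥0∞), φ 0 = 0 → ∀ x, φ (g x)
      = ∑ a, (g ⁻¹' {(e a : ℝ≥0∞)}).indicator (fun _ => φ (e a)) x := by
    intro φ hφ x
    rw [e.sum_comp (fun a : s => (g ⁻¹' {(a : ℝ≥0∞)}).indicator (fun _ => φ a) x),
      Finset.sum_coe_sort s (fun a => (g ⁻¹' {a}).indicator (fun _ => φ a) x)]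
    by_cases h : g x = 0
    · rw [h, hφ, Finset.sum_eq_zero]
      intro a ha
      have : a ≠ 0 := (Finset.mem_filter.1 ha).2
      simp [h, this.symm]
    · rw [Finset.sum_eq_single (g x)]
      · simp
      · intro b _ hb
        simp [hb.symm]
      · intro hn
        exact absurd (Finset.mem_filter.2 ⟨SimpleFunc.mem_range_self g x, h⟩) hn
  have key := hX.laplace_step s.card (fun a => g ⁻¹' {(e a : ℝ≥0∞)})
    (fun a => g.measurableSet_preimage _)
    (fun a => hg _ (Finset.mem_filter.1 (e a).2).2)
    (fun a b hab => by
      refine Disjoint.preimage _ ?_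
      simp only [disjoint_singleton, ne_eq, SetLike.coe_eq_coe, EmbeddingLike.apply_eq_iff_eq]
      exact hab) (fun a => (e a : ℝ≥0∞))
  have hid := hdecomp id rfl
  simp only [id] at hid
  rw [lintegral_congr fun ω => congrArg expNeg (tsum_congr fun i => hid (X i ω)), key]
  congr 1
  rw [lintegral_congr (hdecomp (fun y => 1 - expNeg y) (by simp)),
    lintegral_finsetSum _ fun a _ => measurable_const.indicator (g.measurableSet_preimage _)]
  refine Finset.sum_congr rfl fun a _ => ?_
  rw [lintegral_indicator_const (g.measurableSet_preimage _), mul_comm]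

/-- Monotone convergence for counting measure. -/
lemma tendsto_tsum_of_monotone {ι : Type*} {u : ℕ → ι → ℝ≥0∞} {v : ι → ℝ≥0∞}
    (hu : ∀ i, Monotone fun n => u n i)
    (hv : ∀ i, Filter.Tendsto (fun n => u n i) Filter.atTop (nhds (v i))) :
    Filter.Tendsto (fun n => ∑' i, u n i) Filter.atTop (nhds (∑' i, v i)) := by
  let _ : MeasurableSpace ι := ⊤
  simp_rw [← lintegral_count]
  exact lintegral_tendsto_of_tendsto_of_monotone (fun n => measurable_from_top.aemeasurable)
    (ae_of_all _ hu) (ae_of_all _ hv)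

/-- Laplace functional of a Poisson process. -/
lemma IsPoissonProcess.laplace (hX : IsPoissonProcess X μ Pr) [SigmaFinite μ] {g : E → ℝ≥0∞}
    (hg : Measurable g) :
    ∫⁻ ω, expNeg (∑' i, g (X i ω)) ∂Pr = expNeg (∫⁻ x, (1 - expNeg (g x)) ∂μ) := by
  classical
  -- Restricting to the spanning sets gives the level sets finite intensity, as `laplace_simple`
  -- requires, and keeps the approximation increasing to `g`.
  let u : ℕ → SimpleFunc E ℝ≥0∞ := fun n =>
    (SimpleFunc.eapprox g n).restrict (spanningSets μ n)
  have hua : ∀ n x, u n x = (spanningSets μ n).indicator (SimpleFunc.eapprox g n) x := fun n x => by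
    rw [SimpleFunc.restrict_apply _ (measurableSet_spanningSets μ n)]
  have hmono : ∀ x, Monotone fun n => u n x := by
    intro x n m hnm
    simp only [hua, indicator]
    split_ifs with h1 h2
    · exact SimpleFunc.monotone_eapprox g hnm x
    · exact absurd (monotone_spanningSets μ hnm h1) h2
    · exact zero_le
    · exact le_rfl
  have hlim : ∀ x, Filter.Tendsto (fun n => u n x) Filter.atTop (nhds (g x)) := by
    intro x
    refine (SimpleFunc.tendsto_eapprox hg x).congr' ?_
    filter_upwards [Filter.eventually_ge_atTop (spanningSetsIndex μ x)] with n hn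
    rw [hua, indicator_of_mem (mem_spanningSets_of_index_le μ x hn)]
  have hsimple := fun n => hX.laplace_simple (u n) (fun a ha => by
    refine ((measure_mono ?_).trans_lt (measure_spanningSets_lt_top μ n)).ne
    intro x hx
    by_contra hxn
    rw [mem_preimage, mem_singleton_iff, hua, indicator_of_notMem hxn] at hx
    exact ha hx.symm)
  have hL : Filter.Tendsto (fun n => ∫⁻ ω, expNeg (∑' i, u n (X i ω)) ∂Pr) Filter.atTop
      (nhds (∫⁻ ω, expNeg (∑' i, g (X i ω)) ∂Pr)) := by
    refine tendsto_lintegral_of_dominated_convergence (fun _ => 1)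
      (fun n => measurable_expNeg.comp (measurable_tsum_comp hX.measurable (u n).measurable))
      (fun n => ae_of_all _ fun ω => expNeg_le_one _) (by simp) (ae_of_all _ fun ω => ?_)
    exact (continuous_expNeg.tendsto _).comp
      (tendsto_tsum_of_monotone (fun i => hmono _) fun i => hlim _)
  -- The intensity integral may be infinite, so there is no dominating function; `1 - e^{-g}` is
  -- increasing in `g`, and monotone convergence applies.
  have hR : Filter.Tendsto (fun n => expNeg (∫⁻ x, (1 - expNeg (u n x)) ∂μ)) Filter.atTop
      (nhds (expNeg (∫⁻ x, (1 - expNeg (g x)) ∂μ))) := by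
    refine (continuous_expNeg.tendsto _).comp ?_
    refine lintegral_tendsto_of_tendsto_of_monotone
      (fun n => (measurable_const.sub (measurable_expNeg.comp (u n).measurable)).aemeasurable)
      (ae_of_all _ fun x n m hnm => tsub_le_tsub_left (expNeg_antitone (hmono x hnm)) _)
      (ae_of_all _ fun x => ?_)
    exact ENNReal.Tendsto.sub tendsto_const_nhds
      ((continuous_expNeg.tendsto _).comp (hlim x)) (Or.inl ENNReal.one_ne_top)
  simp_rw [hsimple] at hL
  exact tendsto_nhds_unique hL hR

end Poisson


/-! ### Reduced Palm formula -/

section Palm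

variable {Ω E : Type*} [MeasurableSpace Ω] [MeasurableSpace E] {Pr : Measure Ω}
  [IsProbabilityMeasure Pr]

/-- The sequence `1 - 1 / (n + 1)`, which increases to `1`. -/
def ratio (n : ℕ) : ℝ≥0∞ := 1 - ((n : ℝ≥0∞) + 1)⁻¹

lemma inv_add_one_le_one (n : ℕ) : ((n : ℝ≥0∞) + 1)⁻¹ ≤ 1 := by
  rw [ENNReal.inv_le_one]; exact le_add_self

lemma ratio_le_one (n : ℕ) : ratio n ≤ 1 := tsub_le_self

lemma one_sub_ratio (n : ℕ) : 1 - ratio n = ((n : ℝ≥0∞) + 1)⁻¹ :=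
  ENNReal.sub_sub_cancel ENNReal.one_ne_top (inv_add_one_le_one n)

lemma ratio_mono : Monotone ratio := fun n m h => by
  refine tsub_le_tsub_left (ENNReal.inv_le_inv.2 ?_) _
  gcongr

lemma tendsto_ratio : Filter.Tendsto ratio Filter.atTop (nhds 1) := by
  have h : Filter.Tendsto (fun n : ℕ => ((n : ℝ≥0∞) + 1)⁻¹) Filter.atTop (nhds 0) := by
    have := (Filter.tendsto_add_atTop_iff_nat 1).2 ENNReal.tendsto_inv_nat_nhds_zero
    simpa using this
  have := ENNReal.Tendsto.sub (tendsto_const_nhds (x := (1 : ℝ≥0∞))) h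
    (Or.inl ENNReal.one_ne_top)
  rwa [tsub_zero] at this

/-- With `q = ratio n`, the geometric sum is the difference quotient `(1 - q^N) / (1 - q)`. It tends
to `N` as `q → 1`, which expresses a count through generating functions. -/
lemma geom_sum_ratio (n N : ℕ) :
    ((n : ℝ≥0∞) + 1)⁻¹ * ∑ k ∈ Finset.range N, ratio n ^ k + ratio n ^ N = 1 := by
  induction N with
  | zero => simp
  | succ N ih =>
    have h : ((n : ℝ≥0∞) + 1)⁻¹ + ratio n = 1 := add_tsub_cancel_of_le (inv_add_one_le_one n)
    rw [Finset.sum_range_succ, mul_add, pow_succ, add_assoc]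
    nth_rewrite 3 [← ih]
    congr 1
    rw [mul_comm, ← mul_add, h, mul_one]

/-- These are the difference quotients at `0` of `x ↦ -e^{-mx}` along `x = 1 / (n + 1)`. -/
lemma tendsto_mul_one_sub_exp (m : ℝ) :
    Filter.Tendsto (fun n : ℕ => ((n : ℝ) + 1) * (1 - Real.exp (-(m * ((n : ℝ) + 1)⁻¹))))
      Filter.atTop (nhds m) := by
  have hd : HasDerivAt (fun x : ℝ => -Real.exp (-(m * x))) m 0 := by
    have h := (((hasDerivAt_id (0 : ℝ)).const_mul m).fun_neg.exp).fun_neg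
    simpa using h
  have ht : Filter.Tendsto (fun n : ℕ => ((n : ℝ) + 1)⁻¹) Filter.atTop (nhdsWithin 0 {0}ᶜ) := by
    refine tendsto_nhdsWithin_iff.2 ⟨?_, Filter.Eventually.of_forall fun n => ?_⟩
    · simpa using tendsto_one_div_add_atTop_nhds_zero_nat (𝕜 := ℝ)
    · have : ((n : ℝ) + 1)⁻¹ ≠ 0 := by positivity
      simpa using this
  refine (hd.tendsto_slope_zero.comp ht).congr fun n => ?_
  simp
  ring_nf
  exact Or.inl trivial

variable {X : ℕ → Ω → E} {μ : Measure E}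

/-- The Laplace functional at `g + (-log q) 1_B` with `q = ratio n`: the curve along which the
functional is differentiated at `q = 1`. -/
lemma IsPoissonProcess.lintegral_ratio_count (hX : IsPoissonProcess X μ Pr) [SigmaFinite μ]
    {g : E → ℝ≥0∞} (hg : Measurable g) {B : Set E} (hB : MeasurableSet B) (n : ℕ) :
    ∫⁻ ω, expNeg (negLog (ratio n) * (pointCount X B ω : ℝ≥0∞)) * expNeg (∑' i, g (X i ω)) ∂Pr
      = expNeg (∫⁻ x, (1 - expNeg (g x)) ∂μ)
        * expNeg (((n : ℝ≥0∞) + 1)⁻¹ * ∫⁻ x in B, expNeg (g x) ∂μ) := by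
  have hm : Measurable fun x => g x + B.indicator (fun _ => negLog (ratio n)) x :=
    hg.add (measurable_const.indicator hB)
  rw [← expNeg_add, ← lintegral_const_mul _ (by fun_prop), ← lintegral_indicator hB,
    ← lintegral_add_right _ (Measurable.indicator (by fun_prop) hB)]
  have h1 : ∀ ω, expNeg (negLog (ratio n) * (pointCount X B ω : ℝ≥0∞)) * expNeg (∑' i, g (X i ω))
      = expNeg (∑' i, (g (X i ω) + B.indicator (fun _ => negLog (ratio n)) (X i ω))) := by
    intro ω
    rw [← expNeg_add, ENNReal.tsum_add, toENNReal_pointCount, ← ENNReal.tsum_mul_left, add_comm]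
    congr 3
    ext i
    by_cases h : X i ω ∈ B <;> simp [h]
  simp_rw [h1]
  rw [hX.laplace hm]
  congr 1
  refine lintegral_congr fun x => ?_
  -- On `B`, with `u = e^{-g}` and `v = q`, this is `1 - u v = (1 - u) + (1 - v) u`.
  by_cases h : x ∈ B
  · simp only [h, indicator_of_mem, expNeg_add, expNeg_negLog (ratio_le_one n),
      ← one_sub_ratio]
    have h1 := expNeg_le_one (g x)
    have h2 := ratio_le_one n
    have h3 := expNeg_ne_top (g x)
    generalize expNeg (g x) = u at *
    generalize ratio n = v at *
    have hv : v ≠ ∞ := (h2.trans_lt ENNReal.one_lt_top).ne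
    lift u to NNReal using h3
    lift v to NNReal using hv
    norm_cast at *
    rw [← NNReal.coe_inj]
    push_cast [NNReal.coe_sub h1, NNReal.coe_sub h2, NNReal.coe_sub (mul_le_one' h1 h2)]
    ring
  · simp [h]

/-- Number of points in `B`, weighted with an exponential functional. -/
lemma IsPoissonProcess.palm_count (hX : IsPoissonProcess X μ Pr) [SigmaFinite μ]
    {g : E → ℝ≥0∞} (hg : Measurable g) {B : Set E} (hB : MeasurableSet B) (hμ : μ B ≠ ∞) :
    ∫⁻ ω, (∑' i, B.indicator 1 (X i ω)) * expNeg (∑' i, g (X i ω)) ∂Pr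
      = (∫⁻ x in B, expNeg (g x) ∂μ) * expNeg (∫⁻ x, (1 - expNeg (g x)) ∂μ) := by
  set C := expNeg (∫⁻ x, (1 - expNeg (g x)) ∂μ) with hC
  have hCtop : C ≠ ∞ := expNeg_ne_top _
  set m := ∫⁻ x in B, expNeg (g x) ∂μ with hm
  have hmtop : m ≠ ∞ := by
    refine ((lintegral_mono fun x => expNeg_le_one (g x)).trans_lt ?_).ne
    simpa using hμ.lt_top
  have hXi := hX.measurable
  have hG : Measurable fun ω => expNeg (∑' i, g (X i ω)) :=
    measurable_expNeg.comp (measurable_tsum_comp hX.measurable hg)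
  have hcount := measurable_pointCount hX.measurable hB
  -- The difference quotient standing in for the count, to which it increases. `toNat` sends an
  -- infinite count to `0`, which is harmless since the count is almost surely finite.
  set Q : ℕ → Ω → ℝ≥0∞ := fun n ω =>
    ∑ k ∈ Finset.range (pointCount X B ω).toNat, ratio n ^ k with hQ
  have hQm : ∀ n, Measurable (Q n) := fun n =>
    (measurable_of_countable
      (fun N : ℕ∞ => ∑ k ∈ Finset.range N.toNat, ratio n ^ k)).comp hcount
  have hfin := hX.ae_count_lt_top hB hμ
  have hQlim : Filter.Tendsto (fun n => ∫⁻ ω, Q n ω * expNeg (∑' i, g (X i ω)) ∂Pr) Filter.atTop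
      (nhds (∫⁻ ω, (∑' i, B.indicator 1 (X i ω)) * expNeg (∑' i, g (X i ω)) ∂Pr)) := by
    refine lintegral_tendsto_of_tendsto_of_monotone (fun n => ((hQm n).mul hG).aemeasurable)
      (ae_of_all _ fun ω n n' h => ?_) ?_
    · simp only [hQ]
      gcongr
      exact ratio_mono h
    · filter_upwards [hfin] with ω hω
      refine ENNReal.Tendsto.mul_const ?_ (Or.inr (expNeg_ne_top _))
      rw [← toENNReal_pointCount]
      obtain ⟨N, hN⟩ := ENat.ne_top_iff_exists.1 (Set.encard_ne_top_iff.2 hω)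
      have hN' : pointCount X B ω = N := hN.symm
      simp only [hQ, hN', ENat.toNat_natCast, ENat.toENNReal_coe]
      have : (N : ℝ≥0∞) = ∑ k ∈ Finset.range N, 1 ^ k := by simp
      rw [this]
      exact tendsto_finsetSum _ fun k _ => ENNReal.Tendsto.pow tendsto_ratio
  have hval : ∀ n : ℕ, ∫⁻ ω, Q n ω * expNeg (∑' i, g (X i ω)) ∂Pr
      = C * ENNReal.ofReal (((n : ℝ) + 1) * (1 - Real.exp (-(m.toReal * ((n : ℝ) + 1)⁻¹)))) := by
    intro n
    -- The difference quotient is stated additively, so that no truncated subtraction occurs under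
    -- the integral.
    have h1 : ((n : ℝ≥0∞) + 1)⁻¹ * (∫⁻ ω, Q n ω * expNeg (∑' i, g (X i ω)) ∂Pr)
        + C * expNeg (((n : ℝ≥0∞) + 1)⁻¹ * m) = C := by
      rw [← hX.lintegral_ratio_count hg hB n, ← lintegral_const_mul _ (by fun_prop),
        ← lintegral_add_left (by fun_prop), hC, ← hX.laplace hg]
      refine lintegral_congr_ae ?_
      filter_upwards [hfin] with ω hω
      obtain ⟨N, hN⟩ := ENat.ne_top_iff_exists.1 (Set.encard_ne_top_iff.2 hω)
      have hN' : pointCount X B ω = N := hN.symm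
      simp only [hQ, hN', ENat.toNat_natCast, ENat.toENNReal_coe]
      rw [← mul_assoc, ← add_mul, mul_comm (negLog _), expNeg_natCast_mul,
        expNeg_negLog (ratio_le_one n), geom_sum_ratio, one_mul]
    have hn1 : ((n : ℝ≥0∞) + 1)⁻¹ = ENNReal.ofReal (((n : ℝ) + 1)⁻¹) := by
      rw [ENNReal.ofReal_inv_of_pos (by positivity), ENNReal.ofReal_add (by positivity) (by simp)]
      simp
    have hE : expNeg (((n : ℝ≥0∞) + 1)⁻¹ * m)
        = ENNReal.ofReal (Real.exp (-(m.toReal * ((n : ℝ) + 1)⁻¹))) := by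
      conv_lhs => rw [hn1, ← ENNReal.ofReal_toReal hmtop]
      rw [← ENNReal.ofReal_mul (by positivity), expNeg_ofReal (by positivity), mul_comm]
    have hE1 : Real.exp (-(m.toReal * ((n : ℝ) + 1)⁻¹)) ≤ 1 :=
      Real.exp_le_one_iff.2 (by simp; positivity)
    rw [hE] at h1
    have hfinA : C * ENNReal.ofReal (Real.exp (-(m.toReal * ((n : ℝ) + 1)⁻¹))) ≠ ∞ :=
      ENNReal.mul_ne_top hCtop ENNReal.ofReal_ne_top
    have h2 : ((n : ℝ≥0∞) + 1)⁻¹ * (∫⁻ ω, Q n ω * expNeg (∑' i, g (X i ω)) ∂Pr)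
        = C * ENNReal.ofReal (1 - Real.exp (-(m.toReal * ((n : ℝ) + 1)⁻¹))) := by
      rw [ENNReal.eq_sub_of_add_eq hfinA h1, ENNReal.ofReal_sub _ (by positivity),
        ENNReal.mul_sub (fun _ _ => hCtop)]
      simp
    rw [ENNReal.ofReal_mul (by positivity), mul_left_comm, ← h2, ← mul_assoc]
    have : ENNReal.ofReal ((n : ℝ) + 1) = (n : ℝ≥0∞) + 1 := by
      rw [ENNReal.ofReal_add (by positivity) (by simp)]; simp
    rw [this, ENNReal.mul_inv_cancel (by simp) (by simp), one_mul]
  simp_rw [hval] at hQlim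
  refine tendsto_nhds_unique hQlim ?_
  rw [mul_comm m C]
  refine ENNReal.Tendsto.const_mul ?_ (Or.inr hCtop)
  have := (ENNReal.continuous_ofReal.tendsto _).comp (tendsto_mul_one_sub_exp m.toReal)
  rwa [ENNReal.ofReal_toReal hmtop] at this

/-- By `palm_count`, the measure `B ↦ E[#(X ∩ B) e^{-∑ g}]` has density `C e^{-g}` with respect to
`μ`, and `f` is integrated against both expressions. The factor `e^{-g x}` appears because the sum
still contains the distinguished point. -/
lemma IsPoissonProcess.palm (hX : IsPoissonProcess X μ Pr) [SigmaFinite μ]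
    {f g : E → ℝ≥0∞} (hf : Measurable f) (hg : Measurable g) :
    ∫⁻ ω, (∑' i, f (X i ω)) * expNeg (∑' i, g (X i ω)) ∂Pr
      = (∫⁻ x, f x * expNeg (g x) ∂μ) * expNeg (∫⁻ x, (1 - expNeg (g x)) ∂μ) := by
  have hXi := hX.measurable
  have hG : Measurable fun ω => expNeg (∑' i, g (X i ω)) :=
    measurable_expNeg.comp (measurable_tsum_comp hX.measurable hg)
  set C := expNeg (∫⁻ x, (1 - expNeg (g x)) ∂μ) with hC
  set D := Pr.withDensity fun ω => expNeg (∑' i, g (X i ω)) with hD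
  -- Both measures are compared inside the spanning sets, where the intensity is finite and
  -- `palm_count` applies.
  have hkey : Measure.sum (fun i => D.map (X i)) = C • μ.withDensity fun x => expNeg (g x) := by
    refine Measure.ext_of_iUnion_eq_univ (s := spanningSets μ) (iUnion_spanningSets μ) fun n => ?_
    ext B hB
    have hB' := hB.inter (measurableSet_spanningSets μ n)
    rw [Measure.restrict_apply hB, Measure.restrict_apply hB, Measure.smul_apply, smul_eq_mul,
      withDensity_apply _ hB', mul_comm, hC, ← hX.palm_count hg hB'
        ((measure_mono inter_subset_right).trans_lt (measure_spanningSets_lt_top μ n)).ne,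
      Measure.sum_apply _ hB']
    simp_rw [← ENNReal.tsum_mul_right]
    have hind : Measurable ((B ∩ spanningSets μ n).indicator (1 : E → ℝ≥0∞)) :=
      measurable_one.indicator hB'
    rw [lintegral_tsum fun i => by fun_prop]
    refine tsum_congr fun i => ?_
    rw [Measure.map_apply (hX.measurable i) hB', hD,
      withDensity_apply _ ((hX.measurable i) hB'), ← lintegral_indicator ((hX.measurable i) hB')]
    refine lintegral_congr fun ω => ?_
    have h : (X i ⁻¹' (B ∩ spanningSets μ n)).indicator
        (fun a => expNeg (∑' i, g (X i a))) ω
        = (B ∩ spanningSets μ n).indicator (fun _ => expNeg (∑' i, g (X i ω))) (X i ω) := rfl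
    rw [h]
    by_cases h : X i ω ∈ B ∩ spanningSets μ n
    · rw [indicator_of_mem h, indicator_of_mem h]; simp
    · rw [indicator_of_notMem h, indicator_of_notMem h]; simp
  have h1 := congrArg (fun ν => ∫⁻ x, f x ∂ν) hkey
  simp only [lintegral_sum_measure, lintegral_smul_measure, smul_eq_mul] at h1
  rw [lintegral_withDensity_eq_lintegral_mul _ (by fun_prop) hf] at h1
  simp only [Pi.mul_apply] at h1
  simp_rw [mul_comm (f _), mul_comm _ C]
  rw [← h1]
  simp_rw [mul_comm _ (expNeg (∑' i, g (X i _))), ← ENNReal.tsum_mul_left]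
  rw [lintegral_tsum fun i => by fun_prop]
  refine tsum_congr fun i => ?_
  rw [lintegral_map hf (hX.measurable i), hD,
    lintegral_withDensity_eq_lintegral_mul _ hG (by fun_prop)]
  rfl

end Palm


/-! ### Sums with one index removed -/

/-- Sum of `G` over all indices except `b₀`. -/
def restSum {ι : Type*} (b₀ : ι) (G : ι → ℝ≥0∞) : ℝ≥0∞ := ∑' b, ({b₀}ᶜ : Set ι).indicator G b

lemma add_restSum {ι : Type*} (b₀ : ι) (G : ι → ℝ≥0∞) : G b₀ + restSum b₀ G = ∑' b, G b := by
  classical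
  rw [restSum, ENNReal.tsum_eq_add_tsum_ite (f := G) b₀]
  congr 1
  refine tsum_congr fun b => ?_
  by_cases h : b = b₀ <;> simp [h]

lemma measurable_restSum {ι Ω : Type*} [Countable ι] [MeasurableSpace Ω] {b₀ : ι}
    {G : ι → Ω → ℝ≥0∞} (hG : ∀ b, Measurable (G b)) :
    Measurable fun ω => restSum b₀ fun b => G b ω := by
  refine Measurable.tsum fun b => ?_
  by_cases hb : b = b₀ <;> simp [hb, hG]

lemma tsum_of_finite_support {ι : Type*} {G : ι → ℝ≥0∞} {F : Set ι} (hF : F.Finite)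
    (h : ∀ b ∉ F, G b = 0) : ∑' b, G b = ∑ b ∈ hF.toFinset, G b :=
  tsum_eq_sum fun b hb => h b (by simpa using hb)

/-- Dominated convergence for counting measure. -/
lemma tendsto_tsum_of_dominated {ι : Type*} {u : ℕ → ι → ℝ≥0∞} {v bound : ι → ℝ≥0∞}
    (hb : ∑' i, bound i ≠ ∞) (hu : ∀ n i, u n i ≤ bound i)
    (hv : ∀ i, Filter.Tendsto (fun n => u n i) Filter.atTop (nhds (v i))) :
    Filter.Tendsto (fun n => ∑' i, u n i) Filter.atTop (nhds (∑' i, v i)) := by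
  let _ : MeasurableSpace ι := ⊤
  simp_rw [← lintegral_count] at hb ⊢
  exact tendsto_lintegral_of_dominated_convergence bound (fun n => measurable_from_top)
    (fun n => ae_of_all _ (hu n)) hb (ae_of_all _ hv)

/-! ### Palm formulas for independent Poisson processes -/

section

variable {Ω E T : Type*} {mΩ : MeasurableSpace Ω} [MeasurableSpace E] {Pr : Measure Ω}
  [IsProbabilityMeasure Pr] [Fintype T] {X : T → ℕ → Ω → E} {μ : T → Measure E}
  [∀ t, SigmaFinite (μ t)]

/-- Independent Poisson processes `X t` with intensity measures `μ t`. -/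
structure PoissonFamily (X : T → ℕ → Ω → E) (μ : T → Measure E) (Pr : Measure Ω) : Prop where
  poisson : ∀ t, IsPoissonProcess (X t) (μ t) Pr
  indep : iIndep (fun t => ⨆ i, MeasurableSpace.comap (X t i) inferInstance) Pr

/-- Only the process `κ` carries the sum of `f`. Independence separates its Palm formula from the
Laplace functionals of the other processes. -/
lemma PoissonFamily.palm (hX : PoissonFamily X μ Pr) (κ : T) {f : E → ℝ≥0∞} (hf : Measurable f)
    {g : T → E → ℝ≥0∞} (hg : ∀ t, Measurable (g t)) :
    ∫⁻ ω, (∑' i, f (X κ i ω)) * expNeg (∑' b : T × ℕ, g b.1 (X b.1 b.2 ω)) ∂Pr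
      = (∫⁻ x, f x * expNeg (g κ x) ∂(μ κ))
        * expNeg (∑ t, ∫⁻ x, (1 - expNeg (g t x)) ∂(μ t)) := by
  classical
  have hle : ∀ t, ⨆ i, MeasurableSpace.comap (X t i) inferInstance ≤ mΩ := fun t =>
    iSup_le fun i => ((hX.poisson t).measurable i).comap_le
  have hXm : ∀ t i, Measurable[⨆ i, MeasurableSpace.comap (X t i) inferInstance] (X t i) :=
    fun t i => (comap_measurable (X t i)).mono (le_iSup
      (fun i => MeasurableSpace.comap (X t i) inferInstance) i) le_rfl
  have hgm : ∀ t, Measurable[⨆ i, MeasurableSpace.comap (X t i) inferInstance]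
      fun ω => expNeg (∑' i, g t (X t i ω)) := fun t =>
    measurable_expNeg.comp (@measurable_tsum_comp Ω E (_) _ (X t) (hXm t) _ (hg t))
  have hfm : ∀ t, Measurable[⨆ i, MeasurableSpace.comap (X t i) inferInstance]
      fun ω => ∑' i, f (X t i ω) := fun t =>
    @measurable_tsum_comp Ω E (_) _ (X t) (hXm t) _ hf
  let h : T → Ω → ℝ≥0∞ := fun t ω =>
    if t = κ then (∑' i, f (X t i ω)) * expNeg (∑' i, g t (X t i ω))
    else expNeg (∑' i, g t (X t i ω))
  have hh : ∀ t, Measurable[⨆ i, MeasurableSpace.comap (X t i) inferInstance] (h t) := fun t => by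
    by_cases ht : t = κ
    · subst ht
      simp only [h, if_true]
      exact (hfm t).mul (hgm t)
    · simp only [h, ht, if_false]
      exact hgm t
  have key := lintegral_prod_of_iIndep' hle hX.indep h hh Finset.univ
  have h1 : ∀ ω, ∏ t, h t ω
      = (∑' i, f (X κ i ω)) * expNeg (∑' b : T × ℕ, g b.1 (X b.1 b.2 ω)) := by
    intro ω
    rw [ENNReal.tsum_prod (f := fun t i => g t (X t i ω)),
      tsum_fintype (fun t => ∑' i, g t (X t i ω)), expNeg_sum,
      ← Finset.mul_prod_erase _ _ (Finset.mem_univ κ),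
      ← Finset.mul_prod_erase _ (fun t => expNeg (∑' i, g t (X t i ω))) (Finset.mem_univ κ),
      ← mul_assoc]
    congr 1
    · simp [h]
    · exact Finset.prod_congr rfl fun t ht => by simp [h, Finset.ne_of_mem_erase ht]
  have h2 : ∏ t, ∫⁻ ω, h t ω ∂Pr = (∫⁻ x, f x * expNeg (g κ x) ∂(μ κ))
        * expNeg (∑ t, ∫⁻ x, (1 - expNeg (g t x)) ∂(μ t)) := by
    rw [expNeg_sum, ← Finset.mul_prod_erase _ _ (Finset.mem_univ κ),
      ← Finset.mul_prod_erase _ (fun t => expNeg (∫⁻ x, (1 - expNeg (g t x)) ∂(μ t)))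
        (Finset.mem_univ κ), ← mul_assoc]
    congr 1
    · simp only [h, if_true]
      exact (hX.poisson κ).palm hf (hg κ)
    · refine Finset.prod_congr rfl fun t ht => ?_
      simp only [h, Finset.ne_of_mem_erase ht, if_false]
      exact (hX.poisson t).laplace (hg t)
  rw [← h2, ← key]
  exact lintegral_congr fun ω => (h1 ω).symm

/-- Reduced Palm formula for finite exponents. -/
lemma PoissonFamily.palm_rest (hX : PoissonFamily X μ Pr) (κ : T) {f : E → ℝ≥0∞}
    (hf : Measurable f) {g : T → E → ℝ≥0∞} (hg : ∀ t, Measurable (g t))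
    (hfin : ∀ t x, g t x ≠ ∞) :
    ∫⁻ ω, ∑' i, f (X κ i ω) * expNeg (restSum (κ, i) fun b => g b.1 (X b.1 b.2 ω)) ∂Pr
      = (∫⁻ x, f x ∂(μ κ)) * expNeg (∑ t, ∫⁻ x, (1 - expNeg (g t x)) ∂(μ t)) := by
  have hinv : ∀ t x, (expNeg (g t x))⁻¹ * expNeg (g t x) = 1 := fun t x =>
    ENNReal.inv_mul_cancel (by simp [expNeg_eq_zero, hfin]) (expNeg_ne_top _)
  -- Dividing `f` by the factor of the distinguished point removes that point from the exponent;
  -- finite exponents guarantee that the factor is not zero.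
  have key := hX.palm κ (f := fun x => f x * (expNeg (g κ x))⁻¹) (by fun_prop) hg
  simp_rw [mul_assoc, hinv, mul_one] at key
  rw [← key]
  refine lintegral_congr fun ω => ?_
  rw [← ENNReal.tsum_mul_right]
  refine tsum_congr fun i => ?_
  rw [← add_restSum (κ, i) fun b : T × ℕ => g b.1 (X b.1 b.2 ω), expNeg_add]
  simp only []
  rw [mul_assoc, ← mul_assoc (expNeg _)⁻¹, hinv, one_mul]

lemma measurable_palm_term (hX : ∀ t i, Measurable (X t i)) {κ : T} {f : E → ℝ≥0∞}
    (hf : Measurable f) {ρ : E → ℝ} (hρ : Measurable ρ) {g : T → E → ℝ → ℝ≥0∞}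
    (hg : ∀ t, Measurable (Function.uncurry (g t))) (i : ℕ) :
    Measurable fun ω => f (X κ i ω)
      * expNeg (restSum (κ, i) fun b : T × ℕ => g b.1 (X b.1 b.2 ω) (ρ (X κ i ω))) := by
  have h : Measurable fun ω =>
      restSum (κ, i) fun b : T × ℕ => g b.1 (X b.1 b.2 ω) (ρ (X κ i ω)) :=
    measurable_restSum fun b => (hg b.1).comp
      ((hX b.1 b.2).prodMk (hρ.comp (hX κ i)))
  have := hX κ i
  fun_prop

lemma measurable_palm_value {ρ : E → ℝ} (hρ : Measurable ρ) {g : T → E → ℝ → ℝ≥0∞}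
    (hg : ∀ t, Measurable (Function.uncurry (g t))) :
    Measurable fun x => expNeg (∑ t, ∫⁻ y, (1 - expNeg (g t y (ρ x))) ∂(μ t)) := by
  refine measurable_expNeg.comp (Finset.measurable_fun_sum _ fun t _ => ?_)
  refine Measurable.lintegral_prod_right' (f := fun z : E × E => 1 - expNeg (g t z.2 (ρ z.1))) ?_
  refine measurable_const.sub (measurable_expNeg.comp ?_)
  exact (hg t).comp (measurable_snd.prodMk (hρ.comp measurable_fst))

/-- Reduced Palm formula when the exponents depend on the distinguished point through a function
with countably many values. -/
lemma PoissonFamily.palm_countable (hX : PoissonFamily X μ Pr) (κ : T) {f : E → ℝ≥0∞}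
    (hf : Measurable f) {l : E → ℕ} (hl : Measurable l) {g : T → E → ℕ → ℝ≥0∞}
    (hg : ∀ t n, Measurable fun y => g t y n) (hfin : ∀ t x n, g t x n ≠ ∞) :
    ∫⁻ ω, ∑' i, f (X κ i ω)
        * expNeg (restSum (κ, i) fun b => g b.1 (X b.1 b.2 ω) (l (X κ i ω))) ∂Pr
      = ∫⁻ x, f x * expNeg (∑ t, ∫⁻ y, (1 - expNeg (g t y (l x))) ∂(μ t)) ∂(μ κ) := by
  -- On each level set of `l` the exponents no longer depend on the distinguished point, so
  -- `palm_rest` applies to the restriction of `f` to that level set.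
  have hsplit : ∀ (x : E) (H : ℕ → ℝ≥0∞),
      f x * H (l x) = ∑' n, (l ⁻¹' {n}).indicator f x * H n := by
    intro x H
    rw [tsum_eq_single (l x)]
    · simp
    · intro n hn
      simp [hn.symm]
  have hfn : ∀ n, Measurable ((l ⁻¹' {n}).indicator f) := fun n =>
    hf.indicator (hl (measurableSet_singleton n))
  have hXm := fun t => (hX.poisson t).measurable
  have h1 : ∀ ω, ∑' i, f (X κ i ω)
        * expNeg (restSum (κ, i) fun b => g b.1 (X b.1 b.2 ω) (l (X κ i ω)))
      = ∑' n, ∑' i, (l ⁻¹' {n}).indicator f (X κ i ω)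
        * expNeg (restSum (κ, i) fun b => g b.1 (X b.1 b.2 ω) n) := by
    intro ω
    rw [ENNReal.tsum_comm]
    exact tsum_congr fun i => hsplit _
      fun n => expNeg (restSum (κ, i) fun b => g b.1 (X b.1 b.2 ω) n)
  simp_rw [h1]
  have hmeas : ∀ n i, Measurable fun ω => (l ⁻¹' {n}).indicator f (X κ i ω)
        * expNeg (restSum (κ, i) fun b : T × ℕ => g b.1 (X b.1 b.2 ω) n) := fun n i =>
    measurable_palm_term hXm (hfn n) (ρ := fun _ => 0) measurable_const
      (g := fun t y _ => g t y n) (fun t => (hg t n).comp measurable_fst) i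
  rw [lintegral_tsum fun n => (Measurable.tsum fun i => hmeas n i).aemeasurable]
  simp_rw [fun n => hX.palm_rest κ (hfn n) (fun t => hg t n) (fun t x => hfin t x n)]
  rw [lintegral_congr fun x => hsplit x
      fun n => expNeg (∑ t, ∫⁻ y, (1 - expNeg (g t y n)) ∂(μ t)),
    lintegral_tsum fun n => ((hfn n).mul_const _).aemeasurable]
  exact tsum_congr fun n => (lintegral_mul_const _ (hfn n)).symm

/-- Right endpoints of the cells of the partition of `[0, ∞)` into intervals of length
`1 / (m + 1)`. -/
def cellEnd (m l : ℕ) : ℝ := ((l : ℝ) + 1) / ((m : ℝ) + 1)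

/-- Index of the cell of length `1 / (m + 1)` that contains `r`. -/
def cellIndex (m : ℕ) (r : ℝ) : ℕ := ⌊r * ((m : ℝ) + 1)⌋₊

lemma measurable_cellIndex (m : ℕ) : Measurable (cellIndex m) :=
  Nat.measurable_floor.comp (measurable_id.mul_const _)

/-- Right endpoints approach `r` strictly from above, the side on which the exponents are assumed
continuous. -/
lemma tendsto_cellEnd {r : ℝ} (hr : 0 < r) :
    Filter.Tendsto (fun m => cellEnd m (cellIndex m r)) Filter.atTop (nhdsWithin r (Ioi r)) := by
  have hlt : ∀ m : ℕ, r < cellEnd m (cellIndex m r) := fun m => by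
    rw [cellEnd, cellIndex, lt_div_iff₀ (by positivity)]
    exact Nat.lt_floor_add_one _
  refine tendsto_nhdsWithin_iff.2 ⟨?_, Filter.Eventually.of_forall hlt⟩
  have hup : Filter.Tendsto (fun m : ℕ => r + 1 / ((m : ℝ) + 1)) Filter.atTop (nhds r) := by
    simpa using tendsto_one_div_add_atTop_nhds_zero_nat.const_add r
  refine tendsto_of_tendsto_of_tendsto_of_le_of_le tendsto_const_nhds hup
    (fun m => (hlt m).le) fun m => ?_
  have h := Nat.floor_le (show 0 ≤ r * ((m : ℝ) + 1) by positivity)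
  simp only [cellEnd, cellIndex]
  rw [div_le_iff₀ (by positivity), add_mul, one_div, inv_mul_cancel₀ (by positivity)]
  linarith

lemma PoissonFamily.lintegral_sum (hX : PoissonFamily X μ Pr) (κ : T) {f : E → ℝ≥0∞}
    (hf : Measurable f) : ∫⁻ ω, ∑' i, f (X κ i ω) ∂Pr = ∫⁻ x, f x ∂(μ κ) := by
  have := hX.palm κ hf (g := fun _ _ => 0) (fun _ => measurable_const)
  simpa using this

/-- Reduced Palm formula for exponents supported in a set of finite intensity. -/
lemma PoissonFamily.palm_finite (hX : PoissonFamily X μ Pr) (κ : T) {f : E → ℝ≥0∞}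
    (hf : Measurable f) (hf_fin : ∫⁻ x, f x ∂(μ κ) ≠ ∞) {ρ : E → ℝ} (hρ : Measurable ρ)
    (hfρ : ∀ x, f x ≠ 0 → 0 < ρ x) {g : T → E → ℝ → ℝ≥0∞}
    (hg : ∀ t, Measurable (Function.uncurry (g t)))
    (hgc : ∀ t y r, 0 < r → ContinuousWithinAt (g t y) (Ioi r) r)
    {S : Set E} (hS : MeasurableSet S) (hμS : ∀ t, μ t S ≠ ∞) (hgS : ∀ t, ∀ y ∉ S, ∀ r, g t y r = 0) :
    ∫⁻ ω, ∑' i, f (X κ i ω)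
        * expNeg (restSum (κ, i) fun b => g b.1 (X b.1 b.2 ω) (ρ (X κ i ω))) ∂Pr
      = ∫⁻ x, f x * expNeg (∑ t, ∫⁻ y, (1 - expNeg (g t y (ρ x))) ∂(μ t)) ∂(μ κ) := by
  have hXm := fun t => (hX.poisson t).measurable
  -- The distance is replaced by the right endpoint of its cell, which takes countably many values,
  -- and the exponent is capped at `m`, as `palm_countable` needs it finite.
  let G : ℕ → T → E → ℕ → ℝ≥0∞ := fun m t y n => min (g t y (cellEnd m n)) m
  let L : ℕ → E → ℕ := fun m x => cellIndex m (ρ x)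
  have hL : ∀ m, Measurable (L m) := fun m => (measurable_cellIndex m).comp hρ
  have hGm : ∀ m t n, Measurable fun y => G m t y n := fun m t n =>
    Measurable.min ((hg t).comp (measurable_id.prodMk measurable_const)) measurable_const
  have hGm' : ∀ m t, Measurable (Function.uncurry fun y (x : E) => G m t y (L m x)) := fun m t => by
    refine Measurable.min ((hg t).comp (measurable_fst.prodMk ?_)) measurable_const
    exact (measurable_of_countable (cellEnd m)).comp ((hL m).comp measurable_snd)
  have hGS : ∀ m t, ∀ y ∉ S, ∀ n, G m t y n = 0 := fun m t y hy n => by simp [G, hgS t y hy]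
  have hGlim : ∀ t y r, 0 < r →
      Filter.Tendsto (fun m => G m t y (cellIndex m r)) Filter.atTop (nhds (g t y r)) := by
    intro t y r hr
    have h1 := ((hgc t y r hr).tendsto.comp (tendsto_cellEnd hr)).min ENNReal.tendsto_nat_nhds_top
    simpa using h1
  have hcells := fun m => hX.palm_countable κ hf (hL m) (g := G m) (hGm m)
    fun t x n => (min_lt_of_right_lt (ENNReal.natCast_lt_top m)).ne
  have hcount : ∀ᵐ ω ∂Pr, ∀ t, {i | X t i ω ∈ S}.Finite :=
    ae_all_iff.2 fun t => (hX.poisson t).ae_count_lt_top hS (hμS t)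
  have hsum := hX.lintegral_sum κ hf
  have hsum_fin : ∀ᵐ ω ∂Pr, ∑' i, f (X κ i ω) < ∞ :=
    ae_lt_top (measurable_tsum_comp (hXm κ) hf) (hsum ▸ hf_fin)
  have hmul : ∀ (a u : ℝ≥0∞), a * expNeg u ≤ a := fun a u =>
    mul_le_of_le_one_right zero_le (expNeg_le_one u)
  have hlhs : Filter.Tendsto (fun m => ∫⁻ ω, ∑' i, f (X κ i ω)
        * expNeg (restSum (κ, i) fun b => G m b.1 (X b.1 b.2 ω) (L m (X κ i ω))) ∂Pr) Filter.atTop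
      (nhds (∫⁻ ω, ∑' i, f (X κ i ω)
        * expNeg (restSum (κ, i) fun b => g b.1 (X b.1 b.2 ω) (ρ (X κ i ω))) ∂Pr)) := by
    refine tendsto_lintegral_of_dominated_convergence (fun ω => ∑' i, f (X κ i ω))
      (fun m => Measurable.tsum fun i => ?_)
      (fun m => ae_of_all _ fun ω => ENNReal.tsum_le_tsum fun i => hmul _ _) (hsum ▸ hf_fin) ?_
    · have hr : Measurable fun ω => restSum (κ, i) fun b : T × ℕ =>
          G m b.1 (X b.1 b.2 ω) (L m (X κ i ω)) := measurable_restSum fun b =>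
        (hGm' m b.1).comp ((hXm b.1 b.2).prodMk (hXm κ i))
      exact (hf.comp (hXm κ i)).mul (measurable_expNeg.comp hr)
    · filter_upwards [hcount, hsum_fin] with ω hω hω'
      refine tendsto_tsum_of_dominated hω'.ne (fun m i => hmul _ _) fun i => ?_
      by_cases h0 : f (X κ i ω) = 0
      · simp [h0]
      refine ENNReal.Tendsto.const_mul ((continuous_expNeg.tendsto _).comp ?_)
        (Or.inr ?_)
      -- The approximations are not monotone in `m`, so the limit cannot be exchanged with an
      -- infinite sum in general. Almost surely only finitely many points lie in `S`, and the sum is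
      -- finite.
      · have hF : {b : T × ℕ | X b.1 b.2 ω ∈ S}.Finite := by
          refine (Set.Finite.biUnion (Set.finite_univ (α := T))
            fun t _ => (hω t).image (Prod.mk t)).subset fun b hb => ?_
          exact mem_biUnion (mem_univ b.1) ⟨b.2, hb, rfl⟩
        have hrest : ∀ H : T × ℕ → ℝ≥0∞, (∀ b : T × ℕ, X b.1 b.2 ω ∉ S → H b = 0) →
            restSum (κ, i) H = ∑ b ∈ hF.toFinset, ({(κ, i)}ᶜ : Set (T × ℕ)).indicator H b :=
          fun H hH => tsum_of_finite_support hF fun b hb => by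
            by_cases h : b = (κ, i) <;> simp [h, hH b hb]
        rw [hrest _ fun b hb => hgS b.1 _ hb _]
        simp_rw [fun m => hrest (fun b => G m b.1 (X b.1 b.2 ω) (L m (X κ i ω)))
          fun b hb => hGS m b.1 _ hb _]
        refine tendsto_finsetSum _ fun b _ => ?_
        by_cases h : b = (κ, i)
        · simp [h]
        · simpa [h] using hGlim b.1 _ _ (hfρ _ h0)
      · exact fun h => absurd h ((ENNReal.le_tsum i).trans_lt hω').ne
  have hrhs : Filter.Tendsto (fun m =>
      ∫⁻ x, f x * expNeg (∑ t, ∫⁻ y, (1 - expNeg (G m t y (L m x))) ∂(μ t)) ∂(μ κ)) Filter.atTop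
      (nhds (∫⁻ x, f x * expNeg (∑ t, ∫⁻ y, (1 - expNeg (g t y (ρ x))) ∂(μ t)) ∂(μ κ))) := by
    refine tendsto_lintegral_of_dominated_convergence f (fun m => ?_)
      (fun m => ae_of_all _ fun x => hmul _ _) hf_fin ?_
    · refine hf.mul (measurable_expNeg.comp (Finset.measurable_fun_sum _ fun t _ => ?_))
      refine Measurable.lintegral_prod_right'
        (f := fun z : E × E => 1 - expNeg (G m t z.2 (L m z.1))) ?_
      exact measurable_const.sub (measurable_expNeg.comp ((hGm' m t).comp measurable_swap))
    · filter_upwards [ae_lt_top hf hf_fin] with x hx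
      by_cases h0 : f x = 0
      · simp [h0]
      refine ENNReal.Tendsto.const_mul ((continuous_expNeg.tendsto _).comp ?_) (Or.inr hx.ne)
      refine tendsto_finsetSum _ fun t _ => ?_
      -- The integrand `1 - e^{-G}` is at most one and vanishes off `S`, a set of finite intensity.
      refine tendsto_lintegral_of_dominated_convergence (S.indicator 1)
        (fun m => measurable_const.sub (measurable_expNeg.comp (hGm m t _)))
        (fun m => ae_of_all _ fun y => ?_) ?_ (ae_of_all _ fun y => ?_)
      · by_cases hy : y ∈ S
        · simp [hy]
        · simp [hy, hGS m t y hy]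
      · simpa [lintegral_indicator_one hS] using hμS t
      · exact ENNReal.Tendsto.sub tendsto_const_nhds
          ((continuous_expNeg.tendsto _).comp (hGlim t y _ (hfρ x h0))) (Or.inl ENNReal.one_ne_top)
  simp_rw [hcells] at hlhs
  exact tendsto_nhds_unique hlhs hrhs

end


/-! ### Palm formula without finiteness restrictions -/

section

variable {Ω E T : Type*} {mΩ : MeasurableSpace Ω} [MeasurableSpace E] {Pr : Measure Ω}
  [IsProbabilityMeasure Pr] [Fintype T] {X : T → ℕ → Ω → E} {μ : T → Measure E}
  [∀ t, SigmaFinite (μ t)]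

/-- Cutting the exponents off outside growing sets of finite intensity reduces to `palm_finite`. The
cut-off exponents increase, so monotone convergence handles both the sums over points and the
intensity integrals. -/
lemma PoissonFamily.palm_integrable (hX : PoissonFamily X μ Pr) (κ : T) {f : E → ℝ≥0∞}
    (hf : Measurable f) (hf_fin : ∫⁻ x, f x ∂(μ κ) ≠ ∞) {ρ : E → ℝ} (hρ : Measurable ρ)
    (hfρ : ∀ x, f x ≠ 0 → 0 < ρ x) {g : T → E → ℝ → ℝ≥0∞}
    (hg : ∀ t, Measurable (Function.uncurry (g t)))
    (hgc : ∀ t y r, 0 < r → ContinuousWithinAt (g t y) (Ioi r) r) :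
    ∫⁻ ω, ∑' i, f (X κ i ω)
        * expNeg (restSum (κ, i) fun b => g b.1 (X b.1 b.2 ω) (ρ (X κ i ω))) ∂Pr
      = ∫⁻ x, f x * expNeg (∑ t, ∫⁻ y, (1 - expNeg (g t y (ρ x))) ∂(μ t)) ∂(μ κ) := by
  have hXm := fun t => (hX.poisson t).measurable
  -- Spanning sets of the summed intensity have finite intensity for every process of the family
  -- simultaneously.
  let S : ℕ → Set E := spanningSets (Measure.sum μ)
  have hS : ∀ n, MeasurableSet (S n) := measurableSet_spanningSets _
  have hμS : ∀ n t, μ t (S n) ≠ ∞ := fun n t =>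
    ((Measure.le_sum μ t (S n)).trans_lt (measure_spanningSets_lt_top (Measure.sum μ) n)).ne
  let G : ℕ → T → E → ℝ → ℝ≥0∞ := fun n t y r => (S n).indicator (fun y => g t y r) y
  have hG : ∀ n t, Measurable (Function.uncurry (G n t)) := fun n t => by
    have : Function.uncurry (G n t) = (Prod.fst ⁻¹' S n).indicator (Function.uncurry (g t)) := by
      ext ⟨y, r⟩
      by_cases hy : y ∈ S n <;> simp [G, hy]
    rw [this]
    exact (hg t).indicator (measurable_fst (hS n))
  have hGc : ∀ n t y r, 0 < r → ContinuousWithinAt (G n t y) (Ioi r) r := by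
    intro n t y r hr
    by_cases hy : y ∈ S n
    · have : G n t y = g t y := by ext; simp [G, hy]
      rw [this]
      exact hgc t y r hr
    · have : G n t y = fun _ => 0 := by ext; simp [G, hy]
      rw [this]
      exact continuousWithinAt_const
  have hGmono : ∀ t y r, Monotone fun n => G n t y r := by
    intro t y r n m hnm
    exact indicator_le_indicator_of_subset (monotone_spanningSets _ hnm) (fun _ => zero_le) y
  have hGlim : ∀ t y r, Filter.Tendsto (fun n => G n t y r) Filter.atTop (nhds (g t y r)) := by
    intro t y r
    refine tendsto_const_nhds.congr' ?_
    filter_upwards [Filter.eventually_ge_atTop (spanningSetsIndex (Measure.sum μ) y)] with n hn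
    exact (indicator_of_mem (mem_spanningSets_of_index_le _ y hn) fun y => g t y r).symm
  have hfinite := fun n => hX.palm_finite κ hf hf_fin hρ hfρ (hG n) (hGc n) (hS n) (hμS n)
    fun t y hy r => by simp [G, hy]
  have hsum := hX.lintegral_sum κ hf
  have hsum_fin : ∀ᵐ ω ∂Pr, ∑' i, f (X κ i ω) < ∞ :=
    ae_lt_top (measurable_tsum_comp (hXm κ) hf) (hsum ▸ hf_fin)
  have hmul : ∀ (a u : ℝ≥0∞), a * expNeg u ≤ a := fun a u =>
    mul_le_of_le_one_right zero_le (expNeg_le_one u)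
  have hlhs : Filter.Tendsto (fun n => ∫⁻ ω, ∑' i, f (X κ i ω)
        * expNeg (restSum (κ, i) fun b => G n b.1 (X b.1 b.2 ω) (ρ (X κ i ω))) ∂Pr) Filter.atTop
      (nhds (∫⁻ ω, ∑' i, f (X κ i ω)
        * expNeg (restSum (κ, i) fun b => g b.1 (X b.1 b.2 ω) (ρ (X κ i ω))) ∂Pr)) := by
    refine tendsto_lintegral_of_dominated_convergence (fun ω => ∑' i, f (X κ i ω))
      (fun n => Measurable.tsum fun i => measurable_palm_term hXm hf hρ (hG n) i)
      (fun n => ae_of_all _ fun ω => ENNReal.tsum_le_tsum fun i => hmul _ _) (hsum ▸ hf_fin) ?_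
    filter_upwards [hsum_fin] with ω hω
    refine tendsto_tsum_of_dominated hω.ne (fun m i => hmul _ _) fun i => ?_
    refine ENNReal.Tendsto.const_mul ((continuous_expNeg.tendsto _).comp ?_) (Or.inr ?_)
    · refine tendsto_tsum_of_monotone (fun b n m hnm => ?_) fun b => ?_
      · exact indicator_le_indicator (hGmono b.1 _ _ hnm)
      · by_cases h : b = (κ, i)
        · simp [h]
        · simpa [h] using hGlim b.1 _ _
    · exact ((ENNReal.le_tsum i).trans_lt hω).ne
  have hrhs : Filter.Tendsto (fun n =>
      ∫⁻ x, f x * expNeg (∑ t, ∫⁻ y, (1 - expNeg (G n t y (ρ x))) ∂(μ t)) ∂(μ κ)) Filter.atTop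
      (nhds (∫⁻ x, f x * expNeg (∑ t, ∫⁻ y, (1 - expNeg (g t y (ρ x))) ∂(μ t)) ∂(μ κ))) := by
    refine tendsto_lintegral_of_dominated_convergence f
      (fun n => hf.mul (measurable_palm_value hρ (hG n)))
      (fun m => ae_of_all _ fun x => hmul _ _) hf_fin ?_
    filter_upwards [ae_lt_top hf hf_fin] with x hx
    refine ENNReal.Tendsto.const_mul ((continuous_expNeg.tendsto _).comp ?_) (Or.inr hx.ne)
    refine tendsto_finsetSum _ fun t _ => ?_
    refine lintegral_tendsto_of_tendsto_of_monotone (fun n => ?_)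
      (ae_of_all _ fun y n m hnm => tsub_le_tsub_left (expNeg_antitone (hGmono t y _ hnm)) _)
      (ae_of_all _ fun y => ENNReal.Tendsto.sub tendsto_const_nhds
        ((continuous_expNeg.tendsto _).comp (hGlim t y _)) (Or.inl ENNReal.one_ne_top))
    exact (measurable_const.sub (measurable_expNeg.comp
      ((hG n t).comp (measurable_id.prodMk measurable_const)))).aemeasurable
  simp_rw [hfinite] at hlhs
  exact tendsto_nhds_unique hlhs hrhs

/-- Reduced Palm formula: exponents that depend on the distinguished point through a real
parameter, right-continuously. -/
theorem PoissonFamily.palm_dependent (hX : PoissonFamily X μ Pr) (κ : T) {f : E → ℝ≥0∞}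
    (hf : Measurable f) (hf_le : ∀ x, f x ≤ 1) {ρ : E → ℝ} (hρ : Measurable ρ)
    (hfρ : ∀ x, f x ≠ 0 → 0 < ρ x) {g : T → E → ℝ → ℝ≥0∞}
    (hg : ∀ t, Measurable (Function.uncurry (g t)))
    (hgc : ∀ t y r, 0 < r → ContinuousWithinAt (g t y) (Ioi r) r) :
    ∫⁻ ω, ∑' i, f (X κ i ω)
        * expNeg (restSum (κ, i) fun b => g b.1 (X b.1 b.2 ω) (ρ (X κ i ω))) ∂Pr
      = ∫⁻ x, f x * expNeg (∑ t, ∫⁻ y, (1 - expNeg (g t y (ρ x))) ∂(μ t)) ∂(μ κ) := by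
  have hXm := fun t => (hX.poisson t).measurable
  -- Disjoint pieces of finite intensity: since `f ≤ 1`, its restriction to each piece is
  -- integrable, and the results are summed.
  let D : ℕ → Set E := fun n => spanningSetsIndex (μ κ) ⁻¹' {n}
  have hD : ∀ n, MeasurableSet (D n) := fun n =>
    measurableSet_spanningSetsIndex (μ κ) (measurableSet_singleton n)
  have hDfin : ∀ n, μ κ (D n) ≠ ∞ := fun n => by
    refine ((measure_mono fun x hx => ?_).trans_lt (measure_spanningSets_lt_top (μ κ) n)).ne
    exact mem_spanningSets_of_index_le (μ κ) x (le_of_eq hx)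
  have hsplit : ∀ x, f x = ∑' n, (D n).indicator f x := by
    intro x
    rw [tsum_eq_single (spanningSetsIndex (μ κ) x)]
    · simp [D]
    · intro n hn
      simp [D, hn.symm]
  have hDm := fun n => hf.indicator (hD n)
  have key := fun n => hX.palm_integrable κ (hDm n) (by
      rw [lintegral_indicator (hD n)]
      refine ((lintegral_mono fun x => hf_le x).trans_lt ?_).ne
      simpa using (hDfin n).lt_top) hρ
    (fun x hx => hfρ x fun h => hx (by simp [indicator, h])) hg hgc
  have hl : ∀ ω, ∑' i, f (X κ i ω)
        * expNeg (restSum (κ, i) fun b => g b.1 (X b.1 b.2 ω) (ρ (X κ i ω)))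
      = ∑' n, ∑' i, (D n).indicator f (X κ i ω)
        * expNeg (restSum (κ, i) fun b => g b.1 (X b.1 b.2 ω) (ρ (X κ i ω))) := by
    intro ω
    rw [ENNReal.tsum_comm]
    refine tsum_congr fun i => ?_
    rw [ENNReal.tsum_mul_right, ← hsplit]
  have hr : ∀ x, f x * expNeg (∑ t, ∫⁻ y, (1 - expNeg (g t y (ρ x))) ∂(μ t))
      = ∑' n, (D n).indicator f x * expNeg (∑ t, ∫⁻ y, (1 - expNeg (g t y (ρ x))) ∂(μ t)) := by
    intro x
    rw [ENNReal.tsum_mul_right, ← hsplit]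
  simp_rw [hl, hr]
  rw [lintegral_tsum fun n => (Measurable.tsum fun i =>
      measurable_palm_term hXm (hDm n) hρ hg i).aemeasurable,
    lintegral_tsum fun n => ((hDm n).fun_mul (measurable_palm_value hρ hg)).aemeasurable]
  exact tsum_congr key

end


/-! ### Link states, averaged powers and the exponent of a BS -/

namespace Params

variable (p : Params)

open Classical in
/-- State of a link of length `r` with blocking mark `u`. -/
def linkState (u r : ℝ) : Link := if u ≤ p.pLOS r then .LOS else .NLOS

/-- Averaged power received over an aligned link of tier `k`, state `s` and length `r`. -/
def meanPower (k : Fin 2) (s : Link) (r : ℝ) : ℝ := p.P k * (p.M k * p.MUE) * r ^ (-p.alpha s)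

lemma meanPower_pos (k : Fin 2) (s : Link) {r : ℝ} (hr : 0 < r) : 0 < p.meanPower k s r := by
  have h1 := p.P_pos k
  have h2 := p.M_pos k
  have h3 := p.MUE_pos
  unfold meanPower
  positivity

lemma meanPower_nonneg (k : Fin 2) (s : Link) {r : ℝ} (hr : 0 ≤ r) : 0 ≤ p.meanPower k s r := by
  have h1 := p.P_pos k
  have h2 := p.M_pos k
  have h3 := p.MUE_pos
  unfold meanPower
  positivity

lemma meanPower_zero (k : Fin 2) (s : Link) : p.meanPower k s 0 = 0 := by
  rw [meanPower, Real.zero_rpow (neg_ne_zero.2 (p.alpha_pos s).ne'), mul_zero]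

lemma eta_pos (s : Link) : 0 < p.eta s := by
  have := p.nu_pos s
  have h2 := (p.nu s).factorial_pos
  unfold eta
  positivity

lemma mu_eq (k : Fin 2) (s : Link) (n : ℕ) (r : ℝ) :
    p.mu k s n r = n * p.tau k * p.eta s / p.meanPower k s r := rfl

lemma mu_nonneg (k : Fin 2) (s : Link) (n : ℕ) {r : ℝ} (hr : 0 ≤ r) : 0 ≤ p.mu k s n r := by
  have h1 := p.meanPower_nonneg k s hr
  have h2 := p.eta_pos s
  have h3 := p.tau_pos k
  rw [mu_eq]
  positivity

lemma gainValue_nonneg (k : Fin 2) (g : Fin 4) : 0 ≤ p.gainValue k g := by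
  have h1 := (p.M_pos k).le
  have h2 := p.m_nonneg k
  have h3 := p.MUE_pos.le
  have h4 := p.mUE_nonneg
  fin_cases g <;> simp [gainValue] <;> positivity

open Classical in
/-- Contribution of a BS of tier `j` at distance `r`, with link state `s`, gain mark `q` and fading
gain `h`, to the exponent of the coverage functional: it is infinite if the BS takes part in the
association and is at least as strong as the level `v`; if it interferes and is weaker than `v`, it
is `c` times the power received from it. -/
def stateExponent (v c : ℝ) (isA isI : Prop) (j : Fin 2) (s : Link) (r : ℝ) (q : Fin 4) (h : ℝ) :
    ℝ≥0∞ :=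
  (if isA ∧ ¬ p.meanPower j s r < v then ∞ else 0) +
    (if isI ∧ p.meanPower j s r < v then
      ENNReal.ofReal c * ENNReal.ofReal (p.P j * h * p.gainValue j q * r ^ (-p.alpha s)) else 0)

end Params

/-- The marks of a BS: blocking, gain and fading in either state. -/
abbrev Mark : Type := ℝ × Fin 4 × (Link → ℝ)

/-- The marks of the `i`-th point of the process `t`. -/
def Network.mark {T : Type} {Ω : Type*} (N : Network T Ω) (t : T) (i : ℕ) (ω : Ω) : Mark :=
  (N.block t i ω, N.gain t i ω, fun s => N.fade t i s ω)

/-- The exponent `Params.stateExponent` in terms of location and marks. -/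
def Params.exponent (p : Params) (v c : ℝ) (isA isI : Prop) (j : Fin 2) (y : Plane) (z : Mark) :
    ℝ≥0∞ :=
  p.stateExponent v c isA isI j (p.linkState z.1 ‖y‖) ‖y‖ z.2.1 (z.2.2 (p.linkState z.1 ‖y‖))

open Classical in
/-- Weight of a serving BS of tier `k` at distance `r` with blocking mark `u`. -/
def Params.servingWeight (p : Params) (k : Fin 2) (s : Link) (n : ℕ) (r u : ℝ) : ℝ≥0∞ :=
  if 0 < r ∧ p.linkState u r = s then expNeg (ENNReal.ofReal (p.mu k s n r * p.noise)) else 0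

/-! ### The serving event as an exponential functional -/

section

variable {T : Type} {Ω : Type*} (p : Params) (N : Network T Ω) {tier : T → Fin 2}
  {a c : Fin 2 → T}

lemma avgPower_pick (a : Fin 2 → T) (b : BS) (ω : Ω) : (N.pick a).avgPower p b ω
    = p.meanPower b.1 (p.linkState (N.block (a b.1) b.2 ω) ‖N.loc (a b.1) b.2 ω‖)
      ‖N.loc (a b.1) b.2 ω‖ := rfl

/-- Real powers satisfy `0 ^ (-α) = 0` for `α ≠ 0`, so a BS at the origin has averaged power `0` and
cannot be strictly stronger than another BS. The next index of the same tier provides that other BS.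
-/
lemma IsServing.dist_pos {A : Network (Fin 2) Ω} {b : BS} {ω : Ω} (h : A.IsServing p b ω) :
    0 < A.dist b ω := by
  refine (norm_nonneg _).lt_of_ne fun h0 => ?_
  have h1 := h (b.1, b.2 + 1) fun h => by simpa using congrArg Prod.snd h
  have h2 : A.avgPower p b ω = 0 := by
    have h0' : A.dist b ω = 0 := h0.symm
    have : A.avgPower p b ω = p.meanPower b.1 (A.link p b ω) (A.dist b ω) := rfl
    rw [this, h0', p.meanPower_zero]
  rw [h2] at h1
  exact absurd (p.meanPower_nonneg _ _ (norm_nonneg _)) (not_le.2 h1)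

/-- Scaled fading level in terms of `μ`. -/
lemma fadeLevel_scaled (A B : Network (Fin 2) Ω) (I : BS → Ω → Set BS) (b : BS) (ω : Ω)
    (hd : 0 < A.dist b ω) (n : ℕ) :
    n * (ENNReal.ofReal (p.eta (A.link p b ω)) * fadeLevel p A B I b ω)
      = ENNReal.ofReal (p.mu b.1 (A.link p b ω) n (A.dist b ω) * p.noise)
        + ENNReal.ofReal (p.mu b.1 (A.link p b ω) n (A.dist b ω))
          * B.interference p (I b ω) ω := by
  have hmu := p.mu_nonneg b.1 (A.link p b ω) n hd.le
  have hpow := p.meanPower_pos b.1 (A.link p b ω) hd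
  have h1 : ENNReal.ofReal (p.mu b.1 (A.link p b ω) n (A.dist b ω))
      = n * ENNReal.ofReal (p.eta (A.link p b ω))
        * (ENNReal.ofReal (p.tau b.1) / ENNReal.ofReal (A.avgPower p b ω)) := by
    rw [p.mu_eq, ENNReal.ofReal_div_of_pos hpow, ENNReal.ofReal_mul
      (mul_nonneg (by positivity) (p.tau_pos _).le), ENNReal.ofReal_mul (by positivity),
      ENNReal.ofReal_natCast, div_eq_mul_inv, div_eq_mul_inv]
    have : A.avgPower p b ω = p.meanPower b.1 (A.link p b ω) (A.dist b ω) := rfl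
    rw [this]
    ring
  rw [ENNReal.ofReal_mul hmu, ← mul_add, h1, fadeLevel, div_eq_mul_inv, div_eq_mul_inv]
  ring

-- The key rewriting: a competitor at least as strong as the candidate has exponent `∞`, and `e^{-∞}
-- = 0` reproduces the indicator of the serving event. The remaining exponents add up to `μ I`.
open Classical in
lemma serving_term (ha : Function.LeftInverse tier a) (hc : Function.LeftInverse tier c)
    (k : Fin 2) (i : ℕ) (s : Link) (n : ℕ) (ω : Ω) :
    (if (N.pick a).IsServing p (k, i) ω ∧ (N.pick a).link p (k, i) ω = s then
      expNeg (n * (ENNReal.ofReal (p.eta s) * fadeLevel p (N.pick a) (N.pick c)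
        (allWeaker p (N.pick a) (N.pick c)) (k, i) ω)) else 0)
    = p.servingWeight k s n ‖N.loc (a k) i ω‖ (N.block (a k) i ω)
      * expNeg (restSum (a k, i) fun b : T × ℕ => p.exponent
          (p.meanPower k s ‖N.loc (a k) i ω‖) (p.mu k s n ‖N.loc (a k) i ω‖)
          (b.1 ∈ range a) (b.1 ∈ range c) (tier b.1) (N.loc b.1 b.2 ω) (N.mark b.1 b.2 ω)) := by
  set r := ‖N.loc (a k) i ω‖ with hr
  have hdist : (N.pick a).dist (k, i) ω = r := rfl
  have hlink : (N.pick a).link p (k, i) ω = p.linkState (N.block (a k) i ω) r := rfl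
  by_cases h0 : 0 < r ∧ p.linkState (N.block (a k) i ω) r = s
  swap
  · rw [Params.servingWeight, if_neg h0, zero_mul, if_neg]
    rintro ⟨h1, h2⟩
    have hp := IsServing.dist_pos p h1
    rw [hdist] at hp
    rw [hlink] at h2
    exact h0 ⟨hp, h2⟩
  obtain ⟨hr0, hs⟩ := h0
  rw [Params.servingWeight, hlink, hs, if_pos (⟨hr0, rfl⟩ : 0 < r ∧ s = s)]
  simp only [and_true]
  set v := p.meanPower k s r with hv
  have havg : (N.pick a).avgPower p (k, i) ω = v := by
    rw [avgPower_pick]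
    simp only [← hr, hs, ← hv]
  let pw : T × ℕ → ℝ := fun b => p.meanPower (tier b.1)
    (p.linkState (N.block b.1 b.2 ω) ‖N.loc b.1 b.2 ω‖) ‖N.loc b.1 b.2 ω‖
  have hpwa : ∀ b : BS, (N.pick a).avgPower p b ω = pw (a b.1, b.2) := fun b => by
    simp only [pw, avgPower_pick, ha b.1]
  have hpwc : ∀ b : BS, (N.pick c).avgPower p b ω = pw (c b.1, b.2) := fun b => by
    simp only [pw, avgPower_pick, hc b.1]
  -- `Ga` encodes the association and `Gc` the interference, both on the points of the whole family.
  let Ga : T × ℕ → ℝ≥0∞ := fun b => if b.1 ∈ range a ∧ ¬ pw b < v then ∞ else 0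
  let Gc : T × ℕ → ℝ≥0∞ := fun b => if b.1 ∈ range c ∧ pw b < v then
    ENNReal.ofReal (p.mu k s n r) * ENNReal.ofReal (p.P (tier b.1)
      * N.fade b.1 b.2 (p.linkState (N.block b.1 b.2 ω) ‖N.loc b.1 b.2 ω‖) ω
      * p.gainValue (tier b.1) (N.gain b.1 b.2 ω)
      * ‖N.loc b.1 b.2 ω‖ ^ (-p.alpha (p.linkState (N.block b.1 b.2 ω) ‖N.loc b.1 b.2 ω‖)))
    else 0
  have hG : restSum (a k, i) (fun b : T × ℕ => p.exponent v (p.mu k s n r)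
          (b.1 ∈ range a) (b.1 ∈ range c) (tier b.1) (N.loc b.1 b.2 ω) (N.mark b.1 b.2 ω))
      = restSum (a k, i) Ga + restSum (a k, i) Gc := by
    rw [restSum, restSum, restSum, ← ENNReal.tsum_add]
    refine tsum_congr fun b => ?_
    by_cases h : b = (a k, i)
    · simp [h]
    · have h' : b ∈ ({(a k, i)}ᶜ : Set (T × ℕ)) := h
      rw [indicator_of_mem h', indicator_of_mem h', indicator_of_mem h']
      simp only [Params.exponent, Params.stateExponent, Network.mark, Ga, Gc, pw]
      congr
  -- The serving point is not weaker than itself, so leaving it out does not change the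
  -- interference. This matters when `a` and `c` select the same process.
  have hGc0 : Gc (a k, i) = 0 := by
    refine if_neg ?_
    rintro ⟨-, h⟩
    have : pw (a k, i) = v := by rw [← havg, hpwa]
    exact h.ne this
  have hGc : restSum (a k, i) Gc = ENNReal.ofReal (p.mu k s n r)
      * (N.pick c).interference p (allWeaker p (N.pick a) (N.pick c) (k, i) ω) ω := by
    have h1 := add_restSum (a k, i) Gc
    rw [hGc0, zero_add] at h1
    rw [h1, Network.interference, ← ENNReal.tsum_mul_left]
    have hinj : Function.Injective fun b : BS => (c b.1, b.2) := fun b b' h => by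
      simp only [Prod.mk.injEq] at h
      exact Prod.ext (hc.injective h.1) h.2
    rw [← hinj.tsum_eq (f := Gc) ?_]
    · refine tsum_congr fun b => ?_
      have hmem : b ∈ allWeaker p (N.pick a) (N.pick c) (k, i) ω ↔ pw (c b.1, b.2) < v := by
        rw [← hpwc, ← havg]; rfl
      by_cases hb : pw (c b.1, b.2) < v
      · rw [indicator_of_mem (hmem.2 hb)]
        simp only [Gc, hb, mem_range_self, and_self, if_true, hc b.1]
        rfl
      · rw [indicator_of_notMem fun h => hb (hmem.1 h)]
        simp [Gc, hb]
    · intro b hb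
      have : b.1 ∈ range c ∧ pw b < v := by
        by_contra h
        exact hb (if_neg h)
      obtain ⟨j, hj⟩ := this.1
      exact ⟨(j, b.2), by simp [hj]⟩
  have hserv : (N.pick a).IsServing p (k, i) ω ↔ restSum (a k, i) Ga = 0 := by
    rw [restSum, ENNReal.tsum_eq_zero]
    constructor
    · intro h b
      by_cases hb : b = (a k, i)
      · simp [hb]
      · rw [indicator_of_mem (show b ∈ ({(a k, i)}ᶜ : Set (T × ℕ)) from hb)]
        refine if_neg ?_
        rintro ⟨⟨j, hj⟩, h2⟩
        refine h2 ?_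
        have h3 := h (j, b.2) fun h => hb (by
          simp only [Prod.mk.injEq] at h
          exact Prod.ext (by rw [← hj, h.1]) h.2)
        rw [havg, hpwa] at h3
        simpa [hj] using h3
    · intro h b hb
      have hne : (a b.1, b.2) ∈ ({(a k, i)}ᶜ : Set (T × ℕ)) := fun h => hb (by
        simp only [mem_singleton_iff, Prod.mk.injEq] at h
        exact Prod.ext (ha.injective h.1) h.2)
      have h1 := h (a b.1, b.2)
      rw [indicator_of_mem hne] at h1
      rw [havg, hpwa]
      by_contra h2
      have h3 : Ga (a b.1, b.2) = ∞ := if_pos ⟨mem_range_self _, h2⟩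
      exact absurd (h3.symm.trans h1) ENNReal.top_ne_zero
  have hlev := fadeLevel_scaled p (N.pick a) (N.pick c) (allWeaker p (N.pick a) (N.pick c)) (k, i) ω
    hr0 n
  rw [hlink, hs, hdist] at hlev
  simp only at hlev
  rw [hG, expNeg_add, hGc, hlev, expNeg_add]
  by_cases h : (N.pick a).IsServing p (k, i) ω
  · rw [if_pos h, hserv.1 h]
    simp
  -- Every term of `Ga` is `0` or `∞`, so a nonzero sum is infinite and annihilates the exponential.
  · have htop : restSum (a k, i) Ga = ∞ := by
      have h1 := mt hserv.2 h
      rw [restSum, ENNReal.tsum_eq_zero] at h1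
      push Not at h1
      obtain ⟨b, hb⟩ := h1
      refine ENNReal.tsum_eq_top_of_eq_top ⟨b, ?_⟩
      have hb' : b ∈ ({(a k, i)}ᶜ : Set (T × ℕ)) := by
        by_contra h2
        exact hb (indicator_of_notMem h2 _)
      rw [indicator_of_mem hb'] at hb ⊢
      by_contra h3
      refine hb (if_neg fun h4 => h3 (if_pos h4))
    rw [if_neg h, htop]
    simp

end


/-! ### Laplace transform of the fading gain -/

/-- Exponential tilting maps the Gamma density of rate `ν` to a multiple of the one of rate `ν + x`,
whose integral is one. -/
lemma lintegral_expNeg_gammaMeasure {ν : ℕ} (hν : 0 < ν) {x : ℝ} (hx : 0 ≤ x) :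
    ∫⁻ h, expNeg (ENNReal.ofReal (x * h)) ∂(gammaMeasure ν ν)
      = ENNReal.ofReal ((1 / (1 + x / ν)) ^ ν) := by
  have hν' : (0 : ℝ) < ν := by exact_mod_cast hν
  have hm : Measurable fun h : ℝ => expNeg (ENNReal.ofReal (x * h)) := by fun_prop
  have hpt : ∀ h, gammaPDF ν ν h * expNeg (ENNReal.ofReal (x * h))
      = ENNReal.ofReal ((1 / (1 + x / ν)) ^ ν) * gammaPDF ν (ν + x) h := by
    intro h
    rcases lt_or_ge h 0 with hh | hh
    · simp [gammaPDF_of_neg hh]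
    · rw [gammaPDF_of_nonneg hh, gammaPDF_of_nonneg hh, expNeg_ofReal (mul_nonneg hx hh),
        ← ENNReal.ofReal_mul (by positivity), ← ENNReal.ofReal_mul (by positivity)]
      congr 1
      have h1 : Real.exp (-((ν + x) * h)) = Real.exp (-(ν * h)) * Real.exp (-(x * h)) := by
        rw [← Real.exp_add]; congr 1; ring
      have h2 : (1 / (1 + x / ν)) ^ ν * ((ν : ℝ) + x) ^ (ν : ℝ) = (ν : ℝ) ^ (ν : ℝ) := by
        rw [Real.rpow_natCast, Real.rpow_natCast, ← mul_pow]
        congr 1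
        field_simp
      rw [h1, ← h2]
      ring
  have hpdf : ∀ a r : ℝ, Measurable (gammaPDF a r) := fun a r =>
    (measurable_gammaPDFReal a r).ennreal_ofReal
  rw [gammaMeasure, lintegral_withDensity_eq_lintegral_mul _ (hpdf _ _) hm]
  simp only [Pi.mul_apply, hpt]
  rw [lintegral_const_mul _ (hpdf _ _), lintegral_gammaPDF_eq_one hν' (by positivity), mul_one]

/-! ### Locations and marks -/

/-- The sources of the marks of the `i`-th point of the process `t`. -/
def markSources {T : Type} (b : T × ℕ) : Set (Source T) :=
  {x | x = .block b.1 b.2 ∨ x = .gain b.1 b.2 ∨ ∃ s, x = .fade b.1 b.2 s}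

lemma disjoint_markSources {T : Type} {b b' : T × ℕ} (h : b ≠ b') :
    Disjoint (markSources b) (markSources b') := by
  rw [Set.disjoint_left]
  obtain ⟨t, i⟩ := b
  obtain ⟨t', i'⟩ := b'
  rintro x (rfl | rfl | ⟨s, rfl⟩) (h2 | h2 | ⟨s', h2⟩) <;> cases h2 <;> exact h rfl

namespace Network.IsModel

variable {T : Type} {Ω : Type*} {mΩ : MeasurableSpace Ω} {p : Params}
  {N : Network T Ω} {tier : T → Fin 2} {dens : T → ℝ} {Pr : Measure Ω}

lemma sigma_le (hN : N.IsModel p tier dens Pr) (x : Source T) : N.sigma x ≤ mΩ := by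
  cases x with
  | loc t => exact iSup_le fun i => ((hN.poisson t).measurable i).comap_le
  | block t i => exact (hN.block_meas t i).comap_le
  | gain t i => exact (hN.gain_meas t i).comap_le
  | fade t i s => exact (hN.fade_meas t i s).comap_le

lemma measurable_mark (hN : N.IsModel p tier dens Pr) (t : T) (i : ℕ) :
    Measurable (N.mark t i) :=
  (hN.block_meas t i).prodMk ((hN.gain_meas t i).prodMk
    (measurable_pi_lambda _ fun s => hN.fade_meas t i s))

lemma poissonFamily (hN : N.IsModel p tier dens Pr) :
    PoissonFamily N.loc (fun t => ENNReal.ofReal (dens t) • volume) Pr where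
  poisson := hN.poisson
  indep := hN.indep.precomp (g := Source.loc) fun t t' h => by cases h; rfl

end Network.IsModel

lemma measurable_mark_sources {T : Type} {Ω : Type*} (N : Network T Ω) (b : T × ℕ) :
    Measurable[⨆ x ∈ markSources b, N.sigma x] (N.mark b.1 b.2) := by
  have hle : ∀ x ∈ markSources b, N.sigma x ≤ ⨆ x ∈ markSources b, N.sigma x := fun x hx =>
    le_iSup₂ (f := fun x (_ : x ∈ markSources b) => N.sigma x) x hx
  refine Measurable.prodMk (m := ⨆ x ∈ markSources b, N.sigma x)
    ((comap_measurable _).mono (hle (.block b.1 b.2) (Or.inl rfl)) le_rfl)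
    (Measurable.prodMk (m := ⨆ x ∈ markSources b, N.sigma x)
      ((comap_measurable _).mono (hle (.gain b.1 b.2) (Or.inr (Or.inl rfl))) le_rfl)
      (@measurable_pi_lambda _ _ _ (_) _ _ fun s => (comap_measurable _).mono
        (hle (.fade b.1 b.2 s) (Or.inr (Or.inr ⟨s, rfl⟩))) le_rfl))

namespace Network.IsModel

variable {T : Type} {Ω : Type*} {mΩ : MeasurableSpace Ω} {p : Params}
  {N : Network T Ω} {tier : T → Fin 2} {dens : T → ℝ} {Pr : Measure Ω}

/-- Locations and marks are independent. -/
lemma indepFun_loc_mark (hN : N.IsModel p tier dens Pr) :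
    IndepFun (fun ω (b : T × ℕ) => N.loc b.1 b.2 ω) (fun ω (b : T × ℕ) => N.mark b.1 b.2 ω) Pr := by
  have hd : Disjoint (range (Source.loc (T := T))) (⋃ b, markSources b) := by
    rw [Set.disjoint_left]
    rintro x ⟨t, rfl⟩ hx
    obtain ⟨b, hb | hb | ⟨s, hb⟩⟩ := mem_iUnion.1 hx <;> cases hb
  have h := indep_iSup_of_disjoint hN.sigma_le hN.indep hd
  rw [IndepFun_iff_Indep]
  refine indep_of_indep_of_le_left (indep_of_indep_of_le_right h ?_) ?_
  · rw [← measurable_iff_comap_le]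
    refine @measurable_pi_lambda _ _ _ (_) _ _ fun b => (measurable_mark_sources N b).mono ?_ le_rfl
    exact biSup_mono fun x hx => mem_iUnion.2 ⟨b, hx⟩
  · rw [← measurable_iff_comap_le]
    refine @measurable_pi_lambda _ _ _ (_) _ _ fun b => (comap_measurable _).mono ?_ le_rfl
    exact (le_iSup (fun i => MeasurableSpace.comap (N.loc b.1 i) inferInstance) b.2).trans
      (le_iSup₂ (f := fun x (_ : x ∈ range (Source.loc (T := T))) => N.sigma x)
        (.loc b.1) ⟨b.1, rfl⟩)

variable [IsProbabilityMeasure Pr]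

/-- Expectations can be computed by averaging over the marks first. -/
lemma lintegral_loc_mark (hN : N.IsModel p tier dens Pr)
    {Φ : (T × ℕ → Plane) × (T × ℕ → Mark) → ℝ≥0∞} (hΦ : Measurable Φ) :
    ∫⁻ ω, Φ (fun b => N.loc b.1 b.2 ω, fun b => N.mark b.1 b.2 ω) ∂Pr
      = ∫⁻ ω, ∫⁻ ω', Φ (fun b => N.loc b.1 b.2 ω, fun b => N.mark b.1 b.2 ω') ∂Pr ∂Pr := by
  have hL : Measurable fun ω (b : T × ℕ) => N.loc b.1 b.2 ω :=
    measurable_pi_lambda _ fun b => (hN.poisson b.1).measurable b.2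
  have hK : Measurable fun ω (b : T × ℕ) => N.mark b.1 b.2 ω :=
    measurable_pi_lambda _ fun b => hN.measurable_mark b.1 b.2
  have := Measure.isProbabilityMeasure_map (μ := Pr) hK.aemeasurable
  have h := (indepFun_iff_map_prod_eq_prod_map_map hL.aemeasurable hK.aemeasurable).1
    hN.indepFun_loc_mark
  rw [← lintegral_map hΦ (hL.prodMk hK), h, lintegral_prod _ hΦ.aemeasurable,
    lintegral_map hΦ.lintegral_prod_right' hL]
  exact lintegral_congr fun ω => lintegral_map (hΦ.comp measurable_prodMk_left) hK

/-- Expectation of an exponential functional of the marks. -/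
lemma lintegral_marks [Countable T] (hN : N.IsModel p tier dens Pr) (b₀ : T × ℕ) {h₀ : Mark → ℝ≥0∞}
    (hh₀ : Measurable h₀) (hle : ∀ z, h₀ z ≤ 1) {H : T × ℕ → Mark → ℝ≥0∞}
    (hH : ∀ b, Measurable (H b)) :
    ∫⁻ ω, h₀ (N.mark b₀.1 b₀.2 ω) * expNeg (restSum b₀ fun b => H b (N.mark b.1 b.2 ω)) ∂Pr
      = (∫⁻ ω, h₀ (N.mark b₀.1 b₀.2 ω) ∂Pr)
        * expNeg (restSum b₀ fun b => negLog (∫⁻ ω, expNeg (H b (N.mark b.1 b.2 ω)) ∂Pr)) := by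
  classical
  have hmk : ∀ b : T × ℕ, Measurable (N.mark b.1 b.2) := fun b => hN.measurable_mark b.1 b.2
  have hle1 : ∀ b, ∫⁻ ω, expNeg (H b (N.mark b.1 b.2 ω)) ∂Pr ≤ 1 := fun b =>
    (lintegral_mono fun ω => expNeg_le_one _).trans (by simp)
  -- The exponential of the infinite sum is the limit of finite products; the factor `1` at `b₀`
  -- accounts for the missing index.
  have hlim : ∀ G : T × ℕ → ℝ≥0∞, Filter.Tendsto
      (fun F : Finset (T × ℕ) => ∏ b ∈ F, if b = b₀ then 1 else expNeg (G b)) Filter.atTop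
      (nhds (expNeg (restSum b₀ G))) := by
    intro G
    have h1 : Filter.Tendsto
        (fun F : Finset (T × ℕ) => ∑ b ∈ F, ({b₀}ᶜ : Set (T × ℕ)).indicator G b) Filter.atTop
        (nhds (restSum b₀ G)) := ENNReal.summable.hasSum
    refine ((continuous_expNeg.tendsto _).comp h1).congr fun F => ?_
    simp only [Function.comp, expNeg_sum]
    refine Finset.prod_congr rfl fun b _ => ?_
    by_cases hb : b = b₀ <;> simp [hb]
  have hl : Filter.Tendsto (fun F : Finset (T × ℕ) => ∫⁻ ω, h₀ (N.mark b₀.1 b₀.2 ω)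
      * ∏ b ∈ F, (if b = b₀ then 1 else expNeg (H b (N.mark b.1 b.2 ω))) ∂Pr) Filter.atTop
      (nhds (∫⁻ ω, h₀ (N.mark b₀.1 b₀.2 ω)
        * expNeg (restSum b₀ fun b => H b (N.mark b.1 b.2 ω)) ∂Pr)) := by
    refine tendsto_lintegral_filter_of_dominated_convergence (fun _ => 1)
      (Filter.Eventually.of_forall fun F => ?_)
      (Filter.Eventually.of_forall fun F => ae_of_all _ fun ω => ?_) (by simp)
      (ae_of_all _ fun ω => ?_)
    · refine (hh₀.comp (hmk b₀)).mul (Finset.measurable_fun_prod _ fun b _ => ?_)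
      by_cases hb : b = b₀
      · simp [hb]
      · simp only [hb, if_false]
        exact measurable_expNeg.comp ((hH b).comp (hmk b))
    · refine mul_le_one' (hle _) (Finset.prod_le_one' fun b _ => ?_)
      split_ifs
      · exact le_rfl
      · exact expNeg_le_one _
    · exact ENNReal.Tendsto.const_mul (hlim _)
        (Or.inr ((hle _).trans_lt ENNReal.one_lt_top).ne)
  have hr : Filter.Tendsto (fun F : Finset (T × ℕ) => (∫⁻ ω, h₀ (N.mark b₀.1 b₀.2 ω) ∂Pr)
      * ∏ b ∈ F, (if b = b₀ then 1 else ∫⁻ ω, expNeg (H b (N.mark b.1 b.2 ω)) ∂Pr)) Filter.atTop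
      (nhds ((∫⁻ ω, h₀ (N.mark b₀.1 b₀.2 ω) ∂Pr)
        * expNeg (restSum b₀ fun b => negLog (∫⁻ ω, expNeg (H b (N.mark b.1 b.2 ω)) ∂Pr)))) := by
    refine ENNReal.Tendsto.const_mul ?_ (Or.inr ?_)
    · refine (hlim _).congr fun F => Finset.prod_congr rfl fun b _ => ?_
      rw [expNeg_negLog (hle1 b)]
    · exact (((lintegral_mono fun ω => hle _).trans (by simp)).trans_lt ENNReal.one_lt_top).ne
  -- Once the finite set contains `b₀`, the factor `h₀` takes the vacant place there, and the whole
  -- product factorises because distinct points use disjoint sources.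
  refine tendsto_nhds_unique (hl.congr' ?_) hr
  filter_upwards [Filter.eventually_ge_atTop {b₀}] with F hF
  have hb₀ : b₀ ∈ F := hF (Finset.mem_singleton_self _)
  let h : T × ℕ → Ω → ℝ≥0∞ := fun b ω =>
    if b = b₀ then h₀ (N.mark b₀.1 b₀.2 ω) else expNeg (H b (N.mark b.1 b.2 ω))
  have hm : ∀ b, Measurable[⨆ x ∈ markSources b, N.sigma x] (h b) := fun b => by
    by_cases hb : b = b₀
    · subst hb
      simp only [h, if_true]
      exact hh₀.comp (measurable_mark_sources N b)
    · simp only [h, hb, if_false]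
      exact measurable_expNeg.comp ((hH b).comp (measurable_mark_sources N b))
  have key := lintegral_prod_of_iIndep hN.sigma_le hN.indep markSources
    (fun b b' hb => disjoint_markSources hb) h hm F
  have hpull : ∀ (x : ℝ≥0∞) (u : T × ℕ → ℝ≥0∞), x * ∏ b ∈ F, (if b = b₀ then 1 else u b)
      = ∏ b ∈ F, if b = b₀ then x else u b := by
    intro x u
    rw [← Finset.mul_prod_erase _ _ hb₀, ← Finset.mul_prod_erase _ _ hb₀, if_pos rfl, if_pos rfl,
      one_mul]
    congr 1
    exact Finset.prod_congr rfl fun b hb => by simp [Finset.ne_of_mem_erase hb]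
  simp_rw [hpull]
  refine key.trans (Finset.prod_congr rfl fun b _ => ?_)
  by_cases hb : b = b₀ <;> simp [h, hb]

end Network.IsModel


/-! ### Averages over the marks of a BS -/

namespace Params

variable (p : Params)

lemma prob_mem (s : Link) {r : ℝ} (hr : 0 ≤ r) : p.prob s r ∈ Icc (0 : ℝ) 1 := by
  have h := p.pLOS_mem r hr
  cases s
  · exact h
  · exact ⟨by simpa [prob] using h.2, by simpa [prob] using h.1⟩

lemma sum_link {M : Type*} [AddCommMonoid M] (f : Link → M) : ∑ s, f s = f .LOS + f .NLOS := by
  have : (Finset.univ : Finset Link) = {.LOS, .NLOS} := rfl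
  rw [this, Finset.sum_pair (by simp)]

lemma sum_prob (r : ℝ) (hr : 0 ≤ r) : ∑ s, ENNReal.ofReal (p.prob s r) = 1 := by
  rw [sum_link, ← ENNReal.ofReal_add (p.prob_mem _ hr).1 (p.prob_mem _ hr).1]
  simp [prob]

lemma c_mem (k : Fin 2) : p.c k ∈ Icc (0 : ℝ) 1 := by
  have h := p.theta_mem k
  have h2 : 0 < 2 * Real.pi := by positivity
  exact ⟨div_nonneg h.1 h2.le, (div_le_one h2).2 h.2⟩

lemma cUE_mem : p.cUE ∈ Icc (0 : ℝ) 1 := by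
  have h := p.thetaUE_mem
  have h2 : 0 < 2 * Real.pi := by positivity
  exact ⟨div_nonneg h.1 h2.le, (div_le_one h2).2 h.2⟩

lemma gainProb_nonneg (k : Fin 2) (g : Fin 4) : 0 ≤ p.gainProb k g := by
  obtain ⟨h1, h2⟩ := p.c_mem k
  obtain ⟨h3, h4⟩ := p.cUE_mem
  have h5 := sub_nonneg.2 h2
  have h6 := sub_nonneg.2 h4
  fin_cases g <;> simp [gainProb] <;> positivity

lemma sum_gainProb (k : Fin 2) : ∑ g, ENNReal.ofReal (p.gainProb k g) = 1 := by
  rw [← ENNReal.ofReal_sum_of_nonneg fun g _ => p.gainProb_nonneg k g, ENNReal.ofReal_eq_one]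
  simp [Fin.sum_univ_four, gainProb]
  ring

lemma measurable_prob_norm {α : Type*} [MeasurableSpace α] (s : Link) {r : α → ℝ}
    (hr : Measurable r) (hr0 : ∀ x, 0 ≤ r x) : Measurable fun x => p.prob s (r x) := by
  have hL : Measurable fun x => p.pLOS (r x) := by
    -- `pLOS` is controlled only on `[0, ∞)`; composing with `max · 0` makes it antitone, hence
    -- measurable, on the whole line.
    have h1 : Antitone fun r => p.pLOS (max r 0) := fun r r' h =>
      p.pLOS_anti (mem_Ici.2 (le_max_right _ _)) (mem_Ici.2 (le_max_right _ _)) (max_le_max_right 0 h)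
    have h2 := h1.measurable.comp hr
    convert h2 using 2 with x
    simp [hr0]
  cases s
  · exact hL
  · exact measurable_const.sub hL

lemma measurable_meanPower (k : Fin 2) (s : Link) : Measurable (p.meanPower k s) :=
  (measurable_id.pow_const _).const_mul _

lemma measurable_mu (k : Fin 2) (s : Link) (n : ℕ) : Measurable (p.mu k s n) :=
  measurable_const.div (p.measurable_meanPower k s)

lemma linkState_eq_LOS {u r : ℝ} : p.linkState u r = .LOS ↔ u ≤ p.pLOS r := by
  unfold linkState
  split_ifs with h <;> simp [h]

lemma linkState_eq_NLOS {u r : ℝ} : p.linkState u r = .NLOS ↔ p.pLOS r < u := by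
  unfold linkState
  split_ifs with h
  · simpa using h
  · simpa using h

lemma measurableSet_linkState {α : Type*} [MeasurableSpace α] (s : Link) {u r : α → ℝ}
    (hu : Measurable u) (hr : Measurable r) (hr0 : ∀ x, 0 ≤ r x) :
    MeasurableSet {x | p.linkState (u x) (r x) = s} := by
  have h := p.measurable_prob_norm .LOS hr hr0
  cases s
  · simp_rw [linkState_eq_LOS]
    exact measurableSet_le hu h
  · simp_rw [linkState_eq_NLOS]
    exact measurableSet_lt h hu

lemma measurable_stateExponent {α : Type*} [MeasurableSpace α] {v c r h : α → ℝ} {q : α → Fin 4}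
    (hv : Measurable v) (hc : Measurable c) (hr : Measurable r) (hh : Measurable h)
    (hq : Measurable q) (isA isI : Prop) (j : Fin 2) (s : Link) :
    Measurable fun x => p.stateExponent (v x) (c x) isA isI j s (r x) (q x) (h x) := by
  have hset : MeasurableSet {x | p.meanPower j s (r x) < v x} :=
    measurableSet_lt ((p.measurable_meanPower j s).comp hr) hv
  have hg : Measurable fun x => p.gainValue j (q x) :=
    (measurable_of_countable (p.gainValue j)).comp hq
  have hpow : Measurable fun x => r x ^ (-p.alpha s) := hr.pow_const _
  unfold stateExponent
  refine Measurable.add (Measurable.ite ?_ measurable_const measurable_const)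
    (Measurable.ite ?_ (by fun_prop) measurable_const)
  · exact (MeasurableSet.const isA).inter hset.compl
  · exact (MeasurableSet.const isI).inter hset

lemma measurable_exponent {α : Type*} [MeasurableSpace α] {v c : α → ℝ} {y : α → Plane}
    {z : α → Mark} (hv : Measurable v) (hc : Measurable c) (hy : Measurable y) (hz : Measurable z)
    (isA isI : Prop) (j : Fin 2) :
    Measurable fun x => p.exponent (v x) (c x) isA isI j (y x) (z x) := by
  have hset := p.measurableSet_linkState .LOS hz.fst hy.norm fun x => norm_nonneg _
  have h : ∀ s, Measurable fun x =>
      p.stateExponent (v x) (c x) isA isI j s ‖y x‖ (z x).2.1 ((z x).2.2 s) := fun s =>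
    p.measurable_stateExponent hv hc hy.norm ((measurable_pi_apply s).comp hz.snd.snd) hz.snd.fst _ _ _ _
  have heq : (fun x => p.exponent (v x) (c x) isA isI j (y x) (z x))
      = fun x => if p.linkState (z x).1 ‖y x‖ = .LOS then
          p.stateExponent (v x) (c x) isA isI j .LOS ‖y x‖ (z x).2.1 ((z x).2.2 .LOS)
        else p.stateExponent (v x) (c x) isA isI j .NLOS ‖y x‖ (z x).2.1 ((z x).2.2 .NLOS) := by
    funext x
    unfold exponent
    cases p.linkState (z x).1 ‖y x‖ <;> simp
  rw [heq]
  exact Measurable.ite hset (h .LOS) (h .NLOS)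

open Classical in
/-- Expectation of `expNeg` of `stateExponent` over the gain and fading marks. -/
def stateFactor (v c : ℝ) (isA isI : Prop) (j : Fin 2) (s : Link) (r : ℝ) : ℝ≥0∞ :=
  if p.meanPower j s r < v then
    if isI then ∑ g, ENNReal.ofReal (p.gainProb j g) * ENNReal.ofReal
      ((1 / (1 + c * p.P j * p.gainValue j g * r ^ (-p.alpha s) / p.nu s)) ^ p.nu s) else 1
  else if isA then 0 else 1

lemma lintegral_stateExponent {v c : ℝ} (hc : 0 ≤ c) (isA isI : Prop) (j : Fin 2) (s : Link) {r : ℝ}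
    (hr : 0 ≤ r) :
    ∑ g, ENNReal.ofReal (p.gainProb j g) * ∫⁻ h, expNeg (p.stateExponent v c isA isI j s r g h)
        ∂(gammaMeasure (p.nu s) (p.nu s))
      = p.stateFactor v c isA isI j s r := by
  have hν : (0 : ℝ) < p.nu s := by exact_mod_cast p.nu_pos s
  have := isProbabilityMeasure_gammaMeasure hν hν
  by_cases hw : p.meanPower j s r < v
  · by_cases hI : isI
    · rw [stateFactor, if_pos hw, if_pos hI]
      refine Finset.sum_congr rfl fun g _ => ?_
      rw [← lintegral_expNeg_gammaMeasure (p.nu_pos s)]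
      · congr 1
        refine lintegral_congr fun h => ?_
        rw [stateExponent, if_neg fun h => h.2 hw, if_pos ⟨hI, hw⟩, zero_add,
          ← ENNReal.ofReal_mul hc]
        congr 2
        ring
      · have h1 := (p.P_pos j).le
        have h2 := p.gainValue_nonneg j g
        positivity
    · have h0 : ∀ g h, p.stateExponent v c isA isI j s r g h = 0 := fun g h => by
        rw [stateExponent, if_neg fun h => h.2 hw, if_neg fun h => hI h.1, zero_add]
      rw [stateFactor, if_pos hw, if_neg hI]
      simp [h0, p.sum_gainProb j]
  · by_cases hA : isA
    · have h0 : ∀ g h, p.stateExponent v c isA isI j s r g h = ∞ := fun g h => by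
        rw [stateExponent, if_pos ⟨hA, hw⟩, top_add]
      rw [stateFactor, if_neg hw, if_pos hA]
      simp [h0]
    · have h0 : ∀ g h, p.stateExponent v c isA isI j s r g h = 0 := fun g h => by
        rw [stateExponent, if_neg fun h => hA h.1, if_neg fun h => hw h.2, zero_add]
      rw [stateFactor, if_neg hw, if_neg hA]
      simp [h0, p.sum_gainProb j]

lemma measurable_stateFactor {α : Type*} [MeasurableSpace α] {v c r : α → ℝ}
    (hv : Measurable v) (hc : Measurable c) (hr : Measurable r)
    (isA isI : Prop) (j : Fin 2) (s : Link) :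
    Measurable fun x => p.stateFactor (v x) (c x) isA isI j s (r x) := by
  have hset : MeasurableSet {x | p.meanPower j s (r x) < v x} :=
    measurableSet_lt ((p.measurable_meanPower j s).comp hr) hv
  have hpow : Measurable fun x => r x ^ (-p.alpha s) := hr.pow_const _
  unfold stateFactor
  refine Measurable.ite hset ?_ measurable_const
  split_ifs
  · fun_prop
  · exact measurable_const

lemma stateFactor_le_one {v c : ℝ} (hc : 0 ≤ c) (isA isI : Prop) (j : Fin 2) (s : Link) {r : ℝ}
    (hr : 0 ≤ r) : p.stateFactor v c isA isI j s r ≤ 1 := by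
  have hν : (0 : ℝ) < p.nu s := by exact_mod_cast p.nu_pos s
  have := isProbabilityMeasure_gammaMeasure hν hν
  rw [← p.lintegral_stateExponent hc isA isI j s hr, ← p.sum_gainProb j]
  refine Finset.sum_le_sum fun g _ => mul_le_of_le_one_right zero_le ?_
  exact (lintegral_mono fun h => expNeg_le_one _).trans (by simp)

lemma continuousAt_meanPower (k : Fin 2) (s : Link) {r : ℝ} (hr : 0 < r) :
    ContinuousAt (p.meanPower k s) r :=
  continuousAt_const.mul (Real.continuousAt_rpow_const _ _ (Or.inl hr.ne'))

lemma meanPower_antitone (k : Fin 2) (s : Link) {r r' : ℝ} (hr : 0 < r) (h : r ≤ r') :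
    p.meanPower k s r' ≤ p.meanPower k s r := by
  have h1 := (p.P_pos k).le
  have h2 := (p.M_pos k).le
  have h3 := p.MUE_pos.le
  unfold meanPower
  exact mul_le_mul_of_nonneg_left
    (Real.rpow_le_rpow_of_nonpos hr h (neg_nonpos.2 (p.alpha_pos s).le)) (by positivity)

/-- Seen as a function of the serving distance, the factor can jump only where the two averaged
powers coincide. The strict inequality is an open condition; once it fails it also fails at larger
serving distances, because the serving power decreases. This gives continuity from the right. -/
lemma continuousWithinAt_stateFactor (k : Fin 2) (s : Link) (n : ℕ) (isA isI : Prop) (j : Fin 2)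
    (s' : Link) {u : ℝ} (hu : 0 ≤ u) {r : ℝ} (hr : 0 < r) :
    ContinuousWithinAt
      (fun r => p.stateFactor (p.meanPower k s r) (p.mu k s n r) isA isI j s' u) (Ioi r) r := by
  have hcont := p.continuousAt_meanPower k s hr
  have hmu : ContinuousAt (p.mu k s n) r :=
    continuousAt_const.div hcont (p.meanPower_pos k s hr).ne'
  by_cases hw : p.meanPower j s' u < p.meanPower k s r
  · have hev : ∀ᶠ r' in nhds r, p.meanPower j s' u < p.meanPower k s r' :=
      hcont.eventually (lt_mem_nhds hw)
    have heq : (fun r' => p.stateFactor (p.meanPower k s r') (p.mu k s n r') isA isI j s' u)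
        =ᶠ[nhds r] fun r' => p.stateFactor (p.meanPower k s r) (p.mu k s n r') isA isI j s' u := by
      filter_upwards [hev] with r' hr'
      simp [stateFactor, hr', hw]
    refine (ContinuousAt.congr ?_ heq.symm).continuousWithinAt
    simp only [stateFactor, hw, if_true]
    by_cases hI : isI
    · simp only [hI, if_true]
      refine tendsto_finsetSum _ fun g _ => ?_
      refine ENNReal.Tendsto.const_mul ?_ (Or.inr ENNReal.ofReal_ne_top)
      refine (ENNReal.continuous_ofReal.tendsto _).comp ?_
      refine ((tendsto_const_nhds.div (tendsto_const_nhds.add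
        ((((hmu.tendsto.mul_const _).mul_const _).mul_const _).div_const _)) ?_).pow _)
      have h1 := (p.P_pos j).le
      have h2 := p.gainValue_nonneg j g
      have h3 := p.mu_nonneg k s n hr.le
      positivity
    · simp only [hI, if_false]
      exact continuousAt_const
  · refine (continuousWithinAt_const (b := p.stateFactor (p.meanPower k s r) (p.mu k s n r)
      isA isI j s' u)).congr (fun r' hr' => ?_) rfl
    have h1 : ¬ p.meanPower j s' u < p.meanPower k s r' := fun h =>
      hw (h.trans_le (p.meanPower_antitone k s hr (le_of_lt hr')))
    simp [stateFactor, hw, h1]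

/-- Expectation of the exponential functional of the marks of a BS at `y`, when the serving BS has
tier `k`, state `s` and distance `r`. -/
def meanFactor (k : Fin 2) (s : Link) (n : ℕ) (isA isI : Prop) (j : Fin 2) (y : Plane) (r : ℝ) :
    ℝ≥0∞ :=
  ∑ s', ENNReal.ofReal (p.prob s' ‖y‖)
    * p.stateFactor (p.meanPower k s r) (p.mu k s n r) isA isI j s' ‖y‖

lemma measurable_meanFactor (k : Fin 2) (s : Link) (n : ℕ) (isA isI : Prop) (j : Fin 2) :
    Measurable (Function.uncurry (p.meanFactor k s n isA isI j)) := by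
  change Measurable fun x : Plane × ℝ => ∑ s', ENNReal.ofReal (p.prob s' ‖x.1‖)
    * p.stateFactor (p.meanPower k s x.2) (p.mu k s n x.2) isA isI j s' ‖x.1‖
  refine Finset.measurable_fun_sum _ fun s' _ => ?_
  have h1 := p.measurable_prob_norm s' (α := Plane × ℝ) measurable_fst.norm fun x => norm_nonneg _
  exact h1.ennreal_ofReal.mul (p.measurable_stateFactor
    ((p.measurable_meanPower k s).comp measurable_snd) ((p.measurable_mu k s n).comp measurable_snd)
    measurable_fst.norm _ _ _ _)

lemma meanFactor_le_one (k : Fin 2) (s : Link) (n : ℕ) (isA isI : Prop) (j : Fin 2) (y : Plane)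
    {r : ℝ} (hr : 0 ≤ r) : p.meanFactor k s n isA isI j y r ≤ 1 := by
  rw [← p.sum_prob ‖y‖ (norm_nonneg _)]
  exact Finset.sum_le_sum fun s' _ => mul_le_of_le_one_right zero_le
    (p.stateFactor_le_one (p.mu_nonneg k s n hr) _ _ _ _ (norm_nonneg _))

lemma continuousWithinAt_meanFactor (k : Fin 2) (s : Link) (n : ℕ) (isA isI : Prop) (j : Fin 2)
    (y : Plane) {r : ℝ} (hr : 0 < r) :
    ContinuousWithinAt (p.meanFactor k s n isA isI j y) (Ioi r) r :=
  tendsto_finsetSum _ fun s' _ => ENNReal.Tendsto.const_mul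
    (p.continuousWithinAt_stateFactor k s n isA isI j s' (norm_nonneg y) hr)
    (Or.inr ENNReal.ofReal_ne_top)

open Classical in
/-- Expectation of `servingWeight` over the blocking mark. -/
def baseWeight (k : Fin 2) (s : Link) (n : ℕ) (r : ℝ) : ℝ≥0∞ :=
  if 0 < r then ENNReal.ofReal (p.prob s r) * expNeg (ENNReal.ofReal (p.mu k s n r * p.noise))
  else 0

end Params

namespace Network.IsModel

variable {T : Type} {Ω : Type*} {mΩ : MeasurableSpace Ω} {p : Params}
  {N : Network T Ω} {tier : T → Fin 2} {dens : T → ℝ} {Pr : Measure Ω}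

lemma prob_linkState (hN : N.IsModel p tier dens Pr) (t : T) (i : ℕ) (s : Link) {r : ℝ}
    (hr : 0 ≤ r) : Pr {ω | p.linkState (N.block t i ω) r = s} = ENNReal.ofReal (p.prob s r) := by
  have hset : MeasurableSet {u : ℝ | p.linkState u r = s} :=
    p.measurableSet_linkState s measurable_id measurable_const fun _ => hr
  have h : Pr {ω | p.linkState (N.block t i ω) r = s}
      = Pr.map (N.block t i) {u : ℝ | p.linkState u r = s} := by
    rw [Measure.map_apply (hN.block_meas t i) hset]; rfl
  obtain ⟨h0, h1⟩ := p.pLOS_mem r hr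
  rw [h, hN.block_law, Measure.restrict_apply hset]
  cases s
  · have : {u : ℝ | p.linkState u r = .LOS} ∩ Icc 0 1 = Icc 0 (p.pLOS r) := by
      ext u
      simp only [Params.linkState_eq_LOS, mem_inter_iff, mem_ofPred_eq, mem_Icc]
      exact ⟨fun h => ⟨h.2.1, h.1⟩, fun h => ⟨h.2, h.1, h.2.trans h1⟩⟩
    rw [this, Real.volume_Icc, sub_zero]
    rfl
  · have : {u : ℝ | p.linkState u r = .NLOS} ∩ Icc 0 1 = Ioc (p.pLOS r) 1 := by
      ext u
      simp only [Params.linkState_eq_NLOS, mem_inter_iff, mem_ofPred_eq, mem_Icc, mem_Ioc]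
      exact ⟨fun h => ⟨h.1, h.2.2⟩, fun h => ⟨h.1, h0.trans h.1.le, h.2⟩⟩
    rw [this, Real.volume_Ioc]
    rfl

variable [IsProbabilityMeasure Pr]

-- The state selects which fading gain is used, so the blocking and fading marks do not separate at
-- once. After splitting over the state and the gain, each term is a product of functions of three
-- independent sources.
open Classical in
lemma lintegral_exponent (hN : N.IsModel p tier dens Pr) {v c : ℝ} (hc : 0 ≤ c) (isA isI : Prop)
    (t : T) (i : ℕ) (y : Plane) :
    ∫⁻ ω, expNeg (p.exponent v c isA isI (tier t) y (N.mark t i ω)) ∂Pr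
      = ∑ s, ENNReal.ofReal (p.prob s ‖y‖) * p.stateFactor v c isA isI (tier t) s ‖y‖ := by
  set r := ‖y‖ with hr
  have hr0 : 0 ≤ r := norm_nonneg y
  let D : Link → Fin 4 → ℝ → ℝ≥0∞ := fun s q h =>
    expNeg (p.stateExponent v c isA isI (tier t) s r q h)
  have hD : ∀ s q, Measurable (D s q) := fun s q => measurable_expNeg.comp
    (p.measurable_stateExponent measurable_const measurable_const measurable_const measurable_id
      measurable_const _ _ _ _)
  have hsplit : ∀ ω, expNeg (p.exponent v c isA isI (tier t) y (N.mark t i ω))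
      = ∑ s, ∑ q, (if p.linkState (N.block t i ω) r = s then 1 else 0)
        * ((if N.gain t i ω = q then 1 else 0) * D s q (N.fade t i s ω)) := by
    intro ω
    rw [Finset.sum_eq_single (p.linkState (N.block t i ω) r) (fun s _ hs => by simp [hs.symm])
      (by simp), Finset.sum_eq_single (N.gain t i ω) (fun q _ hq => by simp [hq.symm]) (by simp)]
    simp only [if_true, one_mul]
    rfl
  have hblock : ∀ s t i, Measurable[N.sigma (.block t i)] fun ω =>
      (if p.linkState (N.block t i ω) r = s then 1 else 0 : ℝ≥0∞) := fun s t i =>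
    (Measurable.ite (p.measurableSet_linkState s measurable_id measurable_const fun _ => hr0)
      (measurable_const (a := (1 : ℝ≥0∞))) (measurable_const (a := (0 : ℝ≥0∞)))).comp
      (comap_measurable (N.block t i))
  have hgain : ∀ q t i, Measurable[N.sigma (.gain t i)] fun ω =>
      (if N.gain t i ω = q then 1 else 0 : ℝ≥0∞) := fun q t i =>
    (measurable_of_countable fun x : Fin 4 => (if x = q then 1 else 0 : ℝ≥0∞)).comp
      (comap_measurable (N.gain t i))
  have hfade : ∀ s q t i s', Measurable[N.sigma (.fade t i s')] fun ω =>
      D s q (N.fade t i s' ω) := fun s q t i s' => (hD s q).comp (comap_measurable (N.fade t i s'))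
  have hterm : ∀ s q, ∫⁻ ω, (if p.linkState (N.block t i ω) r = s then 1 else 0)
        * ((if N.gain t i ω = q then 1 else 0) * D s q (N.fade t i s ω)) ∂Pr
      = ENNReal.ofReal (p.prob s r) * (ENNReal.ofReal (p.gainProb (tier t) q)
        * ∫⁻ h, D s q h ∂(gammaMeasure (p.nu s) (p.nu s))) := by
    intro s q
    -- A factor is assigned to every source, as `lintegral_prod_of_iIndep'` asks; only three of them
    -- enter the finite product.
    let h : Source T → Ω → ℝ≥0∞ := fun x => match x with
      | .loc _ => fun _ => 1
      | .block t i => fun ω => if p.linkState (N.block t i ω) r = s then 1 else 0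
      | .gain t i => fun ω => if N.gain t i ω = q then 1 else 0
      | .fade t i s' => fun ω => D s q (N.fade t i s' ω)
    have hm : ∀ x, Measurable[N.sigma x] (h x) := fun x => by
      cases x with
      | loc t => exact measurable_const
      | block t i => exact hblock s t i
      | gain t i => exact hgain q t i
      | fade t i s' => exact hfade s q t i s'
    have key := lintegral_prod_of_iIndep' hN.sigma_le hN.indep h hm
      {.block t i, .gain t i, .fade t i s}
    simp only [Finset.prod_insert, Finset.mem_insert, Finset.mem_singleton, reduceCtorEq, or_self,
      not_false_eq_true, Finset.prod_singleton, h] at key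
    rw [key]
    congr 1
    · rw [← hN.prob_linkState t i s hr0]
      have hset := p.measurableSet_linkState s (hN.block_meas t i)
        (measurable_const (a := r)) fun _ => hr0
      rw [← lintegral_indicator_one hset]
      refine lintegral_congr fun ω => ?_
      by_cases hω : p.linkState (N.block t i ω) r = s <;> simp [hω]
    · congr 1
      · rw [← hN.gain_law t i q]
        have hset : MeasurableSet {ω | N.gain t i ω = q} :=
          (hN.gain_meas t i) (measurableSet_singleton q)
        rw [← lintegral_indicator_one hset]
        refine lintegral_congr fun ω => ?_
        by_cases hω : N.gain t i ω = q <;> simp [hω]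
      · rw [← hN.fade_law t i s, lintegral_map (hD s q) (hN.fade_meas t i s)]
  have hmeas : ∀ s q, Measurable fun ω => (if p.linkState (N.block t i ω) r = s then 1 else 0)
        * ((if N.gain t i ω = q then 1 else 0) * D s q (N.fade t i s ω)) := fun s q =>
    ((hblock s t i).mono (hN.sigma_le _) le_rfl).mul
      (((hgain q t i).mono (hN.sigma_le _) le_rfl).mul
        ((hfade s q t i s).mono (hN.sigma_le _) le_rfl))
  simp_rw [hsplit]
  rw [lintegral_finsetSum _ fun s _ => Finset.measurable_fun_sum _ fun q _ => hmeas s q]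
  refine Finset.sum_congr rfl fun s _ => ?_
  rw [lintegral_finsetSum _ fun q _ => hmeas s q, ← p.lintegral_stateExponent hc _ _ _ _ hr0,
    Finset.mul_sum]
  exact Finset.sum_congr rfl fun q _ => hterm s q

lemma lintegral_servingWeight (hN : N.IsModel p tier dens Pr) (k : Fin 2) (s : Link) (n : ℕ)
    {r : ℝ} (t : T) (i : ℕ) :
    ∫⁻ ω, p.servingWeight k s n r (N.block t i ω) ∂Pr = p.baseWeight k s n r := by
  classical
  unfold Params.servingWeight Params.baseWeight
  by_cases hr : 0 < r
  · have hset := p.measurableSet_linkState s (hN.block_meas t i)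
        (measurable_const (a := r)) fun _ => hr.le
    simp only [hr, true_and, if_true]
    rw [← hN.prob_linkState t i s hr.le, mul_comm (Pr _), ← lintegral_indicator_const hset]
    refine lintegral_congr fun ω => ?_
    by_cases hω : p.linkState (N.block t i ω) r = s <;> simp [hω]
  · simp [hr]

end Network.IsModel


/-! ### Polar coordinates -/

/-- Measurability is required on `(0, ∞)` only, since `pLOS` is arbitrary at negative arguments. The
origin is a null set. -/
lemma lintegral_norm_plane {f : ℝ → ℝ≥0∞} (hf : Measurable fun r : Ioi (0 : ℝ) => f r) :
    ∫⁻ y : Plane, f ‖y‖ = ∫⁻ r in Ioi (0 : ℝ), ENNReal.ofReal (2 * Real.pi * r) * f r := by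
  have hdim : Module.finrank ℝ Plane = 2 := by simp
  have h1 : ∫⁻ y : Plane, f ‖y‖
      = ∫⁻ y : ({0}ᶜ : Set Plane), f ‖y.1‖ ∂((volume : Measure Plane).comap Subtype.val) := by
    rw [lintegral_subtype_comap (measurableSet_singleton _).compl fun y => f ‖y‖,
      restrict_compl_singleton]
  have h2 := (Measure.measurePreserving_homeomorphUnitSphereProd
    (volume : Measure Plane)).lintegral_comp_emb (Homeomorph.measurableEmbedding _)
    fun z => f z.2
  simp only [homeomorphUnitSphereProd_apply_snd_coe] at h2
  have hm : Measurable fun r : Ioi (0 : ℝ) => ENNReal.ofReal ((r : ℝ) ^ 1) := by fun_prop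
  have hfs : AEMeasurable (fun z : Metric.sphere (0 : Plane) 1 × Ioi (0 : ℝ) => f z.2)
      ((volume : Measure Plane).toSphere.prod (Measure.volumeIoiPow (Module.finrank ℝ Plane - 1))) :=
    (hf.comp measurable_snd).aemeasurable
  rw [h1, h2, lintegral_prod _ hfs]
  dsimp only
  -- The sphere measure has total mass dimension times volume of the unit disc, that is `2π`.
  rw [lintegral_const,
    Measure.toSphere_apply_univ, hdim, EuclideanSpace.volume_ball_fin_two, Measure.volumeIoiPow,
    lintegral_withDensity_eq_lintegral_mul _ hm hf]
  simp only [Pi.mul_apply]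
  rw [lintegral_subtype_comap measurableSet_Ioi fun r => ENNReal.ofReal (r ^ 1) * f r]
  rw [mul_comm, ← lintegral_const_mul' _ _ (by simp [ENNReal.mul_eq_top])]
  refine setLIntegral_congr_fun measurableSet_Ioi fun r _ => ?_
  simp only [pow_one, ENNReal.ofReal_one, one_pow, one_mul, Nat.cast_ofNat]
  rw [ENNReal.ofReal_mul (by positivity), ENNReal.ofReal_mul (by positivity), ← mul_assoc]
  simp

namespace Params

variable (p : Params)

/-! ### The intensity function -/

lemma measurable_prob_Ioi (s : Link) : Measurable fun r : Ioi (0 : ℝ) => p.prob s r :=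
  p.measurable_prob_norm s measurable_subtype_coe fun r => le_of_lt r.2

lemma aestronglyMeasurable_prob (s : Link) {S : Set ℝ} (hS : MeasurableSet S) (h : S ⊆ Ici 0) :
    AEStronglyMeasurable (fun r => r * p.prob s r) (volume.restrict S) := by
  have h1 := p.measurable_prob_norm s (r := fun r : ℝ => max r 0) (by fun_prop)
    fun x => le_max_right _ _
  refine (measurable_id.mul h1).aestronglyMeasurable.congr ?_
  filter_upwards [ae_restrict_mem hS] with r hr
  simp [max_eq_left (mem_Ici.1 (h hr))]

lemma intervalIntegrable_prob (s : Link) {a b : ℝ} (ha : 0 ≤ a) (hb : 0 ≤ b) :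
    IntervalIntegrable (fun r => r * p.prob s r) volume a b := by
  have h1 : IntervalIntegrable (fun r : ℝ => r) volume a b := intervalIntegral.intervalIntegrable_id
  refine h1.mono_fun (p.aestronglyMeasurable_prob s measurableSet_uIoc fun r hr =>
    (le_min ha hb).trans hr.1.le) ?_
  filter_upwards [ae_restrict_mem measurableSet_uIoc] with r hr
  have hr0 : 0 ≤ r := (le_min ha hb).trans hr.1.le
  obtain ⟨h2, h3⟩ := p.prob_mem s hr0
  rw [norm_mul]
  refine mul_le_of_le_one_right (norm_nonneg _) ?_
  rw [Real.norm_of_nonneg h2]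
  exact h3

/-- Points of discontinuity of the LOS probability on `(0, ∞)`. -/
def jumps : Set ℝ := {r | 0 < r ∧ ¬ ContinuousAt p.pLOS r}

lemma countable_jumps : p.jumps.Countable := by
  have h1 : Antitone fun r => p.pLOS (max r 0) := fun r r' h =>
      p.pLOS_anti (mem_Ici.2 (le_max_right _ _)) (mem_Ici.2 (le_max_right _ _))
        (max_le_max_right 0 h)
  refine h1.countable_not_continuousAt.mono fun r hr => ?_
  change ¬ ContinuousAt (fun r => p.pLOS (max r 0)) r
  intro h
  refine hr.2 (h.congr ?_)
  filter_upwards [lt_mem_nhds hr.1] with x hx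
  simp [max_eq_left hx.le]

/-- Fundamental theorem of calculus at continuity points of `pLOS`. By monotonicity the exceptional
points are countable, so whatever value `deriv` takes there does not affect any integral. -/
lemma hasDerivAt_Lam (dens : ℝ) (s : Link) {r : ℝ} (hr : 0 < r) (hj : r ∉ p.jumps) :
    HasDerivAt (p.Lam dens s) (2 * Real.pi * dens * (r * p.prob s r)) r := by
  have hL : ContinuousAt p.pLOS r := by
    by_contra h
    exact hj ⟨hr, h⟩
  have hcont : ContinuousAt (fun r => r * p.prob s r) r := by
    refine continuousAt_id.mul ?_
    cases s
    · exact hL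
    · exact continuousAt_const.sub hL
  refine HasDerivAt.const_mul _ (intervalIntegral.integral_hasDerivAt_right
    (p.intervalIntegrable_prob s le_rfl hr.le) ?_ hcont)
  exact ⟨Ioi 0, Ioi_mem_nhds hr, p.aestronglyMeasurable_prob s measurableSet_Ioi
    fun x hx => mem_Ici.2 (le_of_lt hx)⟩

lemma Lam'_eq (dens : ℝ) (s : Link) {r : ℝ} (hr : 0 < r) (hj : r ∉ p.jumps) :
    p.Lam' dens s r = 2 * Real.pi * dens * (r * p.prob s r) :=
  (p.hasDerivAt_Lam dens s hr hj).deriv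

lemma ae_notMem_jumps : ∀ᵐ r : ℝ, r ∉ p.jumps := p.countable_jumps.ae_notMem _

lemma Lam_nonneg {dens : ℝ} (hd : 0 ≤ dens) (s : Link) {r : ℝ} (hr : 0 ≤ r) :
    0 ≤ p.Lam dens s r := by
  refine mul_nonneg (by positivity) (intervalIntegral.integral_nonneg hr fun u hu => ?_)
  exact mul_nonneg hu.1 (p.prob_mem s hu.1).1

lemma ofReal_Lam {dens : ℝ} (hd : 0 ≤ dens) (s : Link) {r : ℝ} (hr : 0 ≤ r) :
    ENNReal.ofReal (p.Lam dens s r)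
      = ENNReal.ofReal dens * ∫⁻ u in Ioc 0 r,
          ENNReal.ofReal (2 * Real.pi * u) * ENNReal.ofReal (p.prob s u) := by
  have hi := (intervalIntegrable_iff_integrableOn_Ioc_of_le hr).1
    (p.intervalIntegrable_prob s le_rfl hr)
  rw [Lam, intervalIntegral.integral_of_le hr, mul_comm (2 * Real.pi), mul_assoc,
    ENNReal.ofReal_mul hd, ENNReal.ofReal_mul (by positivity),
    ofReal_integral_eq_lintegral_ofReal hi, ← lintegral_const_mul' _ _ ENNReal.ofReal_ne_top]
  · congr 1
    refine setLIntegral_congr_fun measurableSet_Ioc fun u hu => ?_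
    have hu0 := hu.1.le
    rw [ENNReal.ofReal_mul hu0, ENNReal.ofReal_mul (by positivity : 0 ≤ 2 * Real.pi), mul_assoc]
  · filter_upwards [ae_restrict_mem measurableSet_Ioc] with u hu
    exact mul_nonneg hu.1.le (p.prob_mem s hu.1.le).1

/-! ### Exclusion radii -/

lemma R_nonneg (k : Fin 2) (s : Link) (j : Fin 2) (s' : Link) {x : ℝ} (hx : 0 ≤ x) :
    0 ≤ p.R k s j s' x := by
  have h1 := p.P_pos
  have h2 := p.M_pos
  have := h1 j; have := h1 k; have := h2 j; have := h2 k
  unfold R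
  positivity

/-- The exclusion radius is the distance at which the two averaged powers are equal; the UE gain
cancels. -/
lemma meanPower_lt_iff (k : Fin 2) (s : Link) (j : Fin 2) (s' : Link) {x u : ℝ} (hx : 0 < x)
    (hu : 0 < u) : p.meanPower j s' u < p.meanPower k s x ↔ p.R k s j s' x < u := by
  have hPj := p.P_pos j
  have hPk := p.P_pos k
  have hMj := p.M_pos j
  have hMk := p.M_pos k
  have hU := p.MUE_pos
  have hα := p.alpha_pos s'
  have hR : 0 ≤ p.R k s j s' x := p.R_nonneg k s j s' hx.le
  have hRpow : p.R k s j s' x ^ p.alpha s' = p.P j / p.P k * (p.M j / p.M k) * x ^ p.alpha s := by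
    rw [R, Real.mul_rpow (by positivity) (by positivity), ← Real.rpow_mul (by positivity),
      ← Real.rpow_mul hx.le, div_mul_cancel₀ _ hα.ne', div_mul_cancel₀ _ hα.ne',
      Real.rpow_one]
  rw [← Real.rpow_lt_rpow_iff hR hu.le hα, hRpow, meanPower, meanPower, Real.rpow_neg hu.le,
    Real.rpow_neg hx.le]
  have hA : 0 < u ^ p.alpha s' := by positivity
  have hB : 0 < x ^ p.alpha s := by positivity
  rw [← div_eq_mul_inv, ← div_eq_mul_inv, div_lt_div_iff₀ hA hB]
  have e1 : p.P j * (p.M j * p.MUE) * x ^ p.alpha s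
      = p.P k * (p.M k * p.MUE) * (p.P j / p.P k * (p.M j / p.M k) * x ^ p.alpha s) := by
    field_simp
  rw [e1]
  exact mul_lt_mul_iff_right₀ (by positivity)

/-- Provides the term `Λ_k^s([0, x))` of the exponent that makes the integrand integrable. -/
lemma R_self (k : Fin 2) (s : Link) {x : ℝ} : p.R k s k s x = x := by
  rw [R, div_self (p.P_pos k).ne', div_self (p.M_pos k).ne', div_self (p.alpha_pos s).ne']
  simp

/-! ### Loss factors -/

open Classical in
/-- `1 - stateFactor`. -/
def stateLoss (v c : ℝ) (isA isI : Prop) (j : Fin 2) (s : Link) (r : ℝ) : ℝ≥0∞ :=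
  if p.meanPower j s r < v then
    if isI then ∑ g, ENNReal.ofReal (p.gainProb j g) * ENNReal.ofReal
      (F (p.nu s) (c * p.P j * p.gainValue j g * r ^ (-p.alpha s) / p.nu s)) else 0
  else if isA then 1 else 0

lemma one_div_pow_mem {x : ℝ} (hx : 0 ≤ x) (n : ℕ) : (1 / (1 + x)) ^ n ∈ Icc (0 : ℝ) 1 :=
  ⟨by positivity, pow_le_one₀ (by positivity) ((div_le_one (by positivity)).2 (by linarith))⟩

lemma F_nonneg (n : ℕ) {x : ℝ} (hx : 0 ≤ x) : 0 ≤ F n x :=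
  sub_nonneg.2 (one_div_pow_mem hx n).2

lemma stateFactor_add_stateLoss {v c : ℝ} (hc : 0 ≤ c) (isA isI : Prop) (j : Fin 2) (s : Link)
    {r : ℝ} (hr : 0 ≤ r) :
    p.stateFactor v c isA isI j s r + p.stateLoss v c isA isI j s r = 1 := by
  unfold stateFactor stateLoss
  split_ifs
  · rw [← p.sum_gainProb j, ← Finset.sum_add_distrib]
    refine Finset.sum_congr rfl fun g _ => ?_
    have hx : 0 ≤ c * p.P j * p.gainValue j g * r ^ (-p.alpha s) / p.nu s := by
      have h1 := (p.P_pos j).le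
      have h2 := p.gainValue_nonneg j g
      positivity
    rw [← mul_add, ← ENNReal.ofReal_add (one_div_pow_mem hx _).1 (F_nonneg _ hx), F,
      add_sub_cancel, ENNReal.ofReal_one, mul_one]
  · simp
  · simp
  · simp

lemma one_sub_meanFactor (k : Fin 2) (s : Link) (n : ℕ) (isA isI : Prop) (j : Fin 2) (y : Plane)
    {r : ℝ} (hr : 0 ≤ r) :
    1 - p.meanFactor k s n isA isI j y r = ∑ s', ENNReal.ofReal (p.prob s' ‖y‖)
      * p.stateLoss (p.meanPower k s r) (p.mu k s n r) isA isI j s' ‖y‖ := by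
  refine ENNReal.sub_eq_of_eq_add_rev
    ((p.meanFactor_le_one k s n isA isI j y hr).trans_lt ENNReal.one_lt_top).ne ?_
  rw [meanFactor, ← Finset.sum_add_distrib]
  simp_rw [← mul_add, p.stateFactor_add_stateLoss (p.mu_nonneg k s n hr) _ _ _ _ (norm_nonneg y),
    mul_one]
  exact (p.sum_prob _ (norm_nonneg y)).symm

end Params


/-! ### The exponent of the formula as an integral over the plane -/

namespace Params

variable (p : Params)

lemma ofReal_Lam' {dens : ℝ} (hd : 0 ≤ dens) (s : Link) {r : ℝ} (hr : 0 < r) (hj : r ∉ p.jumps) :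
    ENNReal.ofReal (p.Lam' dens s r)
      = ENNReal.ofReal dens * (ENNReal.ofReal (2 * Real.pi * r) * ENNReal.ofReal (p.prob s r)) := by
  rw [p.Lam'_eq dens s hr hj, ← ENNReal.ofReal_mul (by positivity), ← ENNReal.ofReal_mul hd]
  congr 1
  ring

lemma Lam'_nonneg {dens : ℝ} (hd : 0 ≤ dens) (s : Link) {r : ℝ} (hr : 0 < r) (hj : r ∉ p.jumps) :
    0 ≤ p.Lam' dens s r := by
  rw [p.Lam'_eq dens s hr hj]
  have := (p.prob_mem s hr.le).1
  positivity

lemma measurable_stateLoss {α : Type*} [MeasurableSpace α] {v c r : α → ℝ}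
    (hv : Measurable v) (hc : Measurable c) (hr : Measurable r)
    (isA isI : Prop) (j : Fin 2) (s : Link) :
    Measurable fun x => p.stateLoss (v x) (c x) isA isI j s (r x) := by
  have hset : MeasurableSet {x | p.meanPower j s (r x) < v x} :=
    measurableSet_lt ((p.measurable_meanPower j s).comp hr) hv
  have hpow : Measurable fun x => r x ^ (-p.alpha s) := hr.pow_const _
  unfold stateLoss
  refine Measurable.ite hset ?_ measurable_const
  split_ifs
  · unfold F
    fun_prop
  · exact measurable_const

open Classical in
/-- Integral of the loss of one tier in one state over the plane. -/
lemma lintegral_stateLoss (k : Fin 2) (s : Link) (n : ℕ) {dens : ℝ} (hd : 0 ≤ dens) (isA isI : Prop)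
    (j : Fin 2) (s' : Link) {x : ℝ} (hx : 0 < x) :
    ENNReal.ofReal dens * ∫⁻ y : Plane, ENNReal.ofReal (p.prob s' ‖y‖)
        * p.stateLoss (p.meanPower k s x) (p.mu k s n x) isA isI j s' ‖y‖
      = (if isA then ENNReal.ofReal (p.Lam dens s' (p.R k s j s' x)) else 0)
        + (if isI then ∑ g : Fin 4, ENNReal.ofReal (p.gainProb j g) *
            ∫⁻ r in Ioi (p.R k s j s' x), ENNReal.ofReal
              (F (p.nu s') (p.mu k s n x * p.P j * p.gainValue j g * r ^ (-p.alpha s') / p.nu s')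
                * p.Lam' dens s' r) else 0) := by
  set R := p.R k s j s' x with hR
  have hR0 : 0 ≤ R := p.R_nonneg k s j s' hx.le
  let φ : ℝ → ℝ≥0∞ := fun r => ENNReal.ofReal (p.prob s' r)
        * p.stateLoss (p.meanPower k s x) (p.mu k s n x) isA isI j s' r
  have hφ : Measurable fun r : Ioi (0 : ℝ) => φ r :=
    (p.measurable_prob_Ioi s').ennreal_ofReal.mul
      (p.measurable_stateLoss measurable_const measurable_const measurable_subtype_coe _ _ _ _)
  have hpolar := lintegral_norm_plane hφ
  -- The radial integral is split at the exclusion radius: up to `R` the BS is at least as strong as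
  -- the serving one and only association matters; beyond `R` it is weaker and can only interfere.
  rw [show (∫⁻ y : Plane, ENNReal.ofReal (p.prob s' ‖y‖)
        * p.stateLoss (p.meanPower k s x) (p.mu k s n x) isA isI j s' ‖y‖) = _ from hpolar,
    ← Ioc_union_Ioi_eq_Ioi hR0, lintegral_union measurableSet_Ioi
      (Set.disjoint_left.2 fun r h1 h2 => not_lt.2 h1.2 h2), mul_add]
  congr 1
  · split_ifs with hA
    · rw [p.ofReal_Lam hd s' hR0]
      congr 1
      refine setLIntegral_congr_fun measurableSet_Ioc fun r hr => ?_
      have h1 : ¬ p.meanPower j s' r < p.meanPower k s x := fun h =>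
        not_lt.2 hr.2 ((p.meanPower_lt_iff k s j s' hx hr.1).1 h)
      simp [φ, stateLoss, h1, hA]
    · have : ∀ r ∈ Ioc 0 R, ENNReal.ofReal (2 * Real.pi * r) * φ r = 0 := fun r hr => by
        have h1 : ¬ p.meanPower j s' r < p.meanPower k s x := fun h =>
          not_lt.2 hr.2 ((p.meanPower_lt_iff k s j s' hx hr.1).1 h)
        simp [φ, stateLoss, h1, hA]
      rw [setLIntegral_congr_fun measurableSet_Ioc this]
      simp
  · have hw : ∀ r ∈ Ioi R, p.meanPower j s' r < p.meanPower k s x := fun r hr =>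
      (p.meanPower_lt_iff k s j s' hx (hR0.trans_lt hr)).2 hr
    split_ifs with hI
    · rw [← lintegral_const_mul' _ _ ENNReal.ofReal_ne_top]
      have hmeas : ∀ g, AEMeasurable (fun r => ENNReal.ofReal (F (p.nu s')
          (p.mu k s n x * p.P j * p.gainValue j g * r ^ (-p.alpha s') / p.nu s')
            * p.Lam' dens s' r)) (volume.restrict (Ioi R)) := fun g => by
        have h1 : Measurable (p.Lam' dens s') := measurable_deriv _
        have h2 : Measurable fun r : ℝ => r ^ (-p.alpha s') := measurable_id.pow_const _
        unfold F
        fun_prop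
      simp_rw [← lintegral_const_mul' _ _ ENNReal.ofReal_ne_top]
      rw [← lintegral_finsetSum' _ fun g _ => (hmeas g).const_mul _]
      refine lintegral_congr_ae ?_
      filter_upwards [ae_restrict_mem measurableSet_Ioi, ae_restrict_of_ae p.ae_notMem_jumps]
        with r hr hj
      have hr0 : 0 < r := hR0.trans_lt hr
      simp only [φ, stateLoss, hw r hr, hI, if_true]
      rw [Finset.mul_sum, Finset.mul_sum, Finset.mul_sum]
      refine Finset.sum_congr rfl fun g _ => ?_
      have hF : 0 ≤ F (p.nu s')
          (p.mu k s n x * p.P j * p.gainValue j g * r ^ (-p.alpha s') / p.nu s') := by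
        refine F_nonneg _ ?_
        have h1 := (p.P_pos j).le
        have h2 := p.gainValue_nonneg j g
        have h3 := p.mu_nonneg k s n hx.le
        positivity
      rw [ENNReal.ofReal_mul hF, p.ofReal_Lam' hd s' hr0 hj]
      ring
    · have : ∀ r ∈ Ioi R, ENNReal.ofReal (2 * Real.pi * r) * φ r = 0 := fun r hr => by
        simp [φ, stateLoss, hw r hr, hI]
      rw [setLIntegral_congr_fun measurableSet_Ioi this]
      simp

/-- The exponent of the formula for the coverage probability. -/
def totalLoss (densA densI : Fin 2 → ℝ) (k : Fin 2) (s : Link) (n : ℕ) (x : ℝ) : ℝ≥0∞ :=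
  ∑ j : Fin 2, ∑ s' : Link,
    (p.W densI k s n j s' x + ENNReal.ofReal (p.Lam (densA j) s' (p.R k s j s' x)))

lemma ofReal_integrand {densA densI : Fin 2 → ℝ} (k : Fin 2) (s : Link)
    (n : ℕ) {x : ℝ} (hx : 0 < x) :
    ENNReal.ofReal (p.integrand densA densI k s n x)
      = expNeg (ENNReal.ofReal (p.mu k s n x * p.noise))
        * expNeg (p.totalLoss densA densI k s n x) * ENNReal.ofReal (p.Lam' (densA k) s x) := by
  rw [integrand, ENNReal.ofReal_mul (by positivity), ENNReal.ofReal_mul (by positivity),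
    expNeg_ofReal (mul_nonneg (p.mu_nonneg k s n hx.le) p.noise_nonneg)]
  congr 2
  exact ENNReal.ofReal_toReal (expNeg_ne_top _)

end Params

/-! ### Expectation of the coverage functional -/

section

variable {T : Type} {Ω : Type*} {mΩ : MeasurableSpace Ω} {p : Params}
  {N : Network T Ω} {tier : T → Fin 2} {dens : T → ℝ} {Pr : Measure Ω}
  {a c : Fin 2 → T}

open Classical in
/-- The term of the coverage functional for the serving BS `(k, i)` in state `s`. -/
def servingTerm (p : Params) (A B : Network (Fin 2) Ω) (k : Fin 2) (s : Link) (n : ℕ) (i : ℕ)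
    (ω : Ω) : ℝ≥0∞ :=
  if A.IsServing p (k, i) ω ∧ A.link p (k, i) ω = s then
    expNeg (n * (ENNReal.ofReal (p.eta s) * fadeLevel p A B (allWeaker p A B) (k, i) ω)) else 0

lemma servingTerm_eq (ha : Function.LeftInverse tier a) (hc : Function.LeftInverse tier c)
    (k : Fin 2) (s : Link) (n i : ℕ) (ω : Ω) :
    servingTerm p (N.pick a) (N.pick c) k s n i ω
      = p.servingWeight k s n ‖N.loc (a k) i ω‖ (N.block (a k) i ω)
      * expNeg (restSum (a k, i) fun b : T × ℕ => p.exponent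
          (p.meanPower k s ‖N.loc (a k) i ω‖) (p.mu k s n ‖N.loc (a k) i ω‖)
          (b.1 ∈ range a) (b.1 ∈ range c) (tier b.1) (N.loc b.1 b.2 ω) (N.mark b.1 b.2 ω)) :=
  serving_term p N ha hc k i s n ω

variable [Fintype T]

/-- Locations and marks are free coordinates here, because `lintegral_loc_mark` integrates over them
separately. -/
lemma measurable_weightedExponent (k : Fin 2) (s : Link) (n : ℕ) (κ : T) (i : ℕ) (a c : Fin 2 → T)
    (tier : T → Fin 2) :
    Measurable fun z : (T × ℕ → Plane) × (T × ℕ → Mark) =>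
      p.servingWeight k s n ‖z.1 (κ, i)‖ (z.2 (κ, i)).1
      * expNeg (restSum (κ, i) fun b : T × ℕ => p.exponent
          (p.meanPower k s ‖z.1 (κ, i)‖) (p.mu k s n ‖z.1 (κ, i)‖)
          (b.1 ∈ range a) (b.1 ∈ range c) (tier b.1) (z.1 b) (z.2 b)) := by
  have hloc : ∀ b, Measurable fun z : (T × ℕ → Plane) × (T × ℕ → Mark) => z.1 b := fun b =>
    (measurable_pi_apply b).comp measurable_fst
  have hmark : ∀ b, Measurable fun z : (T × ℕ → Plane) × (T × ℕ → Mark) => z.2 b := fun b =>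
    (measurable_pi_apply b).comp measurable_snd
  have hmu := (p.measurable_mu k s n).comp (hloc (κ, i)).norm
  refine Measurable.mul ?_ (measurable_expNeg.comp (measurable_restSum fun b => ?_))
  · unfold Params.servingWeight
    refine Measurable.ite ((measurableSet_lt measurable_const (hloc (κ, i)).norm).inter
      (p.measurableSet_linkState s (hmark (κ, i)).fst (hloc (κ, i)).norm fun _ => norm_nonneg _))
      (measurable_expNeg.comp ?_) measurable_const
    exact (hmu.mul_const _).ennreal_ofReal
  · exact p.measurable_exponent ((p.measurable_meanPower k s).comp (hloc (κ, i)).norm) hmu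
      (hloc b) (hmark b) _ _ _

lemma Network.IsModel.measurable_servingTerm (hN : N.IsModel p tier dens Pr)
    (ha : Function.LeftInverse tier a) (hc : Function.LeftInverse tier c)
    (k : Fin 2) (s : Link) (n i : ℕ) :
    Measurable (servingTerm p (N.pick a) (N.pick c) k s n i) := by
  have h : servingTerm p (N.pick a) (N.pick c) k s n i
      = (fun z : (T × ℕ → Plane) × (T × ℕ → Mark) =>
      p.servingWeight k s n ‖z.1 (a k, i)‖ (z.2 (a k, i)).1
      * expNeg (restSum (a k, i) fun b : T × ℕ => p.exponent
          (p.meanPower k s ‖z.1 (a k, i)‖) (p.mu k s n ‖z.1 (a k, i)‖)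
          (b.1 ∈ range a) (b.1 ∈ range c) (tier b.1) (z.1 b) (z.2 b)))
      ∘ fun ω => (fun b : T × ℕ => N.loc b.1 b.2 ω, fun b : T × ℕ => N.mark b.1 b.2 ω) := by
    ext ω
    exact servingTerm_eq ha hc k s n i ω
  rw [h]
  exact (measurable_weightedExponent k s n (a k) i a c tier).comp
    ((measurable_pi_lambda _ fun b : T × ℕ => (hN.poisson b.1).measurable b.2).prodMk
      (measurable_pi_lambda _ fun b : T × ℕ => hN.measurable_mark b.1 b.2))

variable [IsProbabilityMeasure Pr]

/-- Averaging over the marks. -/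
lemma Network.IsModel.lintegral_servingTerm (hN : N.IsModel p tier dens Pr)
    (ha : Function.LeftInverse tier a) (hc : Function.LeftInverse tier c)
    (k : Fin 2) (s : Link) (n i : ℕ) :
    ∫⁻ ω, servingTerm p (N.pick a) (N.pick c) k s n i ω ∂Pr
      = ∫⁻ ω, p.baseWeight k s n ‖N.loc (a k) i ω‖
        * expNeg (restSum (a k, i) fun b : T × ℕ => negLog (p.meanFactor k s n
          (b.1 ∈ range a) (b.1 ∈ range c) (tier b.1) (N.loc b.1 b.2 ω) ‖N.loc (a k) i ω‖)) ∂Pr := by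
  simp_rw [servingTerm_eq ha hc k s n i]
  have h1 := hN.lintegral_loc_mark (measurable_weightedExponent (p := p) k s n (a k) i a c tier)
  refine Eq.trans h1 (lintegral_congr fun ω => ?_)
  dsimp only
  have hle : ∀ z : Mark, p.servingWeight k s n ‖N.loc (a k) i ω‖ z.1 ≤ 1 := fun z => by
    unfold Params.servingWeight
    split_ifs
    · exact expNeg_le_one _
    · exact zero_le
  have hm : Measurable fun z : Mark => p.servingWeight k s n ‖N.loc (a k) i ω‖ z.1 := by
    unfold Params.servingWeight
    refine Measurable.ite ((MeasurableSet.const _).inter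
      (p.measurableSet_linkState s measurable_fst measurable_const fun _ => norm_nonneg _))
      measurable_const measurable_const
  have h2 := hN.lintegral_marks (a k, i) hm hle (H := fun b => p.exponent
          (p.meanPower k s ‖N.loc (a k) i ω‖) (p.mu k s n ‖N.loc (a k) i ω‖)
          (b.1 ∈ range a) (b.1 ∈ range c) (tier b.1) (N.loc b.1 b.2 ω))
    (fun b => p.measurable_exponent measurable_const measurable_const measurable_const measurable_id
      _ _ _)
  refine h2.trans ?_
  congr 1
  · exact hN.lintegral_servingWeight k s n (a k) i
  · congr 2
    ext b
    rw [hN.lintegral_exponent (p.mu_nonneg k s n (norm_nonneg _))]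
    rfl

-- A process selected by `a` contributes the association terms of its tier, one selected by `c` the
-- interference terms, and a process selected by both contributes both. Injectivity of `a` and `c`
-- turns the sum over processes into sums over tiers.
open Classical in
lemma sum_totalLoss (ha : Function.LeftInverse tier a) (hc : Function.LeftInverse tier c)
    (hd : ∀ t, 0 ≤ dens t) (k : Fin 2) (s : Link) (n : ℕ) {x : ℝ} (hx : 0 < x) :
    ∑ t, ∫⁻ y : Plane, (1 - p.meanFactor k s n (t ∈ range a) (t ∈ range c) (tier t) y x)
        ∂(ENNReal.ofReal (dens t) • volume)
      = p.totalLoss (fun j => dens (a j)) (fun j => dens (c j)) k s n x := by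
  have h1 : ∀ t, ∫⁻ y : Plane, (1 - p.meanFactor k s n (t ∈ range a) (t ∈ range c) (tier t) y x)
        ∂(ENNReal.ofReal (dens t) • volume)
      = (if t ∈ range a then ∑ s', ENNReal.ofReal (p.Lam (dens t) s' (p.R k s (tier t) s' x)) else 0)
        + (if t ∈ range c then ∑ s', ∑ g : Fin 4, ENNReal.ofReal (p.gainProb (tier t) g) *
            ∫⁻ r in Ioi (p.R k s (tier t) s' x), ENNReal.ofReal
              (Params.F (p.nu s') (p.mu k s n x * p.P (tier t) * p.gainValue (tier t) g
                * r ^ (-p.alpha s') / p.nu s') * p.Lam' (dens t) s' r) else 0) := by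
    intro t
    rw [lintegral_smul_measure, smul_eq_mul]
    simp_rw [p.one_sub_meanFactor k s n _ _ _ _ hx.le]
    rw [lintegral_finsetSum, Finset.mul_sum]
    · simp_rw [p.lintegral_stateLoss k s n (hd t) _ _ _ _ hx, Finset.sum_add_distrib]
      congr 1 <;> split_ifs <;> simp
    · intro s' _
      exact (p.measurable_prob_norm s' measurable_norm fun _ => norm_nonneg _).ennreal_ofReal.mul
        (p.measurable_stateLoss measurable_const measurable_const measurable_norm _ _ _ _)
  simp_rw [h1]
  rw [Finset.sum_add_distrib, Params.totalLoss]
  simp_rw [Finset.sum_add_distrib]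
  rw [add_comm]
  congr 1
  · symm
    refine Fintype.sum_of_injective c hc.injective _ _ (fun t ht => if_neg ht) fun j => ?_
    rw [if_pos (mem_range_self j), hc j]
    rfl
  · symm
    refine Fintype.sum_of_injective a ha.injective _ _ (fun t ht => if_neg ht) fun j => ?_
    rw [if_pos (mem_range_self j), ha j]

lemma measurable_lintegral_one_sub {G : Plane → ℝ → ℝ≥0∞} (hG : Measurable (Function.uncurry G))
    (μ : Measure Plane) [SFinite μ] :
    Measurable fun r : Ioi (0 : ℝ) => ∫⁻ y : Plane, (1 - G y r) ∂μ := by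
  have h : Measurable fun z : Ioi (0 : ℝ) × Plane => 1 - G z.2 z.1 :=
    measurable_const.sub (hG.comp
      (measurable_snd.prodMk (measurable_subtype_coe.comp measurable_fst)))
  exact h.lintegral_prod_right'

/-- The exponent is realised as a planar integral of `meanFactor`, for an auxiliary family in which
the association and interference processes are disjoint copies of the two tiers; parametrised
integrals are measurable. -/
lemma measurable_totalLoss (p : Params) {densA densI : Fin 2 → ℝ} (hA : ∀ j, 0 ≤ densA j)
    (hI : ∀ j, 0 ≤ densI j) (k : Fin 2) (s : Link) (n : ℕ) :
    Measurable fun r : Ioi (0 : ℝ) => p.totalLoss densA densI k s n r := by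
  let tier : Fin 2 ⊕ Fin 2 → Fin 2 := Sum.elim id id
  let dens : Fin 2 ⊕ Fin 2 → ℝ := Sum.elim densA densI
  have hd : ∀ t, 0 ≤ dens t := fun t => by cases t <;> simp [dens, hA, hI]
  have hσ : ∀ t, SigmaFinite (ENNReal.ofReal (dens t) • (volume : Measure Plane)) := fun t => by
    change SigmaFinite ((dens t).toNNReal • (volume : Measure Plane))
    infer_instance
  have h : (fun r : Ioi (0 : ℝ) => p.totalLoss densA densI k s n r)
      = fun r : Ioi (0 : ℝ) => ∑ t, ∫⁻ y : Plane, (1 - p.meanFactor k s n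
          (t ∈ range (Sum.inl : Fin 2 → Fin 2 ⊕ Fin 2)) (t ∈ range (Sum.inr : Fin 2 → Fin 2 ⊕ Fin 2))
          (tier t) y r) ∂(ENNReal.ofReal (dens t) • volume) := by
    ext r
    exact (sum_totalLoss (tier := tier) (a := Sum.inl) (c := Sum.inr) (fun _ => rfl) (fun _ => rfl)
      hd k s n r.2).symm
  rw [h]
  exact Finset.measurable_fun_sum _ fun t _ =>
    measurable_lintegral_one_sub (p.measurable_meanFactor k s n _ _ _) _

/-- Expectation of the exponential coverage functional over serving BSs of tier `k` in state `s`. -/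
theorem Network.IsModel.lintegral_tsum_servingTerm (hN : N.IsModel p tier dens Pr)
    (ha : Function.LeftInverse tier a) (hc : Function.LeftInverse tier c)
    (hd : ∀ t, 0 ≤ dens t) (k : Fin 2) (s : Link) (n : ℕ) :
    ∫⁻ ω, ∑' i, servingTerm p (N.pick a) (N.pick c) k s n i ω ∂Pr
      = ∫⁻ x in Ioi (0 : ℝ), ENNReal.ofReal
        (p.integrand (fun j => dens (a j)) (fun j => dens (c j)) k s n x) := by
  have hσ : ∀ t, SigmaFinite (ENNReal.ofReal (dens t) • (volume : Measure Plane)) := fun t => by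
    change SigmaFinite ((dens t).toNNReal • (volume : Measure Plane))
    infer_instance
  let f : Plane → ℝ≥0∞ := fun y => p.baseWeight k s n ‖y‖
  have hfm : Measurable f := by
    classical
    have h1 := p.measurable_prob_norm s (measurable_norm (α := Plane)) fun _ => norm_nonneg _
    have h2 := (p.measurable_mu k s n).comp (measurable_norm (α := Plane))
    have h3 : Measurable fun y : Plane => p.mu k s n ‖y‖ := h2
    refine Measurable.ite (measurableSet_lt measurable_const measurable_norm) ?_ measurable_const
    fun_prop
  have hf1 : ∀ y, f y ≤ 1 := fun y => by
    simp only [f, Params.baseWeight]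
    split_ifs
    · refine mul_le_one' ?_ (expNeg_le_one _)
      exact ENNReal.ofReal_le_one.2 (p.prob_mem s (norm_nonneg y)).2
    · exact zero_le
  have hf0 : ∀ y, f y ≠ 0 → 0 < ‖y‖ := fun y hy => by
    by_contra h
    exact hy (if_neg h)
  -- The averaged factor rewritten as an exponent; it is infinite where the factor vanishes, for
  -- instance for a competitor that is certainly stronger.
  let g : T → Plane → ℝ → ℝ≥0∞ := fun t y r =>
    negLog (p.meanFactor k s n (t ∈ range a) (t ∈ range c) (tier t) y r)
  have hg : ∀ t, Measurable (Function.uncurry (g t)) := fun t =>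
    measurable_negLog.comp (p.measurable_meanFactor k s n _ _ _)
  have hgc : ∀ t y r, 0 < r → ContinuousWithinAt (g t y) (Ioi r) r := fun t y r hr =>
    (continuous_negLog.tendsto _).comp (p.continuousWithinAt_meanFactor k s n _ _ _ y hr)
  have key := hN.poissonFamily.palm_dependent (a k) hfm hf1 measurable_norm hf0 hg hgc
  have hX : ∀ t i, Measurable (N.loc t i) := fun t => (hN.poisson t).measurable
  rw [lintegral_tsum fun i => (hN.measurable_servingTerm ha hc k s n i).aemeasurable]
  simp_rw [hN.lintegral_servingTerm ha hc k s n]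
  rw [← lintegral_tsum fun i =>
    (measurable_palm_term hX hfm measurable_norm hg i).aemeasurable, key]
  have hG : ∀ t (y : Plane) {r : ℝ}, 0 ≤ r → expNeg (g t y r)
      = p.meanFactor k s n (t ∈ range a) (t ∈ range c) (tier t) y r := fun t y r hr =>
    expNeg_negLog (p.meanFactor_le_one k s n _ _ _ y hr)
  have hval : ∀ x : Plane, f x * expNeg (∑ t, ∫⁻ y, (1 - expNeg (g t y ‖x‖))
        ∂(ENNReal.ofReal (dens t) • volume))
      = p.baseWeight k s n ‖x‖ * expNeg (p.totalLoss (fun j => dens (a j)) (fun j => dens (c j))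
        k s n ‖x‖) := by
    intro x
    by_cases hx : 0 < ‖x‖
    · simp_rw [fun t y => hG t y hx.le]
      rw [sum_totalLoss ha hc hd k s n hx]
    · have : p.baseWeight k s n ‖x‖ = 0 := if_neg hx
      simp [f, this]
  simp_rw [hval]
  let Φ : ℝ → ℝ≥0∞ := fun r => p.baseWeight k s n r
      * expNeg (p.totalLoss (fun j => dens (a j)) (fun j => dens (c j)) k s n r)
  have hmeas : Measurable fun r : Ioi (0 : ℝ) => Φ r := by
    have h1 := p.measurable_prob_Ioi s
    have h2 : Measurable fun r : Ioi (0 : ℝ) => p.mu k s n r :=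
      (p.measurable_mu k s n).comp measurable_subtype_coe
    have h3 := measurable_totalLoss p (fun j => hd (a j)) (fun j => hd (c j)) k s n
    have h4 : (fun r : Ioi (0 : ℝ) => p.baseWeight k s n r) = fun r : Ioi (0 : ℝ) =>
        ENNReal.ofReal (p.prob s r) * expNeg (ENNReal.ofReal (p.mu k s n r * p.noise)) := by
      ext r
      exact if_pos r.2
    have h5 : Measurable fun r : Ioi (0 : ℝ) => p.baseWeight k s n r := by
      rw [h4]
      fun_prop
    exact h5.mul (measurable_expNeg.comp h3)
  rw [lintegral_smul_measure]
  -- The density times the circumference `2πr` times the state probability is `Lam'` off the jumps.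
  have hpol := lintegral_norm_plane (f := Φ) hmeas
  change ENNReal.ofReal (dens (a k)) * ∫⁻ y : Plane, Φ ‖y‖ = _
  rw [hpol, ← lintegral_const_mul' _ _ ENNReal.ofReal_ne_top]
  refine lintegral_congr_ae ?_
  filter_upwards [ae_restrict_mem measurableSet_Ioi, ae_restrict_of_ae p.ae_notMem_jumps]
    with r hr hj
  have hr0 : (0 : ℝ) < r := hr
  dsimp only [Φ]
  rw [p.ofReal_integrand k s n hr0, p.ofReal_Lam' (hd _) s hr0 hj, Params.baseWeight, if_pos hr0]
  ring

end


/-! ### Absolute convergence and the binomial expansion -/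

namespace Params

variable (p : Params)

lemma continuousOn_Lam (dens : ℝ) (s : Link) {b : ℝ} (hb : 0 ≤ b) :
    ContinuousOn (p.Lam dens s) (Icc 0 b) := by
  rw [← uIcc_of_le hb]
  exact continuousOn_const.mul
    (intervalIntegral.continuousOn_primitive_interval' (p.intervalIntegrable_prob s le_rfl hb)
      left_mem_uIcc)

/-- The density of the distance to the nearest BS in state `s` is integrable. -/
lemma integrableOn_exp_neg_Lam {dens : ℝ} (hd : 0 ≤ dens) (s : Link) :
    IntegrableOn (fun x => Real.exp (-p.Lam dens s x) * (2 * Real.pi * dens * (x * p.prob s x)))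
      (Ioi 0) := by
  have hi : ∀ b : ℝ, 0 ≤ b → IntervalIntegrable (fun x => Real.exp (-p.Lam dens s x)
      * (2 * Real.pi * dens * (x * p.prob s x))) volume 0 b := fun b hb => by
    refine ((p.intervalIntegrable_prob s le_rfl hb).const_mul _).continuousOn_mul ?_
    rw [uIcc_of_le hb]
    exact (p.continuousOn_Lam dens s hb).neg.rexp
  refine integrableOn_Ioi_of_intervalIntegral_norm_bounded (l := Filter.atTop) (b := fun n : ℕ => (n : ℝ))
    1 0 (fun n => ?_) tendsto_natCast_atTop_atTop (Filter.Eventually.of_forall fun n => ?_)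
  · exact (intervalIntegrable_iff_integrableOn_Ioc_of_le n.cast_nonneg).1 (hi n n.cast_nonneg)
  · have hn : (0 : ℝ) ≤ n := n.cast_nonneg
    have h1 : ∫ x in (0 : ℝ)..n, ‖Real.exp (-p.Lam dens s x)
        * (2 * Real.pi * dens * (x * p.prob s x))‖
        = ∫ x in (0 : ℝ)..n, Real.exp (-p.Lam dens s x)
          * (2 * Real.pi * dens * (x * p.prob s x)) := by
      refine intervalIntegral.integral_congr fun x hx => ?_
      rw [uIcc_of_le hn] at hx
      have := (p.prob_mem s hx.1).1
      have := hx.1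
      exact Real.norm_of_nonneg (by positivity)
    -- The primitive `-e^{-Λ}` is continuous, with the required derivative off the countable set of
    -- jumps. The integral up to `n` is therefore `1 - e^{-Λ(n)}`, at most one.
    have h2 := integral_eq_of_hasDerivAt_off_countable_of_le
      (fun x => -Real.exp (-p.Lam dens s x)) (fun x => Real.exp (-p.Lam dens s x)
          * (2 * Real.pi * dens * (x * p.prob s x))) hn p.countable_jumps
      (p.continuousOn_Lam dens s hn).neg.rexp.neg
      (fun x hx => by
        have := ((p.hasDerivAt_Lam dens s hx.1.1 hx.2).neg.exp).neg
        have h : Real.exp (-p.Lam dens s x) * (2 * Real.pi * dens * (x * p.prob s x))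
            = -(Real.exp (-p.Lam dens s x) * -(2 * Real.pi * dens * (x * p.prob s x))) := by ring
        rw [h]
        exact this) (hi n hn)
    rw [h1, h2]
    have h3 : p.Lam dens s 0 = 0 := by simp [Lam]
    have h4 := Real.exp_pos (-p.Lam dens s n)
    simp only [h3, neg_zero, Real.exp_zero]
    linarith

lemma integrand_eq (densA densI : Fin 2 → ℝ) (k : Fin 2) (s : Link) (n : ℕ) (x : ℝ) :
    p.integrand densA densI k s n x = Real.exp (-(p.mu k s n x * p.noise))
      * (expNeg (p.totalLoss densA densI k s n x)).toReal * p.Lam' (densA k) s x := rfl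

/-- The noise factor is at most one, and the total exponent dominates `Λ_k^s([0, x))` by `R_self`;
this leaves the integrable majorant of `integrableOn_exp_neg_Lam`. -/
lemma integrableOn_integrand {densA densI : Fin 2 → ℝ} (hA : ∀ j, 0 ≤ densA j)
    (hI : ∀ j, 0 ≤ densI j) (k : Fin 2) (s : Link) (n : ℕ) :
    IntegrableOn (p.integrand densA densI k s n) (Ioi 0) := by
  refine (p.integrableOn_exp_neg_Lam (hA k) s).mono' ?_ ?_
  · refine AEMeasurable.aestronglyMeasurable ?_
    rw [aemeasurable_restrict_iff_comap_subtype measurableSet_Ioi]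
    have h2 : Measurable fun r : Ioi (0 : ℝ) => p.mu k s n r :=
      (p.measurable_mu k s n).comp measurable_subtype_coe
    have h3 := measurable_expNeg.comp (measurable_totalLoss p hA hI k s n)
    have h4 : Measurable fun r : Ioi (0 : ℝ) => p.Lam' (densA k) s r :=
      (measurable_deriv _).comp measurable_subtype_coe
    exact (((h2.mul_const _).neg.exp.mul h3.ennreal_toReal).mul h4).aemeasurable
  · filter_upwards [ae_restrict_mem measurableSet_Ioi, ae_restrict_of_ae p.ae_notMem_jumps]
      with x hx hj
    have hx0 : (0 : ℝ) < x := hx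
    have hL := p.Lam_nonneg (hA k) s hx0.le
    have h1 : ENNReal.ofReal (p.Lam (densA k) s x) ≤ p.totalLoss densA densI k s n x := by
      have h2 : ∀ j, ∀ s', p.W densI k s n j s' x
          + ENNReal.ofReal (p.Lam (densA j) s' (p.R k s j s' x)) ≤ p.totalLoss densA densI k s n x :=
        fun j s' => (Finset.single_le_sum (f := fun s' => p.W densI k s n j s' x
          + ENNReal.ofReal (p.Lam (densA j) s' (p.R k s j s' x))) (fun _ _ => zero_le)
            (Finset.mem_univ s')).trans
          (Finset.single_le_sum (f := fun j => ∑ s', (p.W densI k s n j s' x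
          + ENNReal.ofReal (p.Lam (densA j) s' (p.R k s j s' x)))) (fun _ _ => zero_le)
            (Finset.mem_univ j))
      have h3 := h2 k s
      rw [R_self] at h3
      exact le_add_self.trans h3
    have h2 : (expNeg (p.totalLoss densA densI k s n x)).toReal
        ≤ Real.exp (-p.Lam (densA k) s x) := by
      have := ENNReal.toReal_mono (expNeg_ne_top _) (expNeg_antitone h1)
      rwa [expNeg_ofReal hL, ENNReal.toReal_ofReal (Real.exp_pos _).le] at this
    have h3 : Real.exp (-(p.mu k s n x * p.noise)) ≤ 1 :=
      Real.exp_le_one_iff.2 (neg_nonpos.2 (mul_nonneg (p.mu_nonneg k s n hx0.le) p.noise_nonneg))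
    have h4 := p.Lam'_nonneg (hA k) s hx0 hj
    rw [integrand_eq, Real.norm_of_nonneg (by positivity), ← p.Lam'_eq _ s hx0 hj]
    gcongr
    calc _ ≤ 1 * Real.exp (-p.Lam (densA k) s x) := by gcongr
      _ = _ := one_mul _

lemma integral_integrand {densA densI : Fin 2 → ℝ} (hA : ∀ j, 0 ≤ densA j)
    (hI : ∀ j, 0 ≤ densI j) (k : Fin 2) (s : Link) (n : ℕ) :
    ∫ x in Ioi (0 : ℝ), p.integrand densA densI k s n x
      = (∫⁻ x in Ioi (0 : ℝ), ENNReal.ofReal (p.integrand densA densI k s n x)).toReal := by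
  refine integral_eq_lintegral_of_nonneg_ae ?_
    (p.integrableOn_integrand hA hI k s n).aestronglyMeasurable
  filter_upwards [ae_restrict_mem measurableSet_Ioi, ae_restrict_of_ae p.ae_notMem_jumps]
    with x hx hj
  have := p.Lam'_nonneg (hA k) s hx hj
  rw [integrand_eq]
  positivity

lemma densPHP_pos : 0 < p.densPHP := mul_pos p.dens2_pos (Real.exp_pos _)

/-- Binomial expansion of the approximate tail. -/
lemma toReal_approxTail (s : Link) (z : ℝ≥0∞) :
    (p.approxTail s z).toReal = ∑ n ∈ Finset.Icc 1 (p.nu s),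
      (-1 : ℝ) ^ (n + 1) * ((p.nu s).choose n : ℝ)
        * (expNeg (n * (ENNReal.ofReal (p.eta s) * z))).toReal := by
  set e := expNeg (ENNReal.ofReal (p.eta s) * z) with he
  have he1 : e ≤ 1 := expNeg_le_one _
  have h1 : (p.approxTail s z).toReal = 1 - (1 - e.toReal) ^ p.nu s := by
    change (1 - (1 - e) ^ p.nu s : ℝ≥0∞).toReal = _
    rw [ENNReal.toReal_sub_of_le (pow_le_one' tsub_le_self _) ENNReal.one_ne_top, ENNReal.toReal_pow,
      ENNReal.toReal_sub_of_le he1 ENNReal.one_ne_top, ENNReal.toReal_one]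
  have h2 : (1 - e.toReal) ^ p.nu s
      = ∑ n ∈ Finset.range (p.nu s + 1), (-1 : ℝ) ^ n * ((p.nu s).choose n : ℝ) * e.toReal ^ n := by
    rw [sub_eq_neg_add, add_pow]
    refine Finset.sum_congr rfl fun n _ => ?_
    rw [one_pow, mul_one, neg_pow]
    ring
  rw [h1, h2, Finset.range_eq_Ico, Finset.sum_eq_sum_Ico_succ_bot (Nat.succ_pos _)]
  simp only [pow_zero, Nat.choose_zero_right, Nat.cast_one, zero_add, mul_one]
  -- The term `n = 0` cancels the leading `1`; the remaining minus sign turns `(-1)^n` into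
  -- `(-1)^(n+1)`.
  rw [sub_add_cancel_left, ← Finset.sum_neg_distrib]
  have h3 : Finset.Ico 1 (p.nu s + 1) = Finset.Icc 1 (p.nu s) := rfl
  rw [h3]
  refine Finset.sum_congr rfl fun n _ => ?_
  rw [expNeg_natCast_mul, ENNReal.toReal_pow]
  ring

end Params


/-! ### Uniqueness of the serving BS and the pointwise expansion -/

section

variable {Ω : Type*} {p : Params}

lemma Network.IsServing.unique {A : Network (Fin 2) Ω} {b b' : BS} {ω : Ω} (h : A.IsServing p b ω)
    (h' : A.IsServing p b' ω) : b' = b := by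
  by_contra hne
  exact lt_asymm (h b' hne) (h' b (Ne.symm hne))

open Classical in
lemma tsum_servingTerm_of_isServing {A : Network (Fin 2) Ω} (B : Network (Fin 2) Ω) {b : BS} {ω : Ω}
    (h : A.IsServing p b ω) (k : Fin 2) (s : Link) (n : ℕ) :
    ∑' i, servingTerm p A B k s n i ω
      = if k = b.1 ∧ s = A.link p b ω then
        expNeg (n * (ENNReal.ofReal (p.eta s) * fadeLevel p A B (allWeaker p A B) b ω)) else 0 := by
  have hz : ∀ i, i ≠ b.2 → servingTerm p A B k s n i ω = 0 := fun i hi =>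
    if_neg fun h' => hi (congrArg Prod.snd (h.unique h'.1))
  rw [tsum_eq_single b.2 hz]
  obtain ⟨k₀, i₀⟩ := b
  by_cases hk : k = k₀
  · subst hk
    simp [servingTerm, h, eq_comm]
  · rw [if_neg fun h' => hk h'.1]
    exact if_neg fun h' => hk (congrArg Prod.fst (h.unique h'.1))

lemma tsum_servingTerm_le_one (A B : Network (Fin 2) Ω) (k : Fin 2) (s : Link) (n : ℕ) (ω : Ω) :
    ∑' i, servingTerm p A B k s n i ω ≤ 1 := by
  by_cases h : ∃ b, A.IsServing p b ω
  · obtain ⟨b, hb⟩ := h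
    rw [tsum_servingTerm_of_isServing B hb]
    split_ifs
    · exact expNeg_le_one _
    · exact zero_le
  · have : ∀ i, servingTerm p A B k s n i ω = 0 := fun i => if_neg fun h' => h ⟨_, h'.1⟩
    simp [this]

lemma tsum_indicator_isServing {A : Network (Fin 2) Ω} {b : BS} {ω : Ω} (h : A.IsServing p b ω)
    (Q : BS → ℝ≥0∞) : ∑' b, {b | A.IsServing p b ω}.indicator Q b = Q b := by
  rw [tsum_eq_single b fun b' hb' => indicator_of_notMem (fun h' => hb' (h.unique h')) _]
  exact indicator_of_mem h _

/-- Pointwise binomial expansion of the approximate coverage functional. -/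
lemma toReal_tsum_approxTail (A B : Network (Fin 2) Ω) (ω : Ω) :
    (∑' b, {b | A.IsServing p b ω}.indicator
        (fun b => p.approxTail (A.link p b ω) (fadeLevel p A B (allWeaker p A B) b ω)) b).toReal
      = ∑ k : Fin 2, ∑ s : Link, ∑ n ∈ Finset.Icc 1 (p.nu s),
        (-1 : ℝ) ^ (n + 1) * ((p.nu s).choose n : ℝ)
          * (∑' i, servingTerm p A B k s n i ω).toReal := by
  classical
  by_cases h : ∃ b, A.IsServing p b ω
  · obtain ⟨b, hb⟩ := h
    rw [tsum_indicator_isServing hb, p.toReal_approxTail]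
    simp_rw [tsum_servingTerm_of_isServing B hb]
    rw [Finset.sum_eq_single_of_mem b.1 (Finset.mem_univ _) fun k _ hk => by simp [hk],
      Finset.sum_eq_single_of_mem (A.link p b ω) (Finset.mem_univ _) fun s _ hs => by simp [hs]]
    simp
  · have h1 : ∀ k s n i, servingTerm p A B k s n i ω = 0 :=
      fun k s n i => if_neg fun h' => h ⟨_, h'.1⟩
    have h2 : {b | A.IsServing p b ω} = ∅ := by
      ext b
      exact ⟨fun hb => h ⟨b, hb⟩, fun hb => hb.elim⟩
    simp [h1, h2]

lemma tsum_approxTail_le_one (A B : Network (Fin 2) Ω) (ω : Ω) :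
    ∑' b, {b | A.IsServing p b ω}.indicator
        (fun b => p.approxTail (A.link p b ω) (fadeLevel p A B (allWeaker p A B) b ω)) b ≤ 1 := by
  by_cases h : ∃ b, A.IsServing p b ω
  · obtain ⟨b, hb⟩ := h
    rw [tsum_indicator_isServing hb]
    exact tsub_le_self
  · have h2 : {b | A.IsServing p b ω} = ∅ := by
      ext b
      exact ⟨fun hb => h ⟨b, hb⟩, fun hb => hb.elim⟩
    simp [h2]

/-! ### A single network: all others interfere -/

/-- The association rule makes every other BS strictly weaker, and no BS is weaker than itself. The
single-network models thus become instances of `allWeaker`. -/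
lemma allOthers_eq_allWeaker {A : Network (Fin 2) Ω} {b : BS} {ω : Ω} (h : A.IsServing p b ω) :
    allOthers b ω = allWeaker p A A b ω := by
  ext b'
  refine ⟨fun hb' => h b' hb', fun hb' => ?_⟩
  rintro rfl
  exact lt_irrefl (A.avgPower p b' ω) hb'

variable [MeasurableSpace Ω]

lemma coverageProb_allOthers (A : Network (Fin 2) Ω) (Pr : Measure Ω) :
    coverageProb p A A allOthers Pr = coverageProb p A A (allWeaker p A A) Pr := by
  unfold coverageProb
  congr 1
  ext ω
  refine exists_congr fun b => and_congr_right fun h => ?_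
  rw [sinr, sinr, allOthers_eq_allWeaker h]

lemma tailCoverage_allOthers (A : Network (Fin 2) Ω) (Q : Link → ℝ≥0∞ → ℝ≥0∞) (Pr : Measure Ω) :
    tailCoverage p A A allOthers Q Pr = tailCoverage p A A (allWeaker p A A) Q Pr := by
  unfold tailCoverage
  congr with ω
  congr with b
  by_cases h : A.IsServing p b ω
  · rw [indicator_of_mem (show b ∈ {b | A.IsServing p b ω} from h),
      indicator_of_mem (show b ∈ {b | A.IsServing p b ω} from h), fadeLevel, fadeLevel,
      allOthers_eq_allWeaker h]
  · rw [indicator_of_notMem (show b ∉ {b | A.IsServing p b ω} from h),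
      indicator_of_notMem (show b ∉ {b | A.IsServing p b ω} from h)]

end

/-! ### The formula for the approximate coverage probability -/

variable {T : Type} [Fintype T] {Ω : Type*} {mΩ : MeasurableSpace Ω} {p : Params}
  {N : Network T Ω} {tier : T → Fin 2} {dens : T → ℝ} {Pr : Measure Ω} [IsProbabilityMeasure Pr]
  {a c : Fin 2 → T}

/-- The formula for the approximate coverage probability. -/
theorem Network.IsModel.toReal_tailCoverage_approxTail (hN : N.IsModel p tier dens Pr)
    (ha : Function.LeftInverse tier a) (hc : Function.LeftInverse tier c) (hd : ∀ t, 0 ≤ dens t) :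
    (tailCoverage p (N.pick a) (N.pick c) (allWeaker p (N.pick a) (N.pick c)) p.approxTail
        Pr).toReal = p.formula (fun j => dens (a j)) (fun j => dens (c j)) := by
  have hm : ∀ k s n, Measurable fun ω => ∑' i, servingTerm p (N.pick a) (N.pick c) k s n i ω :=
    fun k s n => Measurable.tsum fun i => hN.measurable_servingTerm ha hc k s n i
  have hle := tsum_servingTerm_le_one (p := p) (N.pick a) (N.pick c)
  have hint : ∀ k s n,
      Integrable (fun ω => (∑' i, servingTerm p (N.pick a) (N.pick c) k s n i ω).toReal) Pr := by
    intro k s n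
    refine Integrable.of_bound (hm k s n).ennreal_toReal.aestronglyMeasurable 1 (ae_of_all _ fun ω => ?_)
    rw [Real.norm_of_nonneg ENNReal.toReal_nonneg]
    exact ENNReal.toReal_le_of_le_ofReal zero_le_one (by simpa using hle k s n ω)
  let S : Ω → ℝ≥0∞ := fun ω => ∑' b, {b | (N.pick a).IsServing p b ω}.indicator
    (fun b => p.approxTail ((N.pick a).link p b ω)
      (fadeLevel p (N.pick a) (N.pick c) (allWeaker p (N.pick a) (N.pick c)) b ω)) b
  have hS1 : ∀ ω, S ω < ∞ := fun ω => (tsum_approxTail_le_one _ _ ω).trans_lt ENNReal.one_lt_top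
  have hSr : ∀ ω, (S ω).toReal = _ := fun ω =>
    toReal_tsum_approxTail (p := p) (N.pick a) (N.pick c) ω
  -- Measurability is read off the binomial expansion of the real value, which determines `S`
  -- because `S` is finite.
  have hSm : Measurable S := by
    have h1 : Measurable fun ω => (S ω).toReal := by
      simp_rw [hSr]
      exact Finset.measurable_fun_sum _ fun k _ => Finset.measurable_fun_sum _ fun s _ =>
        Finset.measurable_fun_sum _ fun n _ => (hm k s n).ennreal_toReal.const_mul _
    have h2 : S = fun ω => ENNReal.ofReal (S ω).toReal := by
      ext ω
      exact (ENNReal.ofReal_toReal (hS1 ω).ne).symm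
    rw [h2]
    exact h1.ennreal_ofReal
  change (∫⁻ ω, S ω ∂Pr).toReal = _
  -- The expansion has alternating signs, so integration is moved to the reals, where every term is
  -- bounded and hence integrable.
  rw [← integral_toReal hSm.aemeasurable (ae_of_all _ hS1)]
  simp_rw [hSr]
  rw [integral_finsetSum _ fun k _ => integrable_finsetSum _ fun s _ =>
    integrable_finsetSum _ fun n _ => (hint k s n).const_mul _]
  refine Finset.sum_congr rfl fun k _ => ?_
  rw [integral_finsetSum _ fun s _ => integrable_finsetSum _ fun n _ => (hint k s n).const_mul _]
  refine Finset.sum_congr rfl fun s _ => ?_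
  rw [integral_finsetSum _ fun n _ => (hint k s n).const_mul _]
  refine Finset.sum_congr rfl fun n _ => ?_
  rw [integral_const_mul, integral_toReal (hm k s n).aemeasurable
    (ae_of_all _ fun ω => (hle k s n ω).trans_lt ENNReal.one_lt_top),
    hN.lintegral_tsum_servingTerm ha hc hd k s n,
    p.integral_integrand (fun j => hd (a j)) (fun j => hd (c j))]


/-! ### Measurability of the network functionals -/

/-- All random objects of the network are measurable. -/
structure Network.IsMeasurable {T : Type} {Ω : Type*} [MeasurableSpace Ω] (N : Network T Ω) :
    Prop where
  loc : ∀ t i, Measurable (N.loc t i)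
  block : ∀ t i, Measurable (N.block t i)
  gain : ∀ t i, Measurable (N.gain t i)
  fade : ∀ t i s, Measurable (N.fade t i s)

lemma Network.IsMeasurable.pick {T T' : Type} {Ω : Type*} [MeasurableSpace Ω] {N : Network T Ω}
    (h : N.IsMeasurable) (f : T' → T) : (N.pick f).IsMeasurable where
  loc t := h.loc (f t)
  block t := h.block (f t)
  gain t := h.gain (f t)
  fade t := h.fade (f t)

namespace Network.IsMeasurable

variable {Ω : Type*} [MeasurableSpace Ω] {A B : Network (Fin 2) Ω} (p : Params)

lemma dist (h : A.IsMeasurable) (b : BS) : Measurable (A.dist b) := (h.loc b.1 b.2).norm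

lemma link (h : A.IsMeasurable) (b : BS) (s : Link) : MeasurableSet {ω | A.link p b ω = s} :=
  p.measurableSet_linkState s (h.block b.1 b.2) (h.dist b) fun _ => norm_nonneg _

lemma comp_link (h : A.IsMeasurable) (b : BS) {f : Link → Ω → ℝ} (hf : ∀ s, Measurable (f s)) :
    Measurable fun ω => f (A.link p b ω) ω := by
  classical
  have : (fun ω => f (A.link p b ω) ω)
      = fun ω => if A.link p b ω = .LOS then f .LOS ω else f .NLOS ω := by
    ext ω
    cases hs : A.link p b ω <;> simp
  rw [this]
  exact Measurable.ite (h.link p b .LOS) (hf _) (hf _)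

lemma chan (h : A.IsMeasurable) (b : BS) : Measurable (A.chan p b) :=
  h.comp_link p b fun s => h.fade b.1 b.2 s

lemma rpow_dist (h : A.IsMeasurable) (b : BS) :
    Measurable fun ω => A.dist b ω ^ (-p.alpha (A.link p b ω)) :=
  h.comp_link p b (f := fun s ω => A.dist b ω ^ (-p.alpha s)) fun _ => (h.dist b).pow_const _

lemma avgPower (h : A.IsMeasurable) (b : BS) : Measurable (A.avgPower p b) :=
  (h.rpow_dist p b).const_mul _

lemma rxPower (h : A.IsMeasurable) (b : BS) : Measurable (A.rxPower p b) :=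
  (((h.chan p b).const_mul _).mul
    ((Measurable.of_discrete (f := p.gainValue b.1)).comp (h.gain b.1 b.2))).mul (h.rpow_dist p b)

lemma isServing (h : A.IsMeasurable) (b : BS) : MeasurableSet {ω | A.IsServing p b ω} := by
  have : {ω | A.IsServing p b ω} = ⋂ b', ⋂ (_ : b' ≠ b), {ω | A.avgPower p b' ω < A.avgPower p b ω} := by
    ext ω
    simp [Network.IsServing]
  rw [this]
  exact MeasurableSet.iInter fun b' => MeasurableSet.iInter fun _ =>
    measurableSet_lt (h.avgPower p b') (h.avgPower p b)

lemma interference (hA : A.IsMeasurable) (hB : B.IsMeasurable) (b : BS) :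
    Measurable fun ω => B.interference p (allWeaker p A B b ω) ω := by
  classical
  refine Measurable.tsum fun b' => ?_
  have : (fun ω => (allWeaker p A B b ω).indicator (fun b => ENNReal.ofReal (B.rxPower p b ω)) b')
      = fun ω => if B.avgPower p b' ω < A.avgPower p b ω then ENNReal.ofReal (B.rxPower p b' ω)
        else 0 := by
    ext ω
    rw [indicator_apply]
    rfl
  rw [this]
  exact Measurable.ite (measurableSet_lt (hB.avgPower p b') (hA.avgPower p b))
    (hB.rxPower p b').ennreal_ofReal measurable_const

lemma fadeLevel (hA : A.IsMeasurable) (hB : B.IsMeasurable) (b : BS) :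
    Measurable (fadeLevel p A B (allWeaker p A B) b) :=
  ((measurable_const.add (hA.interference p hB b)).const_mul _).div
    (hA.avgPower p b).ennreal_ofReal

end Network.IsMeasurable

lemma Params.measurable_gammaTail (p : Params) (s : Link) : Measurable (p.gammaTail s) := by
  refine Antitone.measurable fun z z' h => measure_mono fun x hx => ?_
  exact lt_of_le_of_lt h hx

/-! ### Coverage in terms of the fading of the serving link -/

/-- Clearing denominators in `[0, ∞]`; a serving BS has positive averaged power, so only the
denominator of the SINR can degenerate. -/
lemma lt_sinr_iff {Ω : Type*} {p : Params} {A : Network (Fin 2) Ω} (B : Network (Fin 2) Ω)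
    (I : BS → Ω → Set BS) {b : BS} {ω : Ω} (h : A.IsServing p b ω) :
    ENNReal.ofReal (p.tau b.1) < sinr p A B I b ω
      ↔ fadeLevel p A B I b ω < ENNReal.ofReal (A.chan p b ω) := by
  have hpos : 0 < A.avgPower p b ω := p.meanPower_pos b.1 _ (IsServing.dist_pos p h)
  have hτ : ENNReal.ofReal (p.tau b.1) ≠ 0 := (ENNReal.ofReal_pos.2 (p.tau_pos _)).ne'
  have h1 : p.P b.1 * A.chan p b ω * (p.M b.1 * p.MUE) * A.dist b ω ^ (-p.alpha (A.link p b ω))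
      = A.avgPower p b ω * A.chan p b ω := by
    rw [Network.avgPower]
    ring
  rw [sinr, fadeLevel, h1, ENNReal.ofReal_mul hpos.le]
  have hq0 : ENNReal.ofReal (A.avgPower p b ω) ≠ 0 := (ENNReal.ofReal_pos.2 hpos).ne'
  rw [ENNReal.div_lt_iff (Or.inl hq0) (Or.inl ENNReal.ofReal_ne_top), mul_comm (ENNReal.ofReal (A.chan p b ω))]
  set d := ENNReal.ofReal p.noise + B.interference p (I b ω) ω
  set y := ENNReal.ofReal (A.avgPower p b ω) * ENNReal.ofReal (A.chan p b ω) with hy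
  have hyt : y ≠ ∞ := ENNReal.mul_ne_top ENNReal.ofReal_ne_top ENNReal.ofReal_ne_top
  -- For `d = 0` the conventions `0 / 0 = 0` and `y / 0 = ∞` for `y ≠ 0` agree with `τ · 0 < y`; for
  -- `d = ∞` both inequalities fail.
  rcases eq_or_ne d 0 with hd | hd
  · rcases eq_or_ne y 0 with h0 | h0
    · simp [hd, h0]
    · simp [hd, ENNReal.div_zero h0, pos_iff_ne_zero, h0]
  · rcases eq_or_ne d ∞ with ht | ht
    · simp [ht, ENNReal.mul_top hτ, ENNReal.div_top]
    · exact ENNReal.lt_div_iff_mul_lt (Or.inl hd) (Or.inl ht)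


/-! ### Independence of the fading level from the serving fading gain -/

open Classical in
/-- The network with one fading gain erased. -/
def Network.eraseFade {T : Type} {Ω : Type*} (N : Network T Ω) (κ : T) (i : ℕ) (s : Link) :
    Network T Ω where
  loc := N.loc
  block := N.block
  gain := N.gain
  fade t j s' ω := if t = κ ∧ j = i ∧ s' = s then 0 else N.fade t j s' ω

/-- Configurations of locations and marks. -/
abbrev Config (T : Type) : Type := (T × ℕ → Plane) × (T × ℕ → Mark)

/-- The network of coordinates on the space of configurations. -/
def coordNetwork (T : Type) : Network T (Config T) where
  loc t i z := z.1 (t, i)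
  block t i z := (z.2 (t, i)).1
  gain t i z := (z.2 (t, i)).2.1
  fade t i s z := (z.2 (t, i)).2.2 s

lemma coordNetwork_isMeasurable (T : Type) : (coordNetwork T).IsMeasurable where
  loc t i := (measurable_pi_apply (t, i)).comp measurable_fst
  block t i := ((measurable_pi_apply (t, i)).comp measurable_snd).fst
  gain t i := ((measurable_pi_apply (t, i)).comp measurable_snd).snd.fst
  fade t i s := (measurable_pi_apply s).comp ((measurable_pi_apply (t, i)).comp measurable_snd).snd.snd

/-- The configuration of a network. -/
def Network.config {T : Type} {Ω : Type*} (N : Network T Ω) (ω : Ω) : Config T :=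
  (fun b => N.loc b.1 b.2 ω, fun b => N.mark b.1 b.2 ω)

section

variable {T : Type} {Ω : Type*} {p : Params} {N : Network T Ω} {tier : T → Fin 2} {a c : Fin 2 → T}

/-- The required fading level does not depend on the fading of the serving link. -/
lemma fadeLevel_eraseFade (ha : Function.LeftInverse tier a) (hc : Function.LeftInverse tier c)
    (N : Network T Ω) (b : BS) (s : Link) (ω : Ω) :
    fadeLevel p ((N.eraseFade (a b.1) b.2 s).pick a) ((N.eraseFade (a b.1) b.2 s).pick c)
      (allWeaker p ((N.eraseFade (a b.1) b.2 s).pick a) ((N.eraseFade (a b.1) b.2 s).pick c)) b ω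
    = fadeLevel p (N.pick a) (N.pick c) (allWeaker p (N.pick a) (N.pick c)) b ω := by
  have h : ((N.eraseFade (a b.1) b.2 s).pick c).interference p
      (allWeaker p (N.pick a) (N.pick c) b ω) ω
      = (N.pick c).interference p (allWeaker p (N.pick a) (N.pick c) b ω) ω := by
    refine tsum_congr fun b' => ?_
    by_cases hw : b' ∈ allWeaker p (N.pick a) (N.pick c) b ω
    · rw [indicator_of_mem hw, indicator_of_mem hw]
      -- The erased gain belongs to the serving point. An interferer that is this same point would
      -- have the same averaged power, so it could not be weaker.
      have hne : ¬ (c b'.1 = a b.1 ∧ b'.2 = b.2) := by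
        rintro ⟨h1, h2⟩
        have h3 : b'.1 = b.1 := by rw [← hc b'.1, h1, ha b.1]
        have h4 : (N.pick c).avgPower p b' ω = (N.pick a).avgPower p b ω := by
          rw [avgPower_pick, avgPower_pick, h1, h2, h3]
        have hw' : (N.pick c).avgPower p b' ω < (N.pick a).avgPower p b ω := hw
        exact hw'.ne h4
      have hch : ((N.eraseFade (a b.1) b.2 s).pick c).chan p b' ω = (N.pick c).chan p b' ω :=
        if_neg fun h => hne ⟨h.1, h.2.1⟩
      have : ((N.eraseFade (a b.1) b.2 s).pick c).rxPower p b' ω = (N.pick c).rxPower p b' ω := by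
        unfold Network.rxPower
        rw [hch]
        rfl
      rw [this]
    · rw [indicator_of_notMem hw, indicator_of_notMem hw]
  unfold fadeLevel
  exact congrArg (fun x => ENNReal.ofReal (p.tau b.1) * (ENNReal.ofReal p.noise + x)
    / ENNReal.ofReal ((N.pick a).avgPower p b ω)) h

/-- The erased coordinate is constant, so every coordinate of the configuration depends on the other
sources only. -/
lemma measurable_config_eraseFade (N : Network T Ω) (κ : T) (i : ℕ) (s : Link) :
    Measurable[⨆ x ∈ ({.fade κ i s}ᶜ : Set (Source T)), N.sigma x]
      (N.eraseFade κ i s).config := by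
  have hle : ∀ x ∈ ({.fade κ i s}ᶜ : Set (Source T)),
      N.sigma x ≤ ⨆ x ∈ ({.fade κ i s}ᶜ : Set (Source T)), N.sigma x := fun x hx =>
    le_iSup₂ (f := fun x (_ : x ∈ ({.fade κ i s}ᶜ : Set (Source T))) => N.sigma x) x hx
  set m := ⨆ x ∈ ({.fade κ i s}ᶜ : Set (Source T)), N.sigma x with hm
  refine Measurable.prodMk (m := m) (@measurable_pi_lambda _ _ _ m _ _ fun b => ?_)
    (@measurable_pi_lambda _ _ _ m _ _ fun b => ?_)
  · refine (comap_measurable _).mono ?_ le_rfl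
    exact (le_iSup (fun i => MeasurableSpace.comap (N.loc b.1 i) inferInstance) b.2).trans
      (hle (.loc b.1) (by simp))
  · refine Measurable.prodMk (m := m)
      ((comap_measurable _).mono (hle (.block b.1 b.2) (by simp)) le_rfl)
      (Measurable.prodMk (m := m) ((comap_measurable _).mono (hle (.gain b.1 b.2) (by simp)) le_rfl)
      (@measurable_pi_lambda _ _ _ m _ _ fun s' => ?_))
    by_cases h : b.1 = κ ∧ b.2 = i ∧ s' = s
    · have : (fun ω => (N.eraseFade κ i s).fade b.1 b.2 s' ω) = fun _ => 0 := by
        ext ω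
        exact if_pos h
      rw [this]
      exact @measurable_const _ _ _ m _
    · have : (fun ω => (N.eraseFade κ i s).fade b.1 b.2 s' ω) = N.fade b.1 b.2 s' := by
        ext ω
        exact if_neg h
      rw [this]
      refine (comap_measurable _).mono (hle (.fade b.1 b.2 s') fun h' => h ?_) le_rfl
      cases h'
      exact ⟨rfl, rfl, rfl⟩

end

/-! ### Decomposition by serving BS and link state -/

section

variable {Ω : Type*} [MeasurableSpace Ω] {p : Params} {A B : Network (Fin 2) Ω} {Pr : Measure Ω}

/-- The events are disjoint because the serving BS is unique. Fixing the state replaces the channel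
gain by a single mark `fade`, to which independence applies; existence of a serving BS is not
required. -/
lemma coverageProb_eq_tsum (hA : A.IsMeasurable) (hB : B.IsMeasurable) :
    coverageProb p A B (allWeaker p A B) Pr
      = ∑' q : BS × Link, Pr {ω | (A.IsServing p q.1 ω ∧ A.link p q.1 ω = q.2) ∧
          fadeLevel p A B (allWeaker p A B) q.1 ω < ENNReal.ofReal (A.fade q.1.1 q.1.2 q.2 ω)} := by
  rw [← measure_iUnion]
  · unfold coverageProb
    congr 1
    ext ω
    rw [mem_iUnion]
    constructor
    · rintro ⟨b, hb, hlt⟩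
      exact ⟨(b, A.link p b ω), ⟨hb, rfl⟩, (lt_sinr_iff B _ hb).1 hlt⟩
    · rintro ⟨⟨b, s⟩, ⟨hb, hs⟩, hlt⟩
      refine ⟨b, hb, (lt_sinr_iff B _ hb).2 ?_⟩
      rw [Network.chan, hs]
      exact hlt
  · intro q q' hq
    refine Set.disjoint_left.2 fun ω h h' => hq ?_
    have h1 : q'.1 = q.1 := h.1.1.unique h'.1.1
    have h2 : A.link p q.1 ω = q.2 := h.1.2
    have h3 : A.link p q'.1 ω = q'.2 := h'.1.2
    exact Prod.ext h1.symm (by rw [← h2, ← h3, h1])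
  · exact fun q => ((hA.isServing p q.1).inter (hA.link p q.1 q.2)).inter
      (measurableSet_lt (hA.fadeLevel p hB q.1) (hA.fade _ _ _).ennreal_ofReal)

lemma tailCoverage_eq_tsum (hA : A.IsMeasurable) (hB : B.IsMeasurable)
    {Q : Link → ℝ≥0∞ → ℝ≥0∞} (hQ : ∀ s, Measurable (Q s)) :
    tailCoverage p A B (allWeaker p A B) Q Pr
      = ∑' q : BS × Link, ∫⁻ ω, {ω | A.IsServing p q.1 ω ∧ A.link p q.1 ω = q.2}.indicator
          (fun ω => Q q.2 (fadeLevel p A B (allWeaker p A B) q.1 ω)) ω ∂Pr := by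
  have hm : ∀ q : BS × Link, Measurable
      ({ω | A.IsServing p q.1 ω ∧ A.link p q.1 ω = q.2}.indicator
        fun ω => Q q.2 (fadeLevel p A B (allWeaker p A B) q.1 ω)) := fun q =>
    ((hQ q.2).comp (hA.fadeLevel p hB q.1)).indicator
      ((hA.isServing p q.1).inter (hA.link p q.1 q.2))
  rw [← lintegral_tsum fun q => (hm q).aemeasurable, tailCoverage]
  refine lintegral_congr fun ω => ?_
  rw [ENNReal.tsum_prod' (α := BS) (β := Link)]
  refine tsum_congr fun b => ?_
  by_cases h : A.IsServing p b ω
  · rw [indicator_of_mem (show b ∈ {b | A.IsServing p b ω} from h),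
      tsum_eq_single (A.link p b ω) fun s hs => indicator_of_notMem
        (s := {ω' | A.IsServing p b ω' ∧ A.link p b ω' = s}) (fun h' => hs h'.2.symm) _]
    symm
    exact indicator_of_mem (s := {ω' | A.IsServing p b ω' ∧ A.link p b ω' = A.link p b ω})
      ⟨h, rfl⟩ _
  · rw [indicator_of_notMem (show b ∉ {b | A.IsServing p b ω} from h)]
    symm
    refine ENNReal.tsum_eq_zero.2 fun s => ?_
    exact indicator_of_notMem (s := {ω' | A.IsServing p b ω' ∧ A.link p b ω' = s})
      (fun h' => h h'.1) _

end

/-! ### Conditioning on everything but the serving fading gain -/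

variable {T : Type} {Ω : Type*} {mΩ : MeasurableSpace Ω} {p : Params}
  {N : Network T Ω} {tier : T → Fin 2} {dens : T → ℝ} {Pr : Measure Ω}
  {a c : Fin 2 → T}

lemma Network.IsModel.isMeasurable (hN : N.IsModel p tier dens Pr) : N.IsMeasurable where
  loc t := (hN.poisson t).measurable
  block := hN.block_meas
  gain := hN.gain_meas
  fade := hN.fade_meas

lemma Network.IsModel.indepFun_fade_config (hN : N.IsModel p tier dens Pr) (κ : T) (i : ℕ)
    (s : Link) : IndepFun (N.fade κ i s) (N.eraseFade κ i s).config Pr := by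
  have h := indep_iSup_of_disjoint hN.sigma_le hN.indep
    (disjoint_compl_right (a := ({.fade κ i s} : Set (Source T))))
  rw [IndepFun_iff_Indep]
  refine indep_of_indep_of_le_left (indep_of_indep_of_le_right h ?_) ?_
  · exact (measurable_config_eraseFade N κ i s).comap_le
  · exact le_iSup₂ (f := fun x (_ : x ∈ ({.fade κ i s} : Set (Source T))) => N.sigma x)
      (.fade κ i s) rfl

variable [IsProbabilityMeasure Pr]

/-- Averaging over the fading of the serving link. -/
lemma Network.IsModel.measure_fadeLevel_lt (hN : N.IsModel p tier dens Pr)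
    (ha : Function.LeftInverse tier a) (hc : Function.LeftInverse tier c) (b : BS) (s : Link) :
    Pr {ω | ((N.pick a).IsServing p b ω ∧ (N.pick a).link p b ω = s) ∧
        fadeLevel p (N.pick a) (N.pick c) (allWeaker p (N.pick a) (N.pick c)) b ω
          < ENNReal.ofReal (N.fade (a b.1) b.2 s ω)}
      = ∫⁻ ω, {ω | (N.pick a).IsServing p b ω ∧ (N.pick a).link p b ω = s}.indicator
          (fun ω => p.gammaTail s
            (fadeLevel p (N.pick a) (N.pick c) (allWeaker p (N.pick a) (N.pick c)) b ω)) ω ∂Pr := by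
  let X := N.fade (a b.1) b.2 s
  let Y := (N.eraseFade (a b.1) b.2 s).config
  -- The serving event and the fading level are expressed as functions on configuration space, so
  -- that composing them with the erased configuration makes them independent of the serving gain.
  let A₀ := (coordNetwork T).pick a
  let B₀ := (coordNetwork T).pick c
  let V : Set (Config T) := {z | A₀.IsServing p b z ∧ A₀.link p b z = s}
  let Z : Config T → ℝ≥0∞ := fadeLevel p A₀ B₀ (allWeaker p A₀ B₀) b
  have hA₀ : A₀.IsMeasurable := (coordNetwork_isMeasurable T).pick a
  have hB₀ : B₀.IsMeasurable := (coordNetwork_isMeasurable T).pick c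
  have hV : MeasurableSet V := (hA₀.isServing p b).inter (hA₀.link p b s)
  have hZ : Measurable Z := hA₀.fadeLevel p hB₀ b
  have hX : Measurable X := hN.fade_meas _ _ _
  have hY : Measurable Y := (measurable_config_eraseFade N (a b.1) b.2 s).mono
    (iSup₂_le fun x _ => hN.sigma_le x) le_rfl
  -- Association and link state do not involve fading, so erasing a gain leaves them unchanged by
  -- definition.
  have hVY : ∀ ω, Y ω ∈ V ↔ (N.pick a).IsServing p b ω ∧ (N.pick a).link p b ω = s :=
    fun ω => Iff.rfl
  have hZY : ∀ ω, Z (Y ω)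
      = fadeLevel p (N.pick a) (N.pick c) (allWeaker p (N.pick a) (N.pick c)) b ω :=
    fun ω => fadeLevel_eraseFade ha hc N b s ω
  let S : Set (ℝ × Config T) := {z | z.2 ∈ V ∧ Z z.2 < ENNReal.ofReal z.1}
  have hS : MeasurableSet S := (measurable_snd hV).inter
    (measurableSet_lt (hZ.comp measurable_snd) measurable_fst.ennreal_ofReal)
  have hmap := (indepFun_iff_map_prod_eq_prod_map_map hX.aemeasurable hY.aemeasurable).1
    (hN.indepFun_fade_config (a b.1) b.2 s)
  have h1 : Pr {ω | ((N.pick a).IsServing p b ω ∧ (N.pick a).link p b ω = s) ∧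
        fadeLevel p (N.pick a) (N.pick c) (allWeaker p (N.pick a) (N.pick c)) b ω
          < ENNReal.ofReal (X ω)} = Pr.map (fun ω => (X ω, Y ω)) S := by
    rw [Measure.map_apply (hX.prodMk hY) hS]
    congr 1
    ext ω
    refine and_congr (hVY ω).symm ?_
    rw [← hZY ω]
  have : IsProbabilityMeasure (Pr.map X) := Measure.isProbabilityMeasure_map hX.aemeasurable
  have : IsProbabilityMeasure (Pr.map Y) := Measure.isProbabilityMeasure_map hY.aemeasurable
  have h2 : ∀ y, Pr.map X ((fun x => (x, y)) ⁻¹' S) = V.indicator (fun y => p.gammaTail s (Z y)) y := by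
    intro y
    by_cases hy : y ∈ V
    · rw [indicator_of_mem hy, Params.gammaTail, hN.fade_law]
      congr 1
      ext x
      exact and_iff_right hy
    · rw [indicator_of_notMem hy]
      have : (fun x => (x, y)) ⁻¹' S = ∅ := by
        ext x
        exact ⟨fun h => hy h.1, fun h => h.elim⟩
      rw [this, measure_empty]
  refine h1.trans ?_
  rw [hmap, Measure.prod_apply_symm hS]
  simp_rw [h2]
  have hm : Measurable (V.indicator fun y => p.gammaTail s (Z y)) :=
    ((p.measurable_gammaTail s).comp hZ).indicator hV
  rw [lintegral_map hm hY]
  refine lintegral_congr fun ω => ?_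
  let V' : Set Ω := {ω | (N.pick a).IsServing p b ω ∧ (N.pick a).link p b ω = s}
  change _ = V'.indicator _ ω
  by_cases h : Y ω ∈ V
  · rw [indicator_of_mem h, indicator_of_mem (s := V') ((hVY ω).1 h), hZY]
  · rw [indicator_of_notMem h, indicator_of_notMem (s := V') fun h' => h ((hVY ω).2 h')]

/-- The coverage probability is the average of the tail of the channel gain. -/
theorem Network.IsModel.coverageProb_eq (hN : N.IsModel p tier dens Pr)
    (ha : Function.LeftInverse tier a) (hc : Function.LeftInverse tier c) :
    coverageProb p (N.pick a) (N.pick c) (allWeaker p (N.pick a) (N.pick c)) Pr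
      = tailCoverage p (N.pick a) (N.pick c) (allWeaker p (N.pick a) (N.pick c)) p.gammaTail Pr := by
  have hA := hN.isMeasurable.pick a
  have hB := hN.isMeasurable.pick c
  rw [coverageProb_eq_tsum hA hB, tailCoverage_eq_tsum hA hB p.measurable_gammaTail]
  exact tsum_congr fun q => hN.measure_fadeLevel_lt ha hc q.1 q.2

end MmWave

end

/-! ### The main theorem -/

theorem theorem1 (p : MmWave.Params) {Ω : Type*} [MeasurableSpace Ω]
    (Pr : MeasureTheory.Measure Ω) [MeasureTheory.IsProbabilityMeasure Pr] :
    -- one MBS tier; SBSs of density `λ_PHP` for association, independent SBSs of the baseline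
    -- density `λ₂` for interference
    (∀ N : MmWave.Network (Fin 3) Ω,
      N.IsModel p ![0, 1, 1] ![p.dens1, p.densPHP, p.dens2] Pr →
      let A := N.pick ![0, 1]
      let B := N.pick ![0, 2]
      MmWave.coverageProb p A B (MmWave.allWeaker p A B) Pr
          = MmWave.tailCoverage p A B (MmWave.allWeaker p A B) p.gammaTail Pr ∧
        (MmWave.tailCoverage p A B (MmWave.allWeaker p A B) p.approxTail Pr).toReal
          = p.formula ![p.dens1, p.densPHP] ![p.dens1, p.dens2]) ∧
    -- two independent PPP tiers, the SBSs having density `λ₂` or `λ_PHP` throughout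
    (∀ dens ∈ ({p.dens2, p.densPHP} : Set ℝ), ∀ N : MmWave.Network (Fin 2) Ω,
      N.IsModel p ![0, 1] ![p.dens1, dens] Pr →
      MmWave.coverageProb p N N MmWave.allOthers Pr
          = MmWave.tailCoverage p N N MmWave.allOthers p.gammaTail Pr ∧
        (MmWave.tailCoverage p N N MmWave.allOthers p.approxTail Pr).toReal
          = p.formula ![p.dens1, dens] ![p.dens1, dens]) ∧
    -- the integrals in the formulas converge
    (∀ densA ∈ ({p.dens2, p.densPHP} : Set ℝ), ∀ densI ∈ ({p.dens2, p.densPHP} : Set ℝ),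
      ∀ k s, ∀ n ∈ Finset.Icc 1 (p.nu s),
        MeasureTheory.IntegrableOn (p.integrand ![p.dens1, densA] ![p.dens1, densI] k s n)
          (Set.Ioi 0)) := by
  have h1 := p.dens1_pos.le
  have h2 : ∀ d ∈ ({p.dens2, p.densPHP} : Set ℝ), 0 ≤ d := by
    rintro d (rfl | rfl)
    · exact p.dens2_pos.le
    · exact p.densPHP_pos.le
  have hvec : ∀ d ∈ ({p.dens2, p.densPHP} : Set ℝ), ∀ j, 0 ≤ (![p.dens1, d] : Fin 2 → ℝ) j :=
    fun d hd j => by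
      fin_cases j
      · exact h1
      · exact h2 d hd
  have hPHP : p.densPHP ∈ ({p.dens2, p.densPHP} : Set ℝ) := Or.inr rfl
  refine ⟨fun N hN => ?_, fun d hd N hN => ?_, fun dA hA dI hI k s n _ =>
    p.integrableOn_integrand (hvec dA hA) (hvec dI hI) k s n⟩
  -- The three processes are the MBSs, the SBSs for association and the SBSs for interference; the
  -- MBSs are shared by both selections.
  · have ha : Function.LeftInverse (![0, 1, 1] : Fin 3 → Fin 2) ![0, 1] := fun j => by
      fin_cases j <;> rfl
    have hc : Function.LeftInverse (![0, 1, 1] : Fin 3 → Fin 2) ![0, 2] := fun j => by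
      fin_cases j <;> rfl
    have hdens : ∀ t, 0 ≤ (![p.dens1, p.densPHP, p.dens2] : Fin 3 → ℝ) t := fun t => by
      fin_cases t
      · exact h1
      · exact p.densPHP_pos.le
      · exact p.dens2_pos.le
    refine ⟨hN.coverageProb_eq ha hc, (hN.toReal_tailCoverage_approxTail ha hc hdens).trans ?_⟩
    congr 1 <;> ext j <;> fin_cases j <;> rfl
  -- With one network, both selections are the identity, and `N.pick id` is `N` by definition.
  · have ha : Function.LeftInverse (![0, 1] : Fin 2 → Fin 2) id := fun j => by
      fin_cases j <;> rfl
    rw [MmWave.coverageProb_allOthers, MmWave.tailCoverage_allOthers,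
      MmWave.tailCoverage_allOthers]
    exact ⟨hN.coverageProb_eq ha ha, hN.toReal_tailCoverage_approxTail ha ha (hvec d hd)⟩
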